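/- Let $d\ge 1$, and for a function $f$ on $\mathbb R^d$ put $(\mathcal F f)(\xi)=(2\pi)^{-d/2}\int_{\mathbb R^d} f(x)e^{-i\xi\cdot x}\,dx$. Let $\{\phi_\ell\}_{\ell\in\mathbb Z}$ be a family of (complex-valued) Schwartz functions on $\mathbb R^d$ such that $(\mathcal F\phi_0)(\xi)\neq 0$ only if $|\xi|\in(2^{-1},2)$, $(\mathcal F\phi_\ell)(\xi)=(\mathcal F\phi_0)(2^{-\ell}\xi)$ for all $\xi$ and $\ell$, and $\sum_{\ell\in\mathbb Z}(\mathcal F\phi_\ell)(\xi)=1$ for all $\xi\ne0$. Then there is a constant $C<\infty$, depending only on $d$ and on the family $\{\phi_\ell\}$, such that the following holds for all $L>0$, $\kappa>0$, $s\in[0,1]$ and $\ell\in\mathbb Z$. Write $\langle f\rangle=L^{-d}\int_{[0,L]^d}f\,dx$ for the spatial average. All functions of $x$ below are $[0,L]^d$-periodic and measurable. For a periodic vector field $v$ put $\langle|\nabla^s v|^2\rangle=\sum_{m\in\frac{2\pi}{L}\mathbb Z^d}|m|^{2s}|\hat v(m)|^2$, where $\hat v(m)=\langle v\,e^{-im\cdot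 x}\rangle$ (and $0^0=1$). Let $u\in L^2((0,T)\times[0,L]^d;\mathbb R^d)$ for all $T<\infty$, with $\operatorname{div}u(t)=0$ in the sense of distributions for a.e. $t>0$, and with $\langle|\nabla^su(t)|^2\rangle^{1/2}=G_s$ for a.e. $t>0$, where $G_s\in[0,\infty)$ does not depend on $t$. Let $\theta_0\in L^1([0,L]^d)$ and let $\theta$, with $\theta,\nabla\theta\in L^2((0,T)\times[0,L]^d)$ for all $T<\infty$ ($\nabla$ is the weak spatial gradient), be a real-valued weak solution on $(0,\infty)$ of $$\partial_t\theta+u\cdot\nabla\theta-\kappa\Delta\theta=0,\qquad \theta(0,\cdot)=\theta_0,$$ that is, for every smooth $\eta=\eta(t,x)$ that is periodic in $x$ and vanishes for all large $t$, $$\int_0^\infty\!\!\int_{[0,L]^d}\bigl(\theta\,\partial_t\eta-(u\cdot\nabla\theta)\,\eta-\kappa\nabla\theta\cdot\nabla\eta\bigr)\,dx\,dt+\int_{[0,L]^d}\theta_0\,\eta(0,\cdot)\,dx=0 .$$ Let $\varphi:[0,\infty)\to[0,\infty)$ be nondecreasing and locally absolutely continuous, and for a nonnegative function $f=f(t,x)$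 (or $f=f(t)$, in which case $\langle f\rangle=f$) put $$\langle\langle f\rangle\rangle_\varphi=\limsup_{T\to\infty}\frac1T\int_0^T\langle f\rangle\,e^{\varphi(t)}\,dt\in[0,\infty].$$ Let $\theta_\ell=\phi_\ell*\theta$ (convolution in space) be the Littlewood--Paley projection. Then $$\langle\langle|\theta_\ell|\rangle\rangle_\varphi\le C\,\kappa^{-1}\Bigl(2^{-(s+2)\ell}\langle|\nabla^su|^2\rangle^{1/2}+2^{-3\ell}\Bigl\|\frac{d\varphi}{dt}\Bigr\|_{L^\infty(0,\infty)}\Bigr)\,\langle\langle\,\langle|\nabla\theta|^2\rangle^{1/2}\,\rangle\rangle_\varphi ,$$ as an inequality in $[0,\infty]$ with the convention $0\cdot\infty=0$. -/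

import Mathlib

open MeasureTheory Set Filter
open scoped ENNReal NNReal ContDiff SchwartzMap

noncomputable section

namespace PassiveScalar

/-- The Euclidean space of dimension `d`. -/
abbrev Space (d : ℕ) : Type := EuclideanSpace ℝ (Fin d)

/-- The periodicity cell, the box with side length `L`. -/
def cell (d : ℕ) (L : ℝ) : Set (Space d) := {x | ∀ i, x i ∈ Icc (0 : ℝ) L}

/-- `f` is `L`-periodic in every coordinate direction. -/
def IsPeriodic {d : ℕ} {α : Type*} (L : ℝ) (f : Space d → α) : Prop :=
  ∀ (i : Fin d) (x : Space d), f (x + EuclideanSpace.single i L) = f x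

/-- The spatial average of a nonnegative function over the cell. -/
def spaceAvg {d : ℕ} (L : ℝ) (f : Space d → ℝ≥0∞) : ℝ≥0∞ :=
  ENNReal.ofReal ((L ^ d)⁻¹) * ∫⁻ x in cell d L, f x

/-- The weighted long-time average, with weight `exp (φ t)`, of a nonnegative function of time. -/
def longTimeAvg (φ : ℝ → ℝ) (f : ℝ → ℝ≥0∞) : ℝ≥0∞ :=
  limsup (fun T : ℝ => ENNReal.ofReal T⁻¹ *
    ∫⁻ t in Ioc 0 T, f t * ENNReal.ofReal (Real.exp (φ t))) atTop

/-- The wave number `(2 π / L) k` attached to the integer vector `k`. -/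
def waveVector {d : ℕ} (L : ℝ) (k : Fin d → ℤ) : Space d :=
  WithLp.toLp 2 fun i => 2 * Real.pi / L * (k i : ℝ)

/-- The Fourier coefficient of a periodic function at the wave number `(2 π / L) k`. -/
def fourierCoefficient {d : ℕ} (L : ℝ) (f : Space d → ℝ) (k : Fin d → ℤ) : ℂ :=
  (((L ^ d)⁻¹ : ℝ) : ℂ) * ∫ x in cell d L,
    (f x : ℂ) * Complex.exp (-Complex.I * ((inner ℝ (waveVector L k) x : ℝ) : ℂ))

/-- The mean square of the fractional gradient of order `s` of a periodic vector field, defined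
through its Fourier coefficients. -/
def fracGradSq {d : ℕ} (L s : ℝ) (v : Space d → Space d) : ℝ≥0∞ :=
  ∑' k : Fin d → ℤ, ENNReal.ofReal (‖waveVector L k‖ ^ (2 * s)) *
    ∑ i : Fin d, ‖fourierCoefficient L (fun x => v x i) k‖ₑ ^ 2

/-- The Fourier transform on the whole space, in the unitary normalization. -/
def fourierTransform {d : ℕ} (f : Space d → ℂ) (ξ : Space d) : ℂ :=
  (((2 * Real.pi) ^ (-(d : ℝ) / 2) : ℝ) : ℂ) *
    ∫ x, f x * Complex.exp (-Complex.I * ((inner ℝ ξ x : ℝ) : ℂ))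

/-- A family of Schwartz functions generating a (homogeneous) Littlewood--Paley decomposition. -/
structure IsLittlewoodPaleyFamily {d : ℕ} (Φ : ℤ → 𝓢(Space d, ℂ)) : Prop where
  support : ∀ ξ, fourierTransform (Φ 0) ξ ≠ 0 → ‖ξ‖ ∈ Ioo ((2 : ℝ)⁻¹) 2
  scaling : ∀ (l : ℤ) (ξ : Space d),
    fourierTransform (Φ l) ξ = fourierTransform (Φ 0) (((2 : ℝ) ^ (-l)) • ξ)
  partition : ∀ ξ : Space d, ξ ≠ 0 → HasSum (fun l : ℤ => fourierTransform (Φ l) ξ) 1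

/-- The Littlewood--Paley projection: convolution in space with the `l`-th Schwartz function. -/
def lpProj {d : ℕ} (Φ : ℤ → 𝓢(Space d, ℂ)) (l : ℤ) (f : Space d → ℝ) (x : Space d) : ℂ :=
  ∫ y, Φ l y * (f (x - y) : ℂ)

/-- `v` is weakly divergence-free (as a periodic vector field). -/
def WeakDivFree {d : ℕ} (L : ℝ) (v : Space d → Space d) : Prop :=
  ∀ ψ : Space d → ℝ, ContDiff ℝ ∞ ψ → IsPeriodic L ψ →
    ∫ x in cell d L, inner ℝ (v x) (gradient ψ x) = 0

/-- `g` is the weak gradient of `f` (as periodic functions). -/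
def IsWeakGradient {d : ℕ} (L : ℝ) (f : Space d → ℝ) (g : Space d → Space d) : Prop :=
  ∀ ψ : Space d → ℝ, ContDiff ℝ ∞ ψ → IsPeriodic L ψ → ∀ i : Fin d,
    ∫ x in cell d L, f x * gradient ψ x i = -∫ x in cell d L, g x i * ψ x

/-- Square integrability on `(0, T) × cell` for every finite time `T`. -/
def LocallySquareIntegrable {d : ℕ} {F : Type*} [NormedAddCommGroup F] (L : ℝ)
    (f : ℝ → Space d → F) : Prop :=
  ∀ T : ℝ, MemLp (fun p : ℝ × Space d => f p.1 p.2) 2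
    ((volume.restrict (Ioo 0 T)).prod (volume.restrict (cell d L)))

/-- Time-dependent, periodic, divergence-free velocity fields. No smoothness is assumed. -/
structure IsVelocityField {d : ℕ} (L : ℝ) (u : ℝ → Space d → Space d) : Prop where
  measurable : Measurable fun p : ℝ × Space d => u p.1 p.2
  periodic : ∀ t, IsPeriodic L (u t)
  sqIntegrable : LocallySquareIntegrable L u
  divFree : ∀ᵐ t ∂volume.restrict (Ioi (0 : ℝ)), WeakDivFree L (u t)

/-- Space-time test functions: smooth, periodic in space, vanishing for large times (but not
necessarily at the initial time). -/
structure IsTestFunction {d : ℕ} (L : ℝ) (η : ℝ → Space d → ℝ) : Prop where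
  smooth : ContDiff ℝ ∞ fun p : ℝ × Space d => η p.1 p.2
  periodic : ∀ t, IsPeriodic L (η t)
  support : ∃ T : ℝ, ∀ t, T ≤ t → ∀ x, η t x = 0

/-- `θ`, with weak spatial gradient `Dθ`, is a weak solution on the time interval `(0, ∞)` of the
periodic advection-diffusion equation `∂ₜθ + u ⬝ ∇θ - κ Δθ = 0` with initial datum `θ₀`. -/
structure IsWeakSolution {d : ℕ} (L κ : ℝ) (u : ℝ → Space d → Space d) (θ₀ : Space d → ℝ)
    (θ : ℝ → Space d → ℝ) (Dθ : ℝ → Space d → Space d) : Prop where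
  initial_measurable : Measurable θ₀
  initial_periodic : IsPeriodic L θ₀
  initial_integrable : IntegrableOn θ₀ (cell d L)
  measurable : Measurable fun p : ℝ × Space d => θ p.1 p.2
  periodic : ∀ t, IsPeriodic L (θ t)
  sqIntegrable : LocallySquareIntegrable L θ
  grad_measurable : Measurable fun p : ℝ × Space d => Dθ p.1 p.2
  grad_periodic : ∀ t, IsPeriodic L (Dθ t)
  grad_sqIntegrable : LocallySquareIntegrable L Dθ
  weakGradient : ∀ᵐ t ∂volume.restrict (Ioi (0 : ℝ)), IsWeakGradient L (θ t) (Dθ t)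
  equation : ∀ η : ℝ → Space d → ℝ, IsTestFunction L η →
    (∫ t in Ioi (0 : ℝ), ∫ x in cell d L,
        (θ t x * deriv (fun τ => η τ x) t - inner ℝ (u t x) (Dθ t x) * η t x
          - κ * inner ℝ (Dθ t x) (gradient (η t) x)))
      + ∫ x in cell d L, θ₀ x * η 0 x = 0

/-- Time weight exponents: nonnegative, nondecreasing, locally absolutely continuous functions
on `[0, ∞)`. -/
structure IsTimeWeight (φ : ℝ → ℝ) : Prop where
  nonneg : ∀ t, 0 ≤ t → 0 ≤ φ t
  monotone : MonotoneOn φ (Ici 0)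
  absCont : ∀ T : ℝ, 0 < T → AbsolutelyContinuousOnInterval φ 0 T

end PassiveScalar

end

/-! The projection solves `∂ₜθ_ℓ - κΔθ_ℓ = -φ_ℓ * (u·∇θ)`, and its spatial L¹ norm `q(t)` is
followed over time windows of length `τ = N 4^{-ℓ}/κ`, a large multiple of the diffusive time at
frequency `2^ℓ`. Write `Y = ⟨|∇θ|²⟩^{1/2}`. Two effects compete on a window.

Diffusion: on functions with frequencies `|ξ| ~ 2^ℓ`, the heat flow over one window is convolution
with a kernel of L¹ norm at most δ, where δ is as small as desired once `N` is large
(`IsLittlewoodPaleyFamily.exists_contracting_kernel`).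

Transport: on a window ending at `b`, let `w(t)` be the heat flow over the remaining time `b - t`
applied to `θ_ℓ(t)`. Then `∂ₜw = -k * (u·∇θ)`, with `k` the projection kernel propagated by that
flow. Testing with a regularized sign of `w`, incompressibility annihilates `u·∇w`, so only the
commutator `k * (u·∇θ) - u·∇(k * θ)` counts. It equals `∫ k(y) (u(x-y) - u(x))·∇θ(x-y) dy`.
Cauchy–Schwarz, together with the Plancherel bound of `u(·-y) - u` in L² by `2|y|^s ⟨|∇^s
u|²⟩^{1/2}`, estimates it by `C 2^{-sℓ} G_s Y` (`enorm_integral_transport_le`). The propagated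
kernels have the required weighted L¹ bounds uniformly in `ℓ` after rescaling.

Together these give `q(a+τ) ≤ 2δ q(a) + C 2^{-sℓ} G_s ∫_a^{a+τ} Y`
(`IsWeakSolution.exists_ae_recursion`). If `τ ‖φ'‖_∞ ≤ 1`, the weight `e^φ` grows at most by the
factor `e` over a window. Integration in `a` and absorption then bound the weighted average of `q`
by `C 2^{-sℓ} G_s τ` times that of `Y` (`longTimeAvg_le_of_recursion`), and `τ` provides the factor
`κ⁻¹ 2^{-2ℓ}`. If `τ ‖φ'‖_∞ ≥ 1`, the elementary bound `q ≤ C 2^{-ℓ} Y` suffices, as its right side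
may be multiplied by `τ ‖φ'‖_∞`.

The low regularity causes no trouble because `θ_ℓ` is a trigonometric polynomial with a fixed finite
set of modes. Each mode, multiplied by `e^{κ|m|²t}`, agrees for a.e. `t` with the primitive of a
locally integrable function (`IsWeakSolution.exists_mode_eq_primitive`), so the evolution is one of
absolutely continuous functions of time. -/

noncomputable section

namespace PassiveScalar

/-! ### Periodic functions as functions on the unit torus: translation, Parseval, density. -/

section Torus

open scoped Topology ComplexConjugate Pointwise

attribute [local instance] instMeasureSpaceUnitAddCircle

local instance isProbabilityMeasure_unitAddCircle :
    IsProbabilityMeasure (volume : Measure UnitAddCircle) :=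
  inferInstanceAs (IsProbabilityMeasure AddCircle.haarAddCircle)

local instance isAddHaarMeasure_unitAddCircle :
    Measure.IsAddHaarMeasure (volume : Measure UnitAddCircle) :=
  inferInstanceAs (Measure.IsAddHaarMeasure AddCircle.haarAddCircle)

/-- The normalized Lebesgue measure on the cell. -/
def cellMeasure (d : ℕ) (L : ℝ) : Measure (Space d) :=
  ENNReal.ofReal ((L ^ d)⁻¹) • volume.restrict (cell d L)

/-- The covering map of the unit torus, scaled to period `L`. -/
def toTorus {d : ℕ} (L : ℝ) (x : Space d) : UnitAddTorus (Fin d) :=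
  fun i => ((x i / L : ℝ) : UnitAddCircle)

/-- A section of the covering map `toTorus`. -/
def ofTorus {d : ℕ} (L : ℝ) (q : UnitAddTorus (Fin d)) : Space d :=
  WithLp.toLp 2 fun i => L * (AddCircle.equivIco (1 : ℝ) 0 (q i) : ℝ)

variable {d : ℕ} {L : ℝ}

theorem continuous_toTorus : Continuous (toTorus L : Space d → UnitAddTorus (Fin d)) := by
  unfold toTorus
  refine continuous_pi fun i => ?_
  exact (AddCircle.continuous_mk' (1 : ℝ)).comp (by fun_prop)

theorem measurable_ofTorus : Measurable (ofTorus L : UnitAddTorus (Fin d) → Space d) := by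
  unfold ofTorus
  refine (MeasurableEquiv.toLp 2 (Fin d → ℝ)).measurable.comp ?_
  refine measurable_pi_lambda _ fun i => ?_
  refine Measurable.const_mul ?_ L
  exact (measurable_subtype_coe.comp (AddCircle.measurableEquivIco 1 0).measurable).comp
    (measurable_pi_apply i)

theorem IsPeriodic.add_zsmul {α : Type*} {f : Space d → α} (hf : IsPeriodic L f)
    (i : Fin d) (n : ℤ) (x : Space d) : f (x + EuclideanSpace.single i (n * L)) = f x := by
  have hp : Function.Periodic f (EuclideanSpace.single i L) := fun x => hf i x
  have := hp.zsmul n x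
  rw [← this]
  congr 2
  ext j
  by_cases h : j = i <;> simp [h]

theorem IsPeriodic.add_lattice {α : Type*} {f : Space d → α} (hf : IsPeriodic L f)
    (n : Fin d → ℤ) (x : Space d) (s : Finset (Fin d)) :
    f (x + ∑ i ∈ s, EuclideanSpace.single i (n i * L)) = f x := by
  classical
  induction s using Finset.induction_on with
  | empty => simp
  | insert i s hi ih =>
    rw [Finset.sum_insert hi, add_comm (EuclideanSpace.single i _), ← add_assoc,
      hf.add_zsmul, ih]

theorem toTorus_ofTorus (hL : 0 < L) (q : UnitAddTorus (Fin d)) : toTorus L (ofTorus L q) = q := by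
  ext i
  simp only [toTorus, ofTorus]
  rw [mul_div_cancel_left₀ _ hL.ne']
  exact (AddCircle.equivIco (1 : ℝ) 0).symm_apply_apply (q i)

/-- The fibres of the covering map are cosets of the period lattice, so periodic functions factor
through the torus. -/
theorem IsPeriodic.eq_of_toTorus_eq {α : Type*} {f : Space d → α} (hf : IsPeriodic L f)
    (hL : 0 < L) {x y : Space d} (h : toTorus L x = toTorus L y) : f x = f y := by
  have h1 : ∀ i, ∃ n : ℤ, x i = y i + n * L := by
    intro i
    have := congrFun h i
    simp only [toTorus] at this
    rw [← sub_eq_zero, ← AddCircle.coe_sub, AddCircle.coe_eq_zero_iff] at this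
    obtain ⟨n, hn⟩ := this
    refine ⟨n, ?_⟩
    rw [← sub_div, eq_div_iff hL.ne'] at hn
    simp only [zsmul_eq_mul, mul_one] at hn
    linarith
  choose n hn using h1
  rw [← hf.add_lattice n y Finset.univ]
  congr 1
  ext j
  rw [hn j]
  simp [Finset.sum_apply]

theorem IsPeriodic.eq_comp_toTorus {α : Type*} {f : Space d → α} (hf : IsPeriodic L f)
    (hL : 0 < L) : f = (fun q => f (ofTorus L q)) ∘ toTorus L := by
  ext x
  exact hf.eq_of_toTorus_eq hL (toTorus_ofTorus hL _).symm

theorem isPeriodic_comp_toTorus {α : Type*} (hL : 0 < L) (F : UnitAddTorus (Fin d) → α) :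
    IsPeriodic L (F ∘ toTorus L) := by
  intro i x
  simp only [Function.comp]
  congr 1
  ext j
  by_cases h : j = i
  · subst h
    simp [toTorus, add_div, hL.ne']
  · simp [toTorus, h]

/-- This carries the Fourier and Haar measure theory of the torus over to the cell. It reduces to
the known unfolding of the torus over the half-open unit cube, by the scaling `x ↦ x / L`. -/
theorem measurePreserving_toTorus (hL : 0 < L) :
    MeasurePreserving (toTorus L) (cellMeasure d L) volume := by
  refine ⟨continuous_toTorus.measurable, Measure.ext fun s hs => ?_⟩
  rw [Measure.map_apply continuous_toTorus.measurable hs]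
  set q : (Fin d → ℝ) → UnitAddTorus (Fin d) := fun x i => ((x i : ℝ) : UnitAddCircle) with hq
  have hqm : Measurable q := (continuous_pi fun i =>
    (AddCircle.continuous_mk' (1 : ℝ)).comp (continuous_apply i)).measurable
  have hvol : volume s = volume ((pi univ fun _ : Fin d => Ioc (0 : ℝ) 1) ∩ q ⁻¹' s) := by
    have h := UnitAddTorus.lintegral_preimage (s.indicator 1) (fun _ : Fin d => (0 : ℝ))
    rw [lintegral_indicator_one hs] at h
    rw [h]
    have hb : {x : Fin d → ℝ | ∀ i, x i ∈ Ioc (0 : ℝ) (0 + 1)} =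
        pi univ fun _ : Fin d => Ioc (0 : ℝ) 1 := by ext x; simp
    rw [hb]
    have h2 : ∀ x : Fin d → ℝ, s.indicator (1 : UnitAddTorus (Fin d) → ℝ≥0∞) (fun i => (x i : UnitAddCircle)) =
        (q ⁻¹' s).indicator 1 x := fun x => rfl
    simp_rw [h2]
    rw [lintegral_indicator_one (hqm hs), Measure.restrict_apply (hqm hs), inter_comm]
  have hcell : volume (toTorus L ⁻¹' s ∩ cell d L) =
      volume ((pi univ fun _ : Fin d => Icc (0 : ℝ) L) ∩ (fun x i => x i / L) ⁻¹' (q ⁻¹' s)) := by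
    rw [← (EuclideanSpace.volume_preserving_symm_measurableEquiv_toLp (Fin d)).measure_preimage]
    · congr 1
      ext x
      simp only [cell, mem_Icc, mem_inter_iff, mem_preimage, mem_ofPred_eq, Set.mem_pi, mem_univ,
        forall_const, hq]
      exact and_comm
    · refine MeasurableSet.nullMeasurableSet ?_
      refine (MeasurableSet.univ_pi fun _ => measurableSet_Icc).inter ?_
      exact (measurable_pi_lambda _ fun i => (measurable_pi_apply i).div_const L) (hqm hs)
  -- The closed cell covers its opposite faces twice, but the faces are null.
  have hae : volume ((pi univ fun _ : Fin d => Icc (0 : ℝ) L) ∩ (fun x i => x i / L) ⁻¹' (q ⁻¹' s))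
      = volume ((pi univ fun _ : Fin d => Ioc (0 : ℝ) L) ∩ (fun x i => x i / L) ⁻¹' (q ⁻¹' s)) := by
    refine measure_congr (Filter.EventuallyEq.inter ?_ (ae_eq_refl _))
    exact Measure.pi_Ioc_ae_eq_pi_Icc.symm
  have hsc : ((pi univ fun _ : Fin d => Ioc (0 : ℝ) L) ∩ (fun x i => x i / L) ⁻¹' (q ⁻¹' s)) =
      L • ((pi univ fun _ : Fin d => Ioc (0 : ℝ) 1) ∩ q ⁻¹' s) := by
    ext x
    rw [mem_smul_set_iff_inv_smul_mem₀ hL.ne']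
    have : ∀ i, x i / L = L⁻¹ * x i := fun i => by rw [div_eq_inv_mul]
    simp only [mem_inter_iff, Set.mem_pi, mem_univ, forall_const, mem_Ioc, mem_preimage,
      Pi.smul_apply, smul_eq_mul, this]
    have h3 : (fun i => L⁻¹ * x i) = L⁻¹ • x := rfl
    rw [h3]
    refine and_congr (forall_congr' fun i => ?_) Iff.rfl
    refine and_congr ?_ ?_
    · simp [hL]
    · rw [inv_mul_le_iff₀ hL, mul_one]
  rw [cellMeasure, Measure.smul_apply, Measure.restrict_apply (continuous_toTorus.measurable hs),
    hcell, hae, hsc, Measure.addHaar_smul, hvol, smul_eq_mul, ← mul_assoc,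
    ← ENNReal.ofReal_mul (by positivity)]
  have : (L ^ d)⁻¹ * |L ^ Module.finrank ℝ (Fin d → ℝ)| = 1 := by
    rw [Module.finrank_fin_fun, abs_of_pos (by positivity)]
    exact inv_mul_cancel₀ (by positivity)
  rw [this, ENNReal.ofReal_one, one_mul]

theorem isProbabilityMeasure_cellMeasure (hL : 0 < L) : IsProbabilityMeasure (cellMeasure d L) := by
  refine ⟨?_⟩
  rw [← preimage_univ (f := toTorus (d := d) L),
    (measurePreserving_toTorus hL).measure_preimage MeasurableSet.univ.nullMeasurableSet]
  exact measure_univ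

theorem spaceAvg_eq_lintegral (f : Space d → ℝ≥0∞) : spaceAvg L f = ∫⁻ x, f x ∂cellMeasure d L := by
  rw [spaceAvg, cellMeasure, lintegral_smul_measure, smul_eq_mul]

theorem integral_cellMeasure {E : Type*} [NormedAddCommGroup E] [NormedSpace ℝ E] (hL : 0 < L)
    (f : Space d → E) : ∫ x, f x ∂cellMeasure d L = (L ^ d)⁻¹ • ∫ x in cell d L, f x := by
  rw [cellMeasure, integral_smul_measure, ENNReal.toReal_ofReal (by positivity)]

theorem setIntegral_cell {E : Type*} [NormedAddCommGroup E] [NormedSpace ℝ E] (hL : 0 < L)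
    (f : Space d → E) : ∫ x in cell d L, f x = (L ^ d) • ∫ x, f x ∂cellMeasure d L := by
  rw [integral_cellMeasure hL, smul_smul, mul_inv_cancel₀ (by positivity), one_smul]

/-- The covering map is a homomorphism, so translation on the cell becomes translation on the torus,
where Haar measure is invariant. -/
theorem lintegral_comp_sub (hL : 0 < L) {f : Space d → ℝ≥0∞} (hf : Measurable f)
    (hp : IsPeriodic L f) (y : Space d) :
    ∫⁻ x, f (x - y) ∂cellMeasure d L = ∫⁻ x, f x ∂cellMeasure d L := by
  set F : UnitAddTorus (Fin d) → ℝ≥0∞ := fun q => f (ofTorus L q)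
  have hF : Measurable F := hf.comp measurable_ofTorus
  have hfF : ∀ x, f x = F (toTorus L x) := fun x => congrFun (hp.eq_comp_toTorus hL) x
  have hsub : ∀ x, toTorus L (x - y) = toTorus L x - toTorus L y := by
    intro x; ext i; simp [toTorus, sub_div]
  simp_rw [hfF, hsub]
  rw [(measurePreserving_toTorus hL).lintegral_comp hF,
    (measurePreserving_toTorus hL).lintegral_comp
      (f := fun q => F (q - toTorus L y)) (hF.comp (measurable_id.sub_const _)),
    lintegral_sub_right_eq_self]

/-- The exponential with wave number `(2 π / L) k`. -/
def expWave {d : ℕ} (L : ℝ) (k : Fin d → ℤ) (x : Space d) : ℂ :=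
  Complex.exp (Complex.I * ((inner ℝ (waveVector L k) x : ℝ) : ℂ))

theorem expWave_eq_mFourier (k : Fin d → ℤ) (x : Space d) :
    expWave L k x = UnitAddTorus.mFourier k (toTorus L x) := by
  simp only [expWave, UnitAddTorus.mFourier, ContinuousMap.coe_mk, toTorus, fourier_coe_apply]
  rw [← Complex.exp_sum]
  congr 1
  simp only [PiLp.inner_apply, waveVector, RCLike.inner_apply, conj_trivial]
  push_cast
  rw [Finset.mul_sum]
  refine Finset.sum_congr rfl fun i _ => ?_
  ring

theorem isPeriodic_expWave (hL : 0 < L) (k : Fin d → ℤ) : IsPeriodic L (expWave L k) := by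
  have : expWave L k = UnitAddTorus.mFourier k ∘ toTorus L := by
    ext x; exact expWave_eq_mFourier k x
  rw [this]
  exact isPeriodic_comp_toTorus hL _

theorem norm_expWave (k : Fin d → ℤ) (x : Space d) : ‖expWave L k x‖ = 1 := by
  rw [expWave, mul_comm, Complex.norm_exp_ofReal_mul_I]

theorem expWave_sub (k : Fin d → ℤ) (x y : Space d) :
    expWave L k (x - y) = expWave L k x * expWave L k (-y) := by
  simp only [expWave]
  rw [← Complex.exp_add]
  congr 1
  simp only [inner_sub_right, inner_neg_right]
  push_cast
  ring

theorem conj_expWave (k : Fin d → ℤ) (x : Space d) : conj (expWave L k x) = expWave L k (-x) := by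
  simp only [expWave, ← Complex.exp_conj, map_mul, Complex.conj_I, Complex.conj_ofReal,
    inner_neg_right, Complex.ofReal_neg]
  congr 1
  ring

theorem contDiff_expWave (k : Fin d → ℤ) : ContDiff ℝ ∞ (expWave L k : Space d → ℂ) := by
  unfold expWave
  have : ContDiff ℝ ∞ fun x : Space d => ((inner ℝ (waveVector L k) x : ℝ) : ℂ) :=
    Complex.ofRealCLM.contDiff.comp (contDiff_const.inner ℝ contDiff_id)
  exact (contDiff_const.mul this).cexp

theorem continuous_expWave (k : Fin d → ℤ) : Continuous (expWave L k : Space d → ℂ) :=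
  (contDiff_expWave k).continuous

/-- The Fourier coefficients of a complex periodic function. -/
def coeffC {d : ℕ} (L : ℝ) (f : Space d → ℂ) (k : Fin d → ℤ) : ℂ :=
  ∫ x, f x * expWave L k (-x) ∂cellMeasure d L

theorem fourierCoefficient_eq (hL : 0 < L) (f : Space d → ℝ) (k : Fin d → ℤ) :
    fourierCoefficient L f k = coeffC L (fun x => (f x : ℂ)) k := by
  rw [fourierCoefficient, coeffC, integral_cellMeasure hL, Complex.real_smul]
  congr 2
  ext x
  rw [expWave, inner_neg_right]
  congr 2
  push_cast
  ring

theorem coeffC_comp_toTorus (hL : 0 < L) {F : UnitAddTorus (Fin d) → ℂ} (hF : Measurable F)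
    (k : Fin d → ℤ) : coeffC L (F ∘ toTorus L) k = UnitAddTorus.mFourierCoeff F k := by
  have hm : Measurable fun q => UnitAddTorus.mFourier (-k) q • F q :=
    (UnitAddTorus.mFourier (-k)).continuous.measurable.smul hF
  rw [coeffC, UnitAddTorus.mFourierCoeff, ← (measurePreserving_toTorus hL).map_eq,
    integral_map continuous_toTorus.aemeasurable hm.aestronglyMeasurable]
  congr 1
  ext x
  rw [UnitAddTorus.mFourier_neg, ← expWave_eq_mFourier, conj_expWave, smul_eq_mul, mul_comm]
  rfl

/-- Parseval's identity on the cell. -/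
theorem tsum_enorm_sq_coeffC (hL : 0 < L) {f : Space d → ℂ} (hf : Measurable f)
    (hp : IsPeriodic L f) (h2 : ∫⁻ x, ‖f x‖ₑ ^ 2 ∂cellMeasure d L ≠ ⊤) :
    ∑' k, ‖coeffC L f k‖ₑ ^ 2 = ∫⁻ x, ‖f x‖ₑ ^ 2 ∂cellMeasure d L := by
  set F : UnitAddTorus (Fin d) → ℂ := fun q => f (ofTorus L q)
  have hF : Measurable F := hf.comp measurable_ofTorus
  have hfF : f = F ∘ toTorus L := hp.eq_comp_toTorus hL
  have hint : ∫⁻ x, ‖f x‖ₑ ^ 2 ∂cellMeasure d L = ∫⁻ q, ‖F q‖ₑ ^ 2 := by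
    rw [hfF]
    exact (measurePreserving_toTorus hL).lintegral_comp (f := fun q => ‖F q‖ₑ ^ 2)
      (hF.enorm.pow_const 2)
  rw [hint] at h2 ⊢
  have hmem : MemLp F 2 volume := by
    refine ⟨hF.aestronglyMeasurable, ?_⟩
    rw [eLpNorm_lt_top_iff_lintegral_rpow_enorm_lt_top (by simp) (by simp)]
    simpa using h2.lt_top
  have hsum := UnitAddTorus.hasSum_sq_mFourierCoeff (hmem.toLp F)
  have hcoe := hmem.coeFn_toLp
  have hco : ∀ k, UnitAddTorus.mFourierCoeff (hmem.toLp F) k = coeffC L f k := by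
    intro k
    rw [hfF, coeffC_comp_toTorus hL hF]
    refine integral_congr_ae ?_
    filter_upwards [hcoe] with q hq
    rw [hq]
  simp_rw [hco] at hsum
  have h3 : ∫ t, ‖(hmem.toLp F) t‖ ^ 2 = ∫ t, ‖F t‖ ^ 2 := by
    refine integral_congr_ae ?_
    filter_upwards [hcoe] with q hq
    rw [hq]
  rw [h3] at hsum
  have h4 : ∫⁻ q, ‖F q‖ₑ ^ 2 = ENNReal.ofReal (∫ t, ‖F t‖ ^ 2) := by
    rw [ofReal_integral_eq_lintegral_ofReal hmem.integrable_norm_pow' (ae_of_all _ fun _ => by positivity)]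
    refine lintegral_congr fun q => ?_
    rw [ENNReal.ofReal_pow (norm_nonneg _), ofReal_norm]
  rw [h4, ← hsum.tsum_eq, ENNReal.ofReal_tsum_of_nonneg (fun _ => by positivity) hsum.summable]
  refine tsum_congr fun k => ?_
  rw [ENNReal.ofReal_pow (norm_nonneg _), ofReal_norm]

/-- Trigonometric polynomials are dense among integrable periodic functions. -/
theorem exists_trigPoly_lintegral_lt (hL : 0 < L) {f : Space d → ℂ} (hf : Measurable f)
    (hp : IsPeriodic L f) (h1 : ∫⁻ x, ‖f x‖ₑ ∂cellMeasure d L ≠ ⊤) {ε : ℝ≥0∞} (hε : ε ≠ 0) :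
    ∃ (s : Finset (Fin d → ℤ)) (c : (Fin d → ℤ) → ℂ),
      ∫⁻ x, ‖f x - ∑ k ∈ s, c k * expWave L k x‖ₑ ∂cellMeasure d L < ε := by
  set F : UnitAddTorus (Fin d) → ℂ := fun q => f (ofTorus L q)
  have hF : Measurable F := hf.comp measurable_ofTorus
  have hfF : f = F ∘ toTorus L := hp.eq_comp_toTorus hL
  have hint : ∫⁻ x, ‖f x‖ₑ ∂cellMeasure d L = ∫⁻ q, ‖F q‖ₑ := by
    rw [hfF]
    exact (measurePreserving_toTorus hL).lintegral_comp (f := fun q => ‖F q‖ₑ) hF.enorm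
  rw [hint] at h1
  have hmem : MemLp F 1 volume := by
    refine ⟨hF.aestronglyMeasurable, ?_⟩
    rw [eLpNorm_one_eq_lintegral_enorm]
    exact h1.lt_top
  have hden := UnitAddTorus.span_mFourierLp_closure_eq_top (d := Fin d) (p := 1) (by simp)
  have hmemc : hmem.toLp F ∈ closure
      (Submodule.span ℂ (range (UnitAddTorus.mFourierLp (d := Fin d) 1)) : Set _) := by
    rw [← Submodule.topologicalClosure_coe, hden]
    trivial
  rw [EMetric.mem_closure_iff] at hmemc
  obtain ⟨g, hg, hlt⟩ := hmemc ε (pos_iff_ne_zero.mpr hε)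
  obtain ⟨c, hc⟩ := Finsupp.mem_span_range_iff_exists_finsupp.mp hg
  refine ⟨c.support, c, ?_⟩
  rw [Lp.edist_def, eLpNorm_one_eq_lintegral_enorm] at hlt
  refine lt_of_eq_of_lt ?_ hlt
  have hgc : (g : UnitAddTorus (Fin d) → ℂ) =ᵐ[volume]
      fun q => ∑ k ∈ c.support, c k * UnitAddTorus.mFourier k q := by
    rw [← hc, Finsupp.sum]
    refine (Lp.coeFn_finsetSum _ _).trans ?_
    have h5 : ∀ k ∈ c.support, ((c k • UnitAddTorus.mFourierLp (d := Fin d) 1 k :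
        Lp ℂ 1 (volume : Measure (UnitAddTorus (Fin d)))) : UnitAddTorus (Fin d) → ℂ) =ᵐ[volume]
        fun q => c k * UnitAddTorus.mFourier k q := by
      intro k _
      filter_upwards [Lp.coeFn_smul (c k) (UnitAddTorus.mFourierLp (d := Fin d) 1 k),
        UnitAddTorus.coeFn_mFourierLp (d := Fin d) 1 k] with q h6 h7
      rw [h6, Pi.smul_apply, h7, smul_eq_mul]
    have h8 := (Finset.eventually_all c.support).mpr h5
    filter_upwards [h8] with q hq
    rw [Finset.sum_apply]
    exact Finset.sum_congr rfl fun k hk => hq k hk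
  have h9 : ∫⁻ q, ‖(hmem.toLp F - g : UnitAddTorus (Fin d) → ℂ) q‖ₑ =
      ∫⁻ q, ‖F q - ∑ k ∈ c.support, c k * UnitAddTorus.mFourier k q‖ₑ := by
    refine lintegral_congr_ae ?_
    filter_upwards [hmem.coeFn_toLp, hgc] with q h10 h11
    rw [Pi.sub_apply, h10, h11]
  rw [h9, ← (measurePreserving_toTorus hL).lintegral_comp]
  · refine lintegral_congr fun x => ?_
    rw [hfF]
    simp only [Function.comp, expWave_eq_mFourier]
  · refine (hF.sub ?_).enorm
    exact Finset.measurable_fun_sum _ fun k _ => (ContinuousMap.continuous _).measurable.const_mul _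

end Torus

/-! ### Convolution of whole-space kernels with periodic functions. -/

section Convolution

open scoped Topology ComplexConjugate

variable {d : ℕ} {L : ℝ}

theorem IsPeriodic.postcomp {α β : Type*} {f : Space d → α} (hf : IsPeriodic L f) (g : α → β) :
    IsPeriodic L fun x => g (f x) :=
  fun i x => congrArg g (hf i x)

/-- Boundedness of the cell needs no sign condition on `L`, so this can be an instance, unlike total
mass one. -/
instance isFiniteMeasure_cellMeasure : IsFiniteMeasure (cellMeasure d L) := by
  refine ⟨?_⟩
  rw [cellMeasure, Measure.smul_apply, Measure.restrict_apply_univ, smul_eq_mul]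
  refine ENNReal.mul_lt_top ENNReal.ofReal_lt_top ?_
  have : cell d L ⊆ Metric.closedBall 0 (Real.sqrt (∑ _i : Fin d, L ^ 2)) := by
    intro x hx
    rw [mem_closedBall_zero_iff, EuclideanSpace.norm_eq]
    refine Real.sqrt_le_sqrt (Finset.sum_le_sum fun i _ => ?_)
    have := hx i
    rw [Real.norm_eq_abs, sq_abs]
    exact pow_le_pow_left₀ this.1 this.2 2
  exact (measure_mono this).trans_lt measure_closedBall_lt_top

/-- Convolution of a kernel on the whole space with a periodic function. -/
def conv {d : ℕ} (k f : Space d → ℂ) (x : Space d) : ℂ := ∫ y, k y * f (x - y)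

/-- The transform of a kernel at the wave numbers of the periodicity lattice. -/
def waveTransform {d : ℕ} (L : ℝ) (k : Space d → ℂ) (m : Fin d → ℤ) : ℂ :=
  ∫ y, k y * expWave L m (-y)

theorem enorm_conv_le (k f : Space d → ℂ) (x : Space d) :
    ‖conv k f x‖ₑ ≤ ∫⁻ y, ‖k y‖ₑ * ‖f (x - y)‖ₑ := by
  refine (enorm_integral_le_lintegral_enorm _).trans_eq (lintegral_congr fun y => ?_)
  rw [enorm_mul]

/-- Tonelli and translation invariance. It yields both Young's inequality and the absolute
convergence of the convolution at a.e. point. -/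
theorem lintegral_lintegral_conv (hL : 0 < L) {k f : Space d → ℂ} (hk : Measurable k)
    (hf : Measurable f) (hp : IsPeriodic L f) :
    ∫⁻ x, (∫⁻ y, ‖k y‖ₑ * ‖f (x - y)‖ₑ) ∂cellMeasure d L =
      (∫⁻ y, ‖k y‖ₑ) * ∫⁻ x, ‖f x‖ₑ ∂cellMeasure d L := by
  rw [lintegral_lintegral_swap]
  · rw [← lintegral_mul_const _ hk.enorm]
    refine lintegral_congr fun y => ?_
    rw [lintegral_const_mul _ (by fun_prop)]
    congr 1
    exact lintegral_comp_sub hL hf.enorm (hp.postcomp _) y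
  · fun_prop

/-- Young's inequality for the convolution with a periodic function. -/
theorem lintegral_enorm_conv_le (hL : 0 < L) {k f : Space d → ℂ} (hk : Measurable k)
    (hf : Measurable f) (hp : IsPeriodic L f) :
    ∫⁻ x, ‖conv k f x‖ₑ ∂cellMeasure d L ≤
      (∫⁻ y, ‖k y‖ₑ) * ∫⁻ x, ‖f x‖ₑ ∂cellMeasure d L := by
  rw [← lintegral_lintegral_conv hL hk hf hp]
  exact lintegral_mono fun x => enorm_conv_le k f x

theorem ae_integrable_conv (hL : 0 < L) {k f : Space d → ℂ} (hk : Measurable k)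
    (hki : Integrable k) (hf : Measurable f) (hp : IsPeriodic L f)
    (h1 : ∫⁻ x, ‖f x‖ₑ ∂cellMeasure d L ≠ ⊤) :
    ∀ᵐ x ∂cellMeasure d L, Integrable fun y => k y * f (x - y) := by
  have h := lintegral_lintegral_conv hL hk hf hp
  have hfin : (∫⁻ y, ‖k y‖ₑ) * ∫⁻ x, ‖f x‖ₑ ∂cellMeasure d L ≠ ⊤ :=
    ENNReal.mul_ne_top hki.2.ne h1
  rw [← h] at hfin
  have hm : Measurable fun x => ∫⁻ y, ‖k y‖ₑ * ‖f (x - y)‖ₑ :=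
    Measurable.lintegral_prod_right' (f := fun p : Space d × Space d => ‖k p.2‖ₑ * ‖f (p.1 - p.2)‖ₑ)
      (by fun_prop)
  filter_upwards [ae_lt_top hm hfin] with x hx
  refine ⟨by fun_prop, ?_⟩
  refine lt_of_eq_of_lt (lintegral_congr fun y => ?_) hx
  rw [enorm_mul]

theorem measurable_conv {k f : Space d → ℂ} (hk : Measurable k) (hf : Measurable f) :
    Measurable (conv k f) := by
  refine StronglyMeasurable.measurable ?_
  exact StronglyMeasurable.integral_prod_right'
    (f := fun p : Space d × Space d => k p.2 * f (p.1 - p.2))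
    (Measurable.stronglyMeasurable (by fun_prop))

theorem measurable_expWave (k : Fin d → ℤ) : Measurable (expWave L k : Space d → ℂ) :=
  (continuous_expWave k).measurable

theorem integrable_mul_expWave {μ : Measure (Space d)} {f : Space d → ℂ} (hf : Integrable f μ)
    (k : Fin d → ℤ) : Integrable (fun x => f x * expWave L k (-x)) μ := by
  refine hf.mul_bdd (c := 1) ?_ (ae_of_all _ fun _ => (norm_expWave k _).le)
  exact ((continuous_expWave k).comp continuous_neg).aestronglyMeasurable

theorem integrable_expWave (k : Fin d → ℤ) : Integrable (expWave L k) (cellMeasure d L) :=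
  Integrable.of_bound (continuous_expWave k).aestronglyMeasurable 1
    (ae_of_all _ fun _ => (norm_expWave k _).le)

theorem coeffC_sub {f g : Space d → ℂ} (hf : Integrable f (cellMeasure d L))
    (hg : Integrable g (cellMeasure d L)) (k : Fin d → ℤ) :
    coeffC L (fun x => f x - g x) k = coeffC L f k - coeffC L g k := by
  simp only [coeffC, sub_mul]
  exact integral_sub (integrable_mul_expWave hf k) (integrable_mul_expWave hg k)

theorem enorm_coeffC_le (f : Space d → ℂ) (k : Fin d → ℤ) :
    ‖coeffC L f k‖ₑ ≤ ∫⁻ x, ‖f x‖ₑ ∂cellMeasure d L := by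
  refine (enorm_integral_le_lintegral_enorm _).trans_eq (lintegral_congr fun y => ?_)
  rw [enorm_mul, ← ofReal_norm (expWave L k (-y)), norm_expWave, ENNReal.ofReal_one, mul_one]

section

attribute [local instance] instMeasureSpaceUnitAddCircle isProbabilityMeasure_unitAddCircle

theorem coeffC_expWave (hL : 0 < L) (n m : Fin d → ℤ) :
    coeffC L (expWave L n) m = if m = n then 1 else 0 := by
  have h : expWave L n = UnitAddTorus.mFourier n ∘ toTorus L := by
    ext x; exact expWave_eq_mFourier n x
  rw [h, coeffC_comp_toTorus hL (UnitAddTorus.mFourier n).continuous.measurable,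
    ← UnitAddTorus.mFourierCoeff_toLp, ← UnitAddTorus.mFourierBasis_repr]
  have : ContinuousMap.toLp 2 volume ℂ (UnitAddTorus.mFourier n) =
      UnitAddTorus.mFourierBasis (d := Fin d) n := by
    rw [UnitAddTorus.coe_mFourierBasis]
  rw [this, HilbertBasis.repr_self, lp.single_apply]
  by_cases h : m = n
  · subst h; simp
  · simp [h]

end

theorem coeffC_trigPoly (hL : 0 < L) (s : Finset (Fin d → ℤ)) (c : (Fin d → ℤ) → ℂ)
    (m : Fin d → ℤ) :
    coeffC L (fun x => ∑ k ∈ s, c k * expWave L k x) m = if m ∈ s then c m else 0 := by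
  have h : coeffC L (fun x => ∑ k ∈ s, c k * expWave L k x) m =
      ∑ k ∈ s, c k * coeffC L (expWave L k) m := by
    simp only [coeffC, Finset.sum_mul, mul_assoc]
    rw [integral_finsetSum]
    · simp_rw [integral_const_mul]
    · intro k _
      exact (integrable_mul_expWave (integrable_expWave k) m).const_mul _
  rw [h]
  simp_rw [coeffC_expWave hL, mul_ite, mul_one, mul_zero]
  rw [Finset.sum_ite_eq s m c]

theorem conv_trigPoly {k : Space d → ℂ} (hki : Integrable k) (s : Finset (Fin d → ℤ))
    (c : (Fin d → ℤ) → ℂ) (x : Space d) :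
    conv k (fun x => ∑ m ∈ s, c m * expWave L m x) x =
      ∑ m ∈ s, waveTransform L k m * c m * expWave L m x := by
  simp only [conv, Finset.mul_sum]
  rw [integral_finsetSum]
  · refine Finset.sum_congr rfl fun m _ => ?_
    rw [waveTransform, ← integral_mul_const, ← integral_mul_const]
    congr 1
    ext y
    rw [expWave_sub]
    ring
  · intro m _
    have : (fun y => k y * (c m * expWave L m (x - y))) =
        fun y => (c m * expWave L m x) * (k y * expWave L m (-y)) := by
      ext y; rw [expWave_sub]; ring
    rw [this]
    exact (integrable_mul_expWave hki m).const_mul _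

theorem integrable_of_lintegral_ne_top {f : Space d → ℂ} (hf : Measurable f)
    (h1 : ∫⁻ x, ‖f x‖ₑ ∂cellMeasure d L ≠ ⊤) : Integrable f (cellMeasure d L) :=
  ⟨hf.aestronglyMeasurable, h1.lt_top⟩

theorem isPeriodic_trigPoly (hL : 0 < L) (s : Finset (Fin d → ℤ)) (c : (Fin d → ℤ) → ℂ) :
    IsPeriodic L fun x : Space d => ∑ m ∈ s, c m * expWave L m x := by
  intro i x
  exact Finset.sum_congr rfl fun m _ => by rw [isPeriodic_expWave hL]

theorem measurable_trigPoly (s : Finset (Fin d → ℤ)) (c : (Fin d → ℤ) → ℂ) :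
    Measurable fun x : Space d => ∑ m ∈ s, c m * expWave L m x :=
  Finset.measurable_fun_sum _ fun m _ => (measurable_expWave m).const_mul _

theorem integrable_trigPoly (s : Finset (Fin d → ℤ)) (c : (Fin d → ℤ) → ℂ) :
    Integrable (fun x : Space d => ∑ m ∈ s, c m * expWave L m x) (cellMeasure d L) :=
  integrable_finsetSum _ fun m _ => (integrable_expWave m).const_mul _

/-- Convolution with a band-limited kernel is a finite Fourier multiplier. -/
theorem conv_ae_eq_trigPoly (hL : 0 < L) {k f : Space d → ℂ} (hk : Measurable k)
    (hki : Integrable k) (hf : Measurable f) (hp : IsPeriodic L f)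
    (h1 : ∫⁻ x, ‖f x‖ₑ ∂cellMeasure d L ≠ ⊤) (S : Finset (Fin d → ℤ))
    (hS : ∀ m, m ∉ S → waveTransform L k m = 0) :
    ∀ᵐ x ∂cellMeasure d L,
      conv k f x = ∑ m ∈ S, waveTransform L k m * coeffC L f m * expWave L m x := by
  -- The defect `T` is bounded from L¹ to L¹ with constant `A` and vanishes on trigonometric
  -- polynomials. These are dense in L¹, so `T f` vanishes a.e.
  set T : (Space d → ℂ) → Space d → ℂ := fun g x =>
    conv k g x - ∑ m ∈ S, waveTransform L k m * coeffC L g m * expWave L m x with hT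
  set A : ℝ≥0∞ := (∫⁻ y, ‖k y‖ₑ) + ∑ m ∈ S, ‖waveTransform L k m‖ₑ *
    (cellMeasure d L univ) with hA
  have hAfin : A ≠ ⊤ := by
    refine ENNReal.add_ne_top.mpr ⟨hki.2.ne, ?_⟩
    refine (ENNReal.sum_lt_top.mpr fun m _ => ?_).ne
    exact ENNReal.mul_lt_top enorm_lt_top (measure_lt_top _ _)
  have hTmeas : ∀ g, Measurable g → Measurable (T g) := fun g hg =>
    (measurable_conv hk hg).sub (measurable_trigPoly _ _)
  have hTle : ∀ g, Measurable g → IsPeriodic L g →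
      ∫⁻ x, ‖T g x‖ₑ ∂cellMeasure d L ≤ A * ∫⁻ x, ‖g x‖ₑ ∂cellMeasure d L := by
    intro g hg hgp
    calc ∫⁻ x, ‖T g x‖ₑ ∂cellMeasure d L
        ≤ ∫⁻ x, (‖conv k g x‖ₑ + ∑ m ∈ S, ‖waveTransform L k m‖ₑ *
            ∫⁻ x, ‖g x‖ₑ ∂cellMeasure d L) ∂cellMeasure d L := by
          refine lintegral_mono fun x => (enorm_sub_le).trans (add_le_add_right ?_ _)
          refine (enorm_sum_le _ _).trans (Finset.sum_le_sum fun m _ => ?_)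
          rw [enorm_mul, enorm_mul, ← ofReal_norm (expWave L m x), norm_expWave,
            ENNReal.ofReal_one, mul_one]
          gcongr
          exact enorm_coeffC_le g m
      _ ≤ A * ∫⁻ x, ‖g x‖ₑ ∂cellMeasure d L := by
          rw [lintegral_add_right _ measurable_const, lintegral_const, hA, add_mul]
          refine add_le_add (lintegral_enorm_conv_le hL hk hg hgp) (le_of_eq ?_)
          rw [Finset.sum_mul, Finset.sum_mul]
          refine Finset.sum_congr rfl fun m _ => ?_
          ring
  have hTpoly : ∀ (s : Finset (Fin d → ℤ)) (c : (Fin d → ℤ) → ℂ) (x : Space d),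
      T (fun x => ∑ m ∈ s, c m * expWave L m x) x = 0 := by
    intro s c x
    simp only [hT]
    rw [conv_trigPoly hki, sub_eq_zero]
    simp_rw [coeffC_trigPoly hL]
    have e1 : ∑ m ∈ s, waveTransform L k m * c m * expWave L m x =
        ∑ m ∈ s ∩ S, waveTransform L k m * c m * expWave L m x := by
      refine (Finset.sum_subset Finset.inter_subset_left fun m hm hm2 => ?_).symm
      rw [hS m (fun h => hm2 (Finset.mem_inter.mpr ⟨hm, h⟩))]
      ring
    have e2 : ∑ m ∈ S, waveTransform L k m * (if m ∈ s then c m else 0) * expWave L m x =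
        ∑ m ∈ s ∩ S, waveTransform L k m * (if m ∈ s then c m else 0) * expWave L m x := by
      refine (Finset.sum_subset Finset.inter_subset_right fun m hm hm2 => ?_).symm
      rw [if_neg (fun h => hm2 (Finset.mem_inter.mpr ⟨h, hm⟩))]
      ring
    rw [e1, e2]
    exact Finset.sum_congr rfl fun m hm => by rw [if_pos (Finset.mem_inter.mp hm).1]
  have hfi := integrable_of_lintegral_ne_top hf h1
  have hzero : ∫⁻ x, ‖T f x‖ₑ ∂cellMeasure d L = 0 := by
    by_contra hne
    have hAT : A * ∫⁻ x, ‖f x‖ₑ ∂cellMeasure d L ≠ ⊤ := ENNReal.mul_ne_top hAfin h1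
    obtain ⟨s, c, hsc⟩ := exists_trigPoly_lintegral_lt hL hf hp h1
      (ε := (∫⁻ x, ‖T f x‖ₑ ∂cellMeasure d L) / A) (ENNReal.div_pos hne hAfin).ne'
    set p : Space d → ℂ := fun x => ∑ m ∈ s, c m * expWave L m x with hpdef
    have hpm : Measurable p := measurable_trigPoly s c
    have hpp : IsPeriodic L p := isPeriodic_trigPoly hL s c
    have hpi : Integrable p (cellMeasure d L) := integrable_trigPoly s c
    -- Linearity of `T` holds only a.e., namely where the convolution integrals converge absolutely.
    have heq : ∀ᵐ x ∂cellMeasure d L, T f x = T (fun x => f x - p x) x := by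
      filter_upwards [ae_integrable_conv hL hk hki hf hp h1,
        ae_integrable_conv hL hk hki hpm hpp hpi.2.ne] with x hx1 hx2
      have e := hTpoly s c x
      rw [← sub_zero (T f x), ← e]
      simp only [hT, conv, coeffC_sub hfi hpi, mul_sub, sub_mul, Finset.sum_sub_distrib]
      rw [integral_sub hx1 hx2]
      ring
    have h2 : ∫⁻ x, ‖T f x‖ₑ ∂cellMeasure d L ≤
        A * ∫⁻ x, ‖f x - p x‖ₑ ∂cellMeasure d L := by
      rw [lintegral_congr_ae (heq.mono fun x hx => by rw [hx])]
      exact hTle _ (hf.sub hpm) fun i x => by rw [hp, hpp]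
    have hA0 : A ≠ 0 := fun h => hne (le_antisymm (h2.trans (by rw [h, zero_mul])) bot_le)
    have h3 : A * ∫⁻ x, ‖f x - p x‖ₑ ∂cellMeasure d L < ∫⁻ x, ‖T f x‖ₑ ∂cellMeasure d L := by
      rw [mul_comm]
      exact (ENNReal.lt_div_iff_mul_lt (Or.inl hA0) (Or.inl hAfin)).mp hsc
    exact absurd h2 (not_le.mpr h3)
  rw [lintegral_eq_zero_iff (hTmeas f hf).enorm] at hzero
  filter_upwards [hzero] with x hx
  simp only [Pi.zero_apply, enorm_eq_zero] at hx
  exact sub_eq_zero.mp hx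

end Convolution

/-! ### Estimates at a fixed time: moduli of continuity and weak gradients. -/

section FixedTime

open scoped Topology ComplexConjugate

variable {d : ℕ} {L : ℝ}

section

attribute [local instance] instMeasureSpaceUnitAddCircle isProbabilityMeasure_unitAddCircle
  isAddHaarMeasure_unitAddCircle

theorem integral_comp_sub (hL : 0 < L) {f : Space d → ℂ} (hf : Measurable f)
    (hp : IsPeriodic L f) (y : Space d) :
    ∫ x, f (x - y) ∂cellMeasure d L = ∫ x, f x ∂cellMeasure d L := by
  set F : UnitAddTorus (Fin d) → ℂ := fun q => f (ofTorus L q)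
  have hF : Measurable F := hf.comp measurable_ofTorus
  have hfF : ∀ x, f x = F (toTorus L x) := fun x => congrFun (hp.eq_comp_toTorus hL) x
  have hsub : ∀ x, toTorus L (x - y) = toTorus L x - toTorus L y := by
    intro x; ext i; simp [toTorus, sub_div]
  simp_rw [hfF, hsub]
  have h1 := integral_map (μ := cellMeasure d L) (continuous_toTorus (L := L)).aemeasurable
    (f := fun q => F (q - toTorus L y)) (hF.comp (measurable_id.sub_const _)).aestronglyMeasurable
  have h2 := integral_map (μ := cellMeasure d L) (continuous_toTorus (L := L)).aemeasurable
    (f := F) hF.aestronglyMeasurable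
  rw [← h1, ← h2, (measurePreserving_toTorus hL).map_eq, integral_sub_right_eq_self]

end

theorem IsPeriodic.mul {f g : Space d → ℂ} (hf : IsPeriodic L f) (hg : IsPeriodic L g) :
    IsPeriodic L fun x => f x * g x :=
  fun i x => congrArg₂ (· * ·) (hf i x) (hg i x)

theorem expWave_neg_eq (m : Fin d → ℤ) (x : Space d) : expWave L m (-x) = expWave L (-m) x := by
  have : waveVector L (-m) = -waveVector L m := by
    ext i; simp [waveVector]
  rw [expWave, expWave, this, inner_neg_right, inner_neg_left]

theorem isPeriodic_expWave_neg (hL : 0 < L) (m : Fin d → ℤ) :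
    IsPeriodic L fun x : Space d => expWave L m (-x) := by
  simp_rw [expWave_neg_eq]
  exact isPeriodic_expWave hL _

theorem coeffC_comp_sub (hL : 0 < L) {f : Space d → ℂ} (hf : Measurable f)
    (hp : IsPeriodic L f) (y : Space d) (m : Fin d → ℤ) :
    coeffC L (fun x => f (x - y)) m = expWave L m (-y) * coeffC L f m := by
  have h := integral_comp_sub hL (f := fun x => f x * expWave L m (-x))
    (hf.mul ((measurable_expWave m).comp measurable_neg))
    (hp.mul (isPeriodic_expWave_neg hL m)) y
  rw [coeffC, coeffC, ← h, ← integral_const_mul]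
  congr 1
  ext x
  have : (-x : Space d) = -(x - y) - y := by abel
  rw [this, expWave_sub]
  ring

/-- Interpolation between the bounds `b` and `2` for `|e^{ib} - 1|`: one has `b ≤ b^s` for `b ≤ 1`
and `1 ≤ b^s` for `b ≥ 1`. -/
theorem norm_expWave_sub_one_le {s : ℝ} (hs : s ∈ Icc (0 : ℝ) 1) (m : Fin d → ℤ) (y : Space d) :
    ‖expWave L m (-y) - 1‖ ≤ 2 * (‖waveVector L m‖ * ‖y‖) ^ s := by
  set b := ‖waveVector L m‖ * ‖y‖ with hb
  have hb0 : 0 ≤ b := by positivity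
  have h1 : ‖expWave L m (-y) - 1‖ ≤ b := by
    rw [expWave]
    refine (Real.norm_exp_I_mul_ofReal_sub_one_le).trans ?_
    rw [Real.norm_eq_abs]
    refine (abs_real_inner_le_norm _ _).trans ?_
    rw [norm_neg]
  have h2 : ‖expWave L m (-y) - 1‖ ≤ 2 := by
    refine (norm_sub_le _ _).trans ?_
    rw [norm_expWave, norm_one]
    norm_num
  rcases le_total b 1 with h | h
  · have : b ≤ b ^ s := by
      simpa using Real.rpow_le_rpow_of_exponent_ge' hb0 h hs.1 hs.2
    have : 0 ≤ b ^ s := Real.rpow_nonneg hb0 s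
    linarith
  · have : 1 ≤ b ^ s := Real.one_le_rpow h hs.1
    linarith

theorem lintegral_enorm_le_sqrt {E : Type*} [NormedAddCommGroup E] [MeasurableSpace E]
    [BorelSpace E] (hL : 0 < L) {f : Space d → E}
    (hf : Measurable f) :
    ∫⁻ x, ‖f x‖ₑ ∂cellMeasure d L ≤ (∫⁻ x, ‖f x‖ₑ ^ 2 ∂cellMeasure d L) ^ (1 / 2 : ℝ) := by
  have := isProbabilityMeasure_cellMeasure (d := d) hL
  have h := ENNReal.lintegral_mul_le_Lp_mul_Lq (cellMeasure d L) Real.HolderConjugate.two_two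
    (f := fun x => ‖f x‖ₑ) (g := fun _ => 1) hf.enorm.aemeasurable aemeasurable_const
  simpa using h

theorem lintegral_enorm_ne_top {E : Type*} [NormedAddCommGroup E] [MeasurableSpace E]
    [BorelSpace E] (hL : 0 < L) {f : Space d → E}
    (hf : Measurable f) (h2 : ∫⁻ x, ‖f x‖ₑ ^ 2 ∂cellMeasure d L ≠ ⊤) :
    ∫⁻ x, ‖f x‖ₑ ∂cellMeasure d L ≠ ⊤ :=
  ne_top_of_le_ne_top (ENNReal.rpow_ne_top_of_nonneg (by norm_num) h2) (lintegral_enorm_le_sqrt hL hf)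

theorem enorm_sub_sq_le (a b : ℂ) : ‖a - b‖ₑ ^ 2 ≤ 2 * (‖a‖ₑ ^ 2 + ‖b‖ₑ ^ 2) := by
  have h : ‖a - b‖ ^ 2 ≤ 2 * (‖a‖ ^ 2 + ‖b‖ ^ 2) := by
    have := norm_sub_le a b
    have h0 := norm_nonneg (a - b)
    nlinarith [sq_nonneg (‖a‖ - ‖b‖)]
  have := ENNReal.ofReal_le_ofReal h
  rw [ENNReal.ofReal_pow (norm_nonneg _), ENNReal.ofReal_mul (by norm_num),
    ENNReal.ofReal_add (by positivity) (by positivity), ENNReal.ofReal_pow (norm_nonneg _),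
    ENNReal.ofReal_pow (norm_nonneg _), ofReal_norm, ofReal_norm, ofReal_norm] at this
  simpa using this

/-- Mean square modulus of continuity in terms of fractional derivatives. -/
theorem lintegral_translate_sub_le (hL : 0 < L) {s : ℝ} (hs : s ∈ Icc (0 : ℝ) 1)
    {f : Space d → ℂ} (hf : Measurable f) (hp : IsPeriodic L f)
    (h2 : ∫⁻ x, ‖f x‖ₑ ^ 2 ∂cellMeasure d L ≠ ⊤) (y : Space d) :
    ∫⁻ x, ‖f (x - y) - f x‖ₑ ^ 2 ∂cellMeasure d L ≤ ENNReal.ofReal ((2 * ‖y‖ ^ s) ^ 2) *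
      ∑' m, ENNReal.ofReal (‖waveVector L m‖ ^ (2 * s)) * ‖coeffC L f m‖ₑ ^ 2 := by
  have hfy : Measurable fun x => f (x - y) := hf.comp (measurable_id.sub_const y)
  have hpy : IsPeriodic L fun x => f (x - y) := fun i x => by
    have := hp i (x - y)
    rwa [sub_add_eq_add_sub] at this
  have h2y : ∫⁻ x, ‖f (x - y)‖ₑ ^ 2 ∂cellMeasure d L ≠ ⊤ := by
    rw [lintegral_comp_sub hL (f := fun x => ‖f x‖ₑ ^ 2) (hf.enorm.pow_const 2)
      (hp.postcomp fun z => ‖z‖ₑ ^ 2)]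
    exact h2
  have hg2 : ∫⁻ x, ‖f (x - y) - f x‖ₑ ^ 2 ∂cellMeasure d L ≠ ⊤ := by
    refine ne_top_of_le_ne_top ?_ (lintegral_mono fun x => enorm_sub_sq_le _ _)
    rw [lintegral_const_mul _ (by fun_prop), lintegral_add_left (by fun_prop)]
    exact ENNReal.mul_ne_top (by simp) (ENNReal.add_ne_top.mpr ⟨h2y, h2⟩)
  have hi := integrable_of_lintegral_ne_top hf (lintegral_enorm_ne_top hL hf h2)
  have hiy := integrable_of_lintegral_ne_top hfy (lintegral_enorm_ne_top hL hfy h2y)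
  -- Parseval for the difference, whose coefficients are `(e^{-im·y} - 1)` times those of `f`; the
  -- bound then holds term by term.
  rw [← tsum_enorm_sq_coeffC hL (f := fun x => f (x - y) - f x) (hfy.sub hf)
    (fun i x => congrArg₂ (· - ·) (hpy i x) (hp i x)) hg2, ← ENNReal.tsum_mul_left]
  refine ENNReal.tsum_le_tsum fun m => ?_
  rw [coeffC_sub hiy hi, coeffC_comp_sub hL hf hp, ← sub_one_mul, enorm_mul, mul_pow, ← mul_assoc]
  gcongr
  rw [← ENNReal.ofReal_mul (by positivity), ← ofReal_norm, ← ENNReal.ofReal_pow (norm_nonneg _)]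
  refine ENNReal.ofReal_le_ofReal ?_
  refine (pow_le_pow_left₀ (norm_nonneg _) (norm_expWave_sub_one_le hs m y) 2).trans_eq ?_
  rw [Real.mul_rpow (norm_nonneg _) (norm_nonneg _), two_mul s,
    Real.rpow_add_of_nonneg (norm_nonneg _) hs.1 hs.1]
  ring

theorem enorm_sq_eq_sum (v : Space d) : ‖v‖ₑ ^ 2 = ∑ i, ‖(v i : ℂ)‖ₑ ^ 2 := by
  have h := EuclideanSpace.norm_sq_eq v
  have := congrArg ENNReal.ofReal h
  rw [ENNReal.ofReal_pow (norm_nonneg _), ofReal_norm,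
    ENNReal.ofReal_sum_of_nonneg fun _ _ => by positivity] at this
  rw [this]
  refine Finset.sum_congr rfl fun i _ => ?_
  rw [ENNReal.ofReal_pow (norm_nonneg _), ← ofReal_norm, Complex.norm_real]

theorem measurable_coord {v : Space d → Space d} (hv : Measurable v) (i : Fin d) :
    Measurable fun x => (v x i : ℂ) := by
  have h : Measurable fun x => v x i := by
    have : Continuous fun z : Space d => z i := by fun_prop
    exact this.measurable.comp hv
  exact Complex.measurable_ofReal.comp h

theorem lintegral_coord_ne_top {v : Space d → Space d}
    (h2 : ∫⁻ x, ‖v x‖ₑ ^ 2 ∂cellMeasure d L ≠ ⊤) (i : Fin d) :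
    ∫⁻ x, ‖(v x i : ℂ)‖ₑ ^ 2 ∂cellMeasure d L ≠ ⊤ := by
  refine ne_top_of_le_ne_top h2 (lintegral_mono fun x => ?_)
  rw [enorm_sq_eq_sum]
  exact Finset.single_le_sum (f := fun i => ‖(v x i : ℂ)‖ₑ ^ 2) (fun _ _ => bot_le) (Finset.mem_univ i)

theorem lintegral_translate_sub_le_fracGradSq (hL : 0 < L) {s : ℝ} (hs : s ∈ Icc (0 : ℝ) 1)
    {v : Space d → Space d} (hv : Measurable v) (hp : IsPeriodic L v)
    (h2 : ∫⁻ x, ‖v x‖ₑ ^ 2 ∂cellMeasure d L ≠ ⊤) (y : Space d) :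
    ∫⁻ x, ‖v (x - y) - v x‖ₑ ^ 2 ∂cellMeasure d L ≤ ENNReal.ofReal ((2 * ‖y‖ ^ s) ^ 2) *
      fracGradSq L s v := by
  simp_rw [enorm_sq_eq_sum]
  rw [lintegral_finsetSum]
  · rw [fracGradSq]
    simp_rw [Finset.mul_sum]
    rw [Summable.tsum_finsetSum fun _ _ => ENNReal.summable, Finset.mul_sum]
    refine Finset.sum_le_sum fun i _ => ?_
    have := lintegral_translate_sub_le hL hs (measurable_coord hv i)
      (hp.postcomp fun z => (z i : ℂ)) (lintegral_coord_ne_top h2 i) y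
    simp_rw [fourierCoefficient_eq hL]
    refine le_trans (le_of_eq ?_) this
    refine lintegral_congr fun x => ?_
    simp
  · intro i _
    have : Measurable fun x => v (x - y) - v x := by fun_prop
    exact (measurable_coord this i).enorm.pow_const 2

theorem hasFDerivAt_expWave (m : Fin d → ℤ) (x : Space d) :
    HasFDerivAt (expWave L m)
      ((Complex.I * expWave L m x) • Complex.ofRealCLM.comp (innerSL ℝ (waveVector L m))) x := by
  have h1 : HasFDerivAt (fun x : Space d => ((inner ℝ (waveVector L m) x : ℝ) : ℂ))
      (Complex.ofRealCLM.comp (innerSL ℝ (waveVector L m))) x :=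
    (Complex.ofRealCLM.comp (innerSL ℝ (waveVector L m))).hasFDerivAt
  have h2 := (h1.const_mul Complex.I).cexp
  convert! h2 using 1
  rw [smul_smul, mul_comm]
  rfl

theorem gradient_apply_eq {ψ : Space d → ℝ} {ψ' : Space d →L[ℝ] ℝ} {x : Space d}
    (h : HasFDerivAt ψ ψ' x) (i : Fin d) :
    gradient ψ x i = ψ' (EuclideanSpace.single i 1) := by
  have h1 : inner ℝ (gradient ψ x) (EuclideanSpace.single i 1) = ψ' (EuclideanSpace.single i 1) := by
    rw [gradient, h.fderiv, InnerProductSpace.toDual_symm_apply]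
  rw [← h1, EuclideanSpace.inner_single_right]
  simp

/-- The real part of a trigonometric polynomial. -/
def reTrig {d : ℕ} (L : ℝ) (S : Finset (Fin d → ℤ)) (c : (Fin d → ℤ) → ℂ) (x : Space d) : ℝ :=
  (∑ m ∈ S, c m * expWave L m x).re

theorem contDiff_reTrig (S : Finset (Fin d → ℤ)) (c : (Fin d → ℤ) → ℂ) :
    ContDiff ℝ ∞ (reTrig L S c : Space d → ℝ) := by
  unfold reTrig
  refine Complex.reCLM.contDiff.comp ?_
  exact ContDiff.sum fun m _ => contDiff_const.mul (contDiff_expWave m)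

theorem isPeriodic_reTrig (hL : 0 < L) (S : Finset (Fin d → ℤ)) (c : (Fin d → ℤ) → ℂ) :
    IsPeriodic L (reTrig L S c : Space d → ℝ) :=
  (isPeriodic_trigPoly hL S c).postcomp Complex.re

theorem hasFDerivAt_reTrig (S : Finset (Fin d → ℤ)) (c : (Fin d → ℤ) → ℂ) (x : Space d) :
    HasFDerivAt (reTrig L S c) (Complex.reCLM.comp (∑ m ∈ S, c m •
      ((Complex.I * expWave L m x) • Complex.ofRealCLM.comp (innerSL ℝ (waveVector L m))))) x := by
  refine (Complex.reCLM.hasFDerivAt).comp x ?_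
  exact HasFDerivAt.fun_sum fun m _ => (hasFDerivAt_expWave m x).const_mul (c m)

theorem gradient_reTrig (S : Finset (Fin d → ℤ)) (c : (Fin d → ℤ) → ℂ) (x : Space d) (i : Fin d) :
    gradient (reTrig L S c) x i =
      reTrig L S (fun m => c m * (Complex.I * (waveVector L m i : ℝ))) x := by
  rw [gradient_apply_eq (hasFDerivAt_reTrig S c x), reTrig]
  simp only [ContinuousLinearMap.comp_apply, Complex.reCLM_apply, _root_.sum_apply,
    _root_.smul_apply, smul_eq_mul, innerSL_apply_apply, Complex.ofRealCLM_apply,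
    EuclideanSpace.inner_single_right]
  congr 1
  refine Finset.sum_congr rfl fun m _ => ?_
  simp
  ring

theorem integral_mul_re_const_mul {μ : Measure (Space d)} {f z : Space d → ℂ} {g : Space d → ℝ}
    (hg : ∀ x, f x = (g x : ℂ)) (hz : Integrable (fun x => f x * z x) μ) (c : ℂ) :
    ∫ x, g x * (c * z x).re ∂μ = (c * ∫ x, f x * z x ∂μ).re := by
  rw [← integral_const_mul]
  have h := integral_re (hz.const_mul c)
  simp only [RCLike.re_eq_complex_re] at h
  rw [← h]
  congr 1
  ext x
  rw [hg x, mul_left_comm, Complex.re_ofReal_mul]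

/-- Fourier coefficients of a weak gradient. -/
theorem IsWeakGradient.coeffC_eq (hL : 0 < L) {f : Space d → ℝ} {g : Space d → Space d}
    (h : IsWeakGradient L f g) (hf : Integrable (fun x => (f x : ℂ)) (cellMeasure d L))
    (hg : ∀ i, Integrable (fun x => (g x i : ℂ)) (cellMeasure d L)) (m : Fin d → ℤ) (i : Fin d) :
    coeffC L (fun x => (g x i : ℂ)) m =
      Complex.I * (waveVector L m i : ℝ) * coeffC L (fun x => (f x : ℂ)) m := by
  -- Test functions are real, so the weak gradient is tested with `Re (c e^{-im·x})`. The choices `c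
  -- = 1` and `c = i` recover the real and imaginary parts.
  have key : ∀ c : ℂ, (c * (Complex.I * (waveVector L (-m) i : ℝ)) *
      coeffC L (fun x => (f x : ℂ)) m).re = -(c * coeffC L (fun x => (g x i : ℂ)) m).re := by
    intro c
    have h1 := h (reTrig L {-m} fun _ => c) (contDiff_reTrig _ _) (isPeriodic_reTrig hL _ _) i
    simp_rw [gradient_reTrig] at h1
    rw [setIntegral_cell hL, setIntegral_cell hL, ← smul_neg,
      smul_right_inj (by positivity : L ^ d ≠ 0)] at h1
    simp only [reTrig, Finset.sum_singleton, ← expWave_neg_eq] at h1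
    rwa [integral_mul_re_const_mul (fun _ => rfl) (integrable_mul_expWave hf m),
      integral_mul_re_const_mul (fun _ => rfl) (integrable_mul_expWave (hg i) m)] at h1
  have hw : waveVector L (-m) i = -waveVector L m i := by simp [waveVector]
  rw [hw] at key
  have k1 := key 1
  have k2 := key Complex.I
  apply Complex.ext
  · simp at k1 ⊢; linarith
  · simp at k2 ⊢; linarith

theorem norm_waveVector_sq (m : Fin d → ℤ) :
    ENNReal.ofReal (‖waveVector L m‖ ^ (2 * (1 : ℝ))) =
      ∑ i, ‖Complex.I * ((waveVector L m i : ℝ) : ℂ)‖ₑ ^ 2 := by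
  have : (2 * (1 : ℝ)) = ((2 : ℕ) : ℝ) := by norm_num
  rw [this, Real.rpow_natCast, ENNReal.ofReal_pow (norm_nonneg _), ofReal_norm, enorm_sq_eq_sum]
  refine Finset.sum_congr rfl fun i _ => ?_
  rw [enorm_mul, ← ofReal_norm Complex.I, Complex.norm_I, ENNReal.ofReal_one, one_mul]

/-- Parseval in each component of the gradient. It identifies the sum in
`lintegral_translate_sub_le` at `s = 1`. -/
theorem IsWeakGradient.tsum_eq (hL : 0 < L) {f : Space d → ℝ} {g : Space d → Space d}
    (h : IsWeakGradient L f g) (hf : Integrable (fun x => (f x : ℂ)) (cellMeasure d L))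
    (hgm : Measurable g) (hgp : IsPeriodic L g) (hg2 : ∫⁻ x, ‖g x‖ₑ ^ 2 ∂cellMeasure d L ≠ ⊤) :
    ∑' m, ENNReal.ofReal (‖waveVector L m‖ ^ (2 * (1 : ℝ))) * ‖coeffC L (fun x => (f x : ℂ)) m‖ₑ ^ 2
      = ∫⁻ x, ‖g x‖ₑ ^ 2 ∂cellMeasure d L := by
  have hgi : ∀ i, Integrable (fun x => (g x i : ℂ)) (cellMeasure d L) := fun i =>
    integrable_of_lintegral_ne_top (measurable_coord hgm i)
      (lintegral_enorm_ne_top hL (measurable_coord hgm i) (lintegral_coord_ne_top hg2 i))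
  simp_rw [enorm_sq_eq_sum]
  rw [lintegral_finsetSum _ fun i _ => (measurable_coord hgm i).enorm.pow_const 2]
  simp_rw [norm_waveVector_sq, Finset.sum_mul]
  rw [Summable.tsum_finsetSum fun _ _ => ENNReal.summable]
  refine Finset.sum_congr rfl fun i _ => ?_
  rw [← tsum_enorm_sq_coeffC hL (measurable_coord hgm i) (hgp.postcomp fun z => (z i : ℂ))
    (lintegral_coord_ne_top hg2 i)]
  refine tsum_congr fun m => ?_
  rw [h.coeffC_eq hL hf hgi, enorm_mul _ (coeffC L _ m), mul_pow]

theorem ofReal_sq_mul_rpow_half {a : ℝ} (ha : 0 ≤ a) (b : ℝ≥0∞) :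
    (ENNReal.ofReal (a ^ 2) * b) ^ (1 / 2 : ℝ) = ENNReal.ofReal a * b ^ (1 / 2 : ℝ) := by
  rw [ENNReal.mul_rpow_of_nonneg _ _ (by norm_num), ENNReal.ofReal_pow ha, ← ENNReal.rpow_natCast,
    ← ENNReal.rpow_mul]
  norm_num

/-- Convolution of a periodic function with a mean-zero kernel is controlled by its gradient. -/
theorem lintegral_enorm_conv_le_gradient (hL : 0 < L) {f : Space d → ℝ} {g : Space d → Space d}
    (h : IsWeakGradient L f g) (hfm : Measurable f) (hfp : IsPeriodic L f)
    (hf2 : ∫⁻ x, ‖f x‖ₑ ^ 2 ∂cellMeasure d L ≠ ⊤)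
    (hgm : Measurable g) (hgp : IsPeriodic L g) (hg2 : ∫⁻ x, ‖g x‖ₑ ^ 2 ∂cellMeasure d L ≠ ⊤)
    {k : Space d → ℂ} (hk : Measurable k) (hki : Integrable k) (hk0 : ∫ y, k y = 0) :
    ∫⁻ x, ‖conv k (fun x => (f x : ℂ)) x‖ₑ ∂cellMeasure d L ≤
      (∫⁻ y, ‖k y‖ₑ * ENNReal.ofReal (2 * ‖y‖)) *
        (∫⁻ x, ‖g x‖ₑ ^ 2 ∂cellMeasure d L) ^ (1 / 2 : ℝ) := by
  set F : Space d → ℂ := fun x => (f x : ℂ) with hF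
  have hFm : Measurable F := Complex.measurable_ofReal.comp hfm
  have hFp : IsPeriodic L F := hfp.postcomp _
  have hF2 : ∫⁻ x, ‖F x‖ₑ ^ 2 ∂cellMeasure d L ≠ ⊤ := by
    simpa only [hF, ← ofReal_norm, Complex.norm_real] using hf2
  have hF1 := lintegral_enorm_ne_top hL hFm hF2
  have hFi := integrable_of_lintegral_ne_top hFm hF1
  have hae : ∀ᵐ x ∂cellMeasure d L, ‖conv k F x‖ₑ ≤ ∫⁻ y, ‖k y‖ₑ * ‖F (x - y) - F x‖ₑ := by
    filter_upwards [ae_integrable_conv hL hk hki hFm hFp hF1] with x hx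
    -- The vanishing mean of the kernel allows subtracting the value at `x`, so the modulus of
    -- continuity enters.
    have : conv k F x = ∫ y, k y * (F (x - y) - F x) := by
      simp only [mul_sub]
      rw [integral_sub hx (hki.mul_const _), integral_mul_const, hk0, zero_mul, sub_zero, conv]
    rw [this]
    refine (enorm_integral_le_lintegral_enorm _).trans_eq (lintegral_congr fun y => ?_)
    rw [enorm_mul]
  refine (lintegral_mono_ae hae).trans ?_
  rw [lintegral_lintegral_swap (by fun_prop), ← lintegral_mul_const _ (by fun_prop)]
  refine lintegral_mono fun y => ?_
  rw [lintegral_const_mul _ (by fun_prop), mul_assoc]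
  gcongr
  refine (lintegral_enorm_le_sqrt hL (by fun_prop)).trans ?_
  refine (ENNReal.rpow_le_rpow (lintegral_translate_sub_le hL (s := 1) (by simp) hFm hFp hF2 y)
    (by norm_num)).trans_eq ?_
  rw [Real.rpow_one, ofReal_sq_mul_rpow_half (by positivity), h.tsum_eq hL hFi hgm hgp hg2]

end FixedTime

/-! ### The commutator estimate and the use of incompressibility. -/

section Transport

open scoped Topology ComplexConjugate

variable {d : ℕ} {L : ℝ}

theorem inner_eq_sum (v w : Space d) : ((inner ℝ v w : ℝ) : ℂ) = ∑ i, (v i : ℂ) * (w i : ℂ) := by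
  rw [PiLp.inner_apply]
  push_cast
  refine Finset.sum_congr rfl fun i _ => ?_
  simp [mul_comm]

theorem enorm_ofReal_inner_le (v w : Space d) : ‖((inner ℝ v w : ℝ) : ℂ)‖ₑ ≤ ‖v‖ₑ * ‖w‖ₑ := by
  rw [← ofReal_norm, Complex.norm_real, ← ofReal_norm v, ← ofReal_norm w,
    ← ENNReal.ofReal_mul (norm_nonneg _)]
  exact ENNReal.ofReal_le_ofReal (norm_inner_le_norm v w)

theorem measurable_ofReal_inner {v w : Space d → Space d} (hv : Measurable v) (hw : Measurable w) :
    Measurable fun x => ((inner ℝ (v x) (w x) : ℝ) : ℂ) :=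
  Complex.measurable_ofReal.comp (hv.inner hw)

theorem lintegral_enorm_inner_le {v w : Space d → Space d} (hv : Measurable v) (hw : Measurable w) :
    ∫⁻ x, ‖v x‖ₑ * ‖w x‖ₑ ∂cellMeasure d L ≤ (∫⁻ x, ‖v x‖ₑ ^ 2 ∂cellMeasure d L) ^ (1 / 2 : ℝ) *
      (∫⁻ x, ‖w x‖ₑ ^ 2 ∂cellMeasure d L) ^ (1 / 2 : ℝ) := by
  have h := ENNReal.lintegral_mul_le_Lp_mul_Lq (cellMeasure d L) Real.HolderConjugate.two_two
    hv.enorm.aemeasurable hw.enorm.aemeasurable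
  simpa using h

theorem lintegral_inner_ne_top {v w : Space d → Space d} (hv : Measurable v) (hw : Measurable w)
    (hv2 : ∫⁻ x, ‖v x‖ₑ ^ 2 ∂cellMeasure d L ≠ ⊤) (hw2 : ∫⁻ x, ‖w x‖ₑ ^ 2 ∂cellMeasure d L ≠ ⊤) :
    ∫⁻ x, ‖((inner ℝ (v x) (w x) : ℝ) : ℂ)‖ₑ ∂cellMeasure d L ≠ ⊤ := by
  refine ne_top_of_le_ne_top ?_ ((lintegral_mono fun x => enorm_ofReal_inner_le _ _).trans
    (lintegral_enorm_inner_le hv hw))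
  exact ENNReal.mul_ne_top (ENNReal.rpow_ne_top_of_nonneg (by norm_num) hv2)
    (ENNReal.rpow_ne_top_of_nonneg (by norm_num) hw2)

/-- The commutator between a convolution and the transport by a vector field. -/
theorem lintegral_commutator_le (hL : 0 < L) {s : ℝ} (hs : s ∈ Icc (0 : ℝ) 1)
    {u g : Space d → Space d} (hu : Measurable u) (hup : IsPeriodic L u)
    (hu2 : ∫⁻ x, ‖u x‖ₑ ^ 2 ∂cellMeasure d L ≠ ⊤) (hg : Measurable g) (hgp : IsPeriodic L g)
    {k : Space d → ℂ} (hk : Measurable k) :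
    ∫⁻ x, (∫⁻ y, ‖k y‖ₑ * (‖u (x - y) - u x‖ₑ * ‖g (x - y)‖ₑ)) ∂cellMeasure d L ≤
      (∫⁻ y, ‖k y‖ₑ * ENNReal.ofReal (2 * ‖y‖ ^ s)) * fracGradSq L s u ^ (1 / 2 : ℝ) *
        (∫⁻ x, ‖g x‖ₑ ^ 2 ∂cellMeasure d L) ^ (1 / 2 : ℝ) := by
  have hs0 := hs.1
  -- For fixed `y`, Cauchy–Schwarz in `x` puts the increment of `u` and the translate of `g` in L²;
  -- the latter has the norm of `g`.
  rw [lintegral_lintegral_swap (by fun_prop), mul_assoc, ← lintegral_mul_const _ (by fun_prop)]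
  refine lintegral_mono fun y => ?_
  rw [lintegral_const_mul _ (by fun_prop), mul_assoc]
  gcongr
  refine (lintegral_enorm_inner_le (v := fun x => u (x - y) - u x) (w := fun x => g (x - y))
    (by fun_prop) (by fun_prop)).trans ?_
  rw [lintegral_comp_sub hL (f := fun x => ‖g x‖ₑ ^ 2) (hg.enorm.pow_const 2)
      (hgp.postcomp fun z => ‖z‖ₑ ^ 2), ← mul_assoc]
  gcongr
  refine (ENNReal.rpow_le_rpow (lintegral_translate_sub_le_fracGradSq hL hs hu hup hu2 y)
    (by norm_num)).trans_eq ?_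
  rw [ofReal_sq_mul_rpow_half (by positivity)]

theorem norm_reTrig_le (S : Finset (Fin d → ℤ)) (c : (Fin d → ℤ) → ℂ) (x : Space d) :
    ‖reTrig L S c x‖ ≤ ∑ m ∈ S, ‖c m‖ := by
  refine (Complex.abs_re_le_norm _).trans ((norm_sum_le _ _).trans
    (Finset.sum_le_sum fun m _ => ?_))
  rw [norm_mul, norm_expWave, mul_one]

/-- Differentiation commutes with the convolution, since both sides multiply the coefficients of `θ`
by `i m_i` and the transform of `k`. This expresses the gradient of the projection as an integral of
`g` against `k`, as the commutator requires. -/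
theorem reTrig_gradient_ae_eq (hL : 0 < L) {θ : Space d → ℝ} {g : Space d → Space d}
    (h : IsWeakGradient L θ g) (hθ : Integrable (fun x => (θ x : ℂ)) (cellMeasure d L))
    (hg : Measurable g) (hgp : IsPeriodic L g) (hg2 : ∫⁻ x, ‖g x‖ₑ ^ 2 ∂cellMeasure d L ≠ ⊤)
    {k : Space d → ℂ} (hk : Measurable k) (hki : Integrable k) (S : Finset (Fin d → ℤ))
    (hS : ∀ m, m ∉ S → waveTransform L k m = 0) :
    ∀ᵐ x ∂cellMeasure d L, ∀ i,
      gradient (reTrig L S fun m => waveTransform L k m * coeffC L (fun x => (θ x : ℂ)) m) x i =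
        (conv k (fun x => (g x i : ℂ)) x).re := by
  rw [ae_all_iff]
  intro i
  have hg1 : ∀ i, ∫⁻ x, ‖(g x i : ℂ)‖ₑ ∂cellMeasure d L ≠ ⊤ := fun i =>
    lintegral_enorm_ne_top hL (measurable_coord hg i) (lintegral_coord_ne_top hg2 i)
  have hgi : ∀ i, Integrable (fun x => (g x i : ℂ)) (cellMeasure d L) := fun i =>
    integrable_of_lintegral_ne_top (measurable_coord hg i) (hg1 i)
  filter_upwards [conv_ae_eq_trigPoly hL hk hki (measurable_coord hg i)
    (hgp.postcomp fun z => (z i : ℂ)) (hg1 i) S hS] with x hx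
  rw [gradient_reTrig, hx, reTrig]
  congr 1
  refine Finset.sum_congr rfl fun m _ => ?_
  rw [h.coeffC_eq hL hθ hgi]
  ring

/-- Testing the transport term of the projected equation with a bounded nonlinear function of the
projection: by incompressibility, only the commutator contributes. -/
theorem enorm_integral_transport_le (hL : 0 < L) {s : ℝ} (hs : s ∈ Icc (0 : ℝ) 1)
    {u g : Space d → Space d} {θ : Space d → ℝ} (hu : Measurable u) (hup : IsPeriodic L u)
    (hu2 : ∫⁻ x, ‖u x‖ₑ ^ 2 ∂cellMeasure d L ≠ ⊤) (hdiv : WeakDivFree L u)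
    (hg : Measurable g) (hgp : IsPeriodic L g) (hg2 : ∫⁻ x, ‖g x‖ₑ ^ 2 ∂cellMeasure d L ≠ ⊤)
    (hθ : Integrable (fun x => (θ x : ℂ)) (cellMeasure d L)) (h : IsWeakGradient L θ g)
    {k : Space d → ℂ} (hk : Measurable k) (hki : Integrable k) (S : Finset (Fin d → ℤ))
    (hS : ∀ m, m ∉ S → waveTransform L k m = 0)
    {B : ℝ → ℝ} (hB : ContDiff ℝ ∞ B) (hB1 : ∀ r, |deriv B r| ≤ 1) :
    ‖∫ x, deriv B (reTrig L S (fun m => waveTransform L k m * coeffC L (fun x => (θ x : ℂ)) m) x) *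
        reTrig L S (fun m => waveTransform L k m *
          coeffC L (fun x => ((inner ℝ (u x) (g x) : ℝ) : ℂ)) m) x ∂cellMeasure d L‖ₑ ≤
      (∫⁻ y, ‖k y‖ₑ * ENNReal.ofReal (2 * ‖y‖ ^ s)) * fracGradSq L s u ^ (1 / 2 : ℝ) *
        (∫⁻ x, ‖g x‖ₑ ^ 2 ∂cellMeasure d L) ^ (1 / 2 : ℝ) := by
  set w := reTrig L S (fun m => waveTransform L k m * coeffC L (fun x => (θ x : ℂ)) m) with hw
  set H := reTrig L S (fun m => waveTransform L k m *
          coeffC L (fun x => ((inner ℝ (u x) (g x) : ℝ) : ℂ)) m) with hH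
  have hwd : ContDiff ℝ ∞ w := contDiff_reTrig _ _
  have hBw : ContDiff ℝ ∞ (B ∘ w) := hB.comp hwd
  have hgrad : ∀ x, gradient (B ∘ w) x = deriv B (w x) • gradient w x := by
    intro x
    have h1 : HasFDerivAt w (fderiv ℝ w x) x :=
      (hwd.differentiable (by simp) x).hasFDerivAt
    have h2 : HasDerivAt B (deriv B (w x)) (w x) :=
      (hB.differentiable (by simp) (w x)).hasDerivAt
    ext i
    rw [gradient_apply_eq (h2.comp_hasFDerivAt x h1)]
    simp only [PiLp.smul_apply, gradient_apply_eq h1]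
    rfl
  -- `B ∘ w` is smooth and periodic, hence admissible in the weak divergence condition, and its
  -- gradient is `B'(w) ∇w`.
  have hd0 : ∫ x, deriv B (w x) * inner ℝ (u x) (gradient w x) ∂cellMeasure d L = 0 := by
    have := hdiv (B ∘ w) hBw ((isPeriodic_reTrig hL _ _).postcomp B)
    rw [setIntegral_cell hL, smul_eq_zero] at this
    have := this.resolve_left (by positivity)
    simp_rw [hgrad, inner_smul_right] at this
    exact this
  have hF1 := lintegral_inner_ne_top hu hg hu2 hg2
  have hFm := measurable_ofReal_inner hu hg
  have hFp : IsPeriodic L fun x => ((inner ℝ (u x) (g x) : ℝ) : ℂ) := fun i x => by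
    simp only [hup i x, hgp i x]
  have hg1 : ∀ i, ∫⁻ x, ‖(g x i : ℂ)‖ₑ ∂cellMeasure d L ≠ ⊤ := fun i =>
    lintegral_enorm_ne_top hL (measurable_coord hg i) (lintegral_coord_ne_top hg2 i)
  have hBm : Measurable fun x => deriv B (w x) :=
    ((hB.continuous_deriv (by simp)).comp hwd.continuous).measurable
  have hwg : Continuous fun x => gradient w x := by
    have : ∀ x, gradient w x = (InnerProductSpace.toDual ℝ (Space d)).symm (fderiv ℝ w x) :=
      fun x => rfl
    simp_rw [this]
    exact (InnerProductSpace.toDual ℝ (Space d)).symm.continuous.comp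
      (hwd.continuous_fderiv (by simp))
  -- pointwise identification of the commutator
  have hae : ∀ᵐ x ∂cellMeasure d L, ‖H x - inner ℝ (u x) (gradient w x)‖ₑ ≤
      ∫⁻ y, ‖k y‖ₑ * (‖u (x - y) - u x‖ₑ * ‖g (x - y)‖ₑ) := by
    have hgi := fun i => ae_integrable_conv hL hk hki (measurable_coord hg i)
      (hgp.postcomp fun z => (z i : ℂ)) (hg1 i)
    rw [← ae_all_iff] at hgi
    filter_upwards [conv_ae_eq_trigPoly hL hk hki hFm hFp hF1 S hS,
      reTrig_gradient_ae_eq hL h hθ hg hgp hg2 hk hki S hS,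
      ae_integrable_conv hL hk hki hFm hFp hF1, hgi] with x h1 h2 h3 h4
    have e1 : H x = (conv k (fun x => ((inner ℝ (u x) (g x) : ℝ) : ℂ)) x).re := by
      rw [h1, hH, reTrig]
    -- Here `u` is frozen at `x` while `g` is evaluated at `x - y`. Subtracting this from the
    -- integral giving `H x` leaves the increment `u (x - y) - u x`.
    have e2 : inner ℝ (u x) (gradient w x) =
        (∫ y, k y * ((inner ℝ (u x) (g (x - y)) : ℝ) : ℂ)).re := by
      have : (fun y => k y * ((inner ℝ (u x) (g (x - y)) : ℝ) : ℂ)) =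
          fun y => ∑ i, (u x i : ℂ) * (k y * (g (x - y) i : ℂ)) := by
        ext y
        rw [inner_eq_sum, Finset.mul_sum]
        exact Finset.sum_congr rfl fun i _ => by ring
      rw [this, integral_finsetSum _ fun i _ => (h4 i).const_mul _, PiLp.inner_apply, Complex.re_sum]
      refine Finset.sum_congr rfl fun i _ => ?_
      rw [integral_const_mul, Complex.re_ofReal_mul, h2 i, conv]
      simp [mul_comm]
    have h5 : Integrable fun y => k y * ((inner ℝ (u x) (g (x - y)) : ℝ) : ℂ) := by
      have : (fun y => k y * ((inner ℝ (u x) (g (x - y)) : ℝ) : ℂ)) =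
          fun y => ∑ i, (u x i : ℂ) * (k y * (g (x - y) i : ℂ)) := by
        ext y
        rw [inner_eq_sum, Finset.mul_sum]
        exact Finset.sum_congr rfl fun i _ => by ring
      rw [this]
      exact integrable_finsetSum _ fun i _ => (h4 i).const_mul _
    rw [e1, e2, ← Complex.sub_re, conv, ← integral_sub h3 h5]
    have e3 : ∀ z : ℂ, ‖z.re‖ₑ ≤ ‖z‖ₑ := fun z => by
      rw [← ofReal_norm, ← ofReal_norm]
      exact ENNReal.ofReal_le_ofReal (Complex.abs_re_le_norm z)
    refine (e3 _).trans ((enorm_integral_le_lintegral_enorm _).trans (lintegral_mono fun y => ?_))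
    rw [← mul_sub, enorm_mul, ← Complex.ofReal_sub, ← inner_sub_left]
    gcongr
    exact enorm_ofReal_inner_le _ _
  have hint1 : Integrable (fun x => deriv B (w x) * H x) (cellMeasure d L) := by
    refine Integrable.bdd_mul (c := 1) ?_ hBm.aestronglyMeasurable
      (ae_of_all _ fun x => hB1 _)
    exact (integrable_trigPoly S _).re
  have hint2 : Integrable (fun x => deriv B (w x) * inner ℝ (u x) (gradient w x))
      (cellMeasure d L) := by
    have e : (fun x => deriv B (w x) * inner ℝ (u x) (gradient w x)) =
        fun x => ∑ i, (deriv B (w x) * gradient w x i) * u x i := by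
      ext x
      rw [PiLp.inner_apply, Finset.mul_sum]
      refine Finset.sum_congr rfl fun i _ => ?_
      simp only [RCLike.inner_apply, conj_trivial]
      ring
    rw [e]
    refine integrable_finsetSum _ fun i _ => ?_
    have hui : Integrable (fun x => u x i) (cellMeasure d L) := by
      have := (integrable_of_lintegral_ne_top (measurable_coord hu i)
        (lintegral_enorm_ne_top hL (measurable_coord hu i) (lintegral_coord_ne_top hu2 i))).re
      simpa using this
    have hgm : Measurable fun x => gradient w x i :=
      (by fun_prop : Continuous fun z : Space d => z i).measurable.comp hwg.measurable
    refine hui.bdd_mul (c := 1 * ∑ m ∈ S, ‖waveTransform L k m *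
      coeffC L (fun x => (θ x : ℂ)) m * (Complex.I * (waveVector L m i : ℝ))‖)
      (hBm.mul hgm).aestronglyMeasurable (ae_of_all _ fun x => ?_)
    rw [norm_mul]
    refine mul_le_mul (hB1 _) ?_ (norm_nonneg _) zero_le_one
    rw [hw, gradient_reTrig]
    exact norm_reTrig_le _ _ _
  have hsub : ∫ x, deriv B (w x) * H x ∂cellMeasure d L =
      ∫ x, deriv B (w x) * (H x - inner ℝ (u x) (gradient w x)) ∂cellMeasure d L := by
    simp only [mul_sub]
    rw [integral_sub hint1 hint2, hd0, sub_zero]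
  rw [hsub]
  refine (enorm_integral_le_lintegral_enorm _).trans ?_
  refine le_trans (lintegral_mono_ae ?_) (lintegral_commutator_le hL hs hu hup hu2 hg hgp hk)
  filter_upwards [hae] with x hx
  rw [enorm_mul]
  refine le_trans ?_ ((one_mul _).trans_le hx)
  gcongr
  rw [← ofReal_norm, ← ENNReal.ofReal_one]
  exact ENNReal.ofReal_le_ofReal (hB1 _)

end Transport

/-! ### Kernels on the whole space, dilations and the heat flow. -/

section Kernels

open scoped Topology ComplexConjugate

variable {d : ℕ}

/-- The Fourier transform of a kernel, without normalizing factor. -/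
def kernelFT {d : ℕ} (k : Space d → ℂ) (ξ : Space d) : ℂ :=
  ∫ y, k y * Complex.exp (-Complex.I * ((inner ℝ ξ y : ℝ) : ℂ))

theorem fourierTransform_eq (f : Space d → ℂ) (ξ : Space d) :
    fourierTransform f ξ = (((2 * Real.pi) ^ (-(d : ℝ) / 2) : ℝ) : ℂ) * kernelFT f ξ := rfl

theorem waveTransform_eq_kernelFT (L : ℝ) (k : Space d → ℂ) (m : Fin d → ℤ) :
    waveTransform L k m = kernelFT k (waveVector L m) := by
  rw [waveTransform, kernelFT]
  congr 1
  ext y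
  rw [expWave, inner_neg_right]
  push_cast
  ring_nf

/-- The `L¹` norm of a kernel with weight `1 + ‖y‖`. -/
def weightedNorm {d : ℕ} (k : Space d → ℂ) : ℝ≥0∞ := ∫⁻ y, ‖k y‖ₑ * ENNReal.ofReal (1 + ‖y‖)

theorem lintegral_enorm_le_weightedNorm (k : Space d → ℂ) : ∫⁻ y, ‖k y‖ₑ ≤ weightedNorm k := by
  refine lintegral_mono fun y => le_mul_of_one_le_right bot_le ?_
  rw [← ENNReal.ofReal_one]
  exact ENNReal.ofReal_le_ofReal (by linarith [norm_nonneg y])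

theorem integrable_of_weightedNorm {k : Space d → ℂ} (hk : Measurable k)
    (h : weightedNorm k ≠ ⊤) : Integrable k :=
  ⟨hk.aestronglyMeasurable, (lintegral_enorm_le_weightedNorm k).trans_lt h.lt_top⟩

/-- The `L¹`-normalized dilation of a kernel. -/
def dil {d : ℕ} (lam : ℝ) (k : Space d → ℂ) (y : Space d) : ℂ := ((lam ^ d : ℝ) : ℂ) * k (lam • y)

theorem measurable_dil (lam : ℝ) {k : Space d → ℂ} (hk : Measurable k) : Measurable (dil lam k) :=
  (hk.comp (measurable_const_smul lam)).const_mul _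

theorem lintegral_comp_smul {lam : ℝ} (hl : 0 < lam) {f : Space d → ℝ≥0∞} (hf : Measurable f) :
    ∫⁻ y, f (lam • y) = ENNReal.ofReal ((lam ^ d)⁻¹) * ∫⁻ y, f y := by
  have h := Measure.map_addHaar_smul (volume : Measure (Space d)) hl.ne'
  rw [← lintegral_map hf (measurable_const_smul lam), h, lintegral_smul_measure]
  simp [abs_of_pos (pow_pos hl d)]

theorem lintegral_dil {lam : ℝ} (hl : 0 < lam) {k : Space d → ℂ} (hk : Measurable k)
    {w : Space d → ℝ≥0∞} (hw : Measurable w) :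
    ∫⁻ y, ‖dil lam k y‖ₑ * w y = ∫⁻ y, ‖k y‖ₑ * w (lam⁻¹ • y) := by
  have h1 := lintegral_comp_smul hl (f := fun y => ‖k y‖ₑ * w (lam⁻¹ • y))
    (hk.enorm.mul (hw.comp (measurable_const_smul _)))
  have hl' : 0 < lam ^ d := pow_pos hl d
  have h2 : ∀ y, ‖dil lam k y‖ₑ * w y =
      ENNReal.ofReal (lam ^ d) * (‖k (lam • y)‖ₑ * w (lam⁻¹ • (lam • y))) := by
    intro y
    rw [inv_smul_smul₀ hl.ne', dil, enorm_mul, ← ofReal_norm ((lam ^ d : ℝ) : ℂ),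
      Complex.norm_real, Real.norm_of_nonneg hl'.le, mul_assoc]
  simp_rw [h2]
  rw [lintegral_const_mul _ (by fun_prop), h1, ← mul_assoc, ← ENNReal.ofReal_mul hl'.le,
    mul_inv_cancel₀ hl'.ne', ENNReal.ofReal_one, one_mul]

theorem lintegral_enorm_dil {lam : ℝ} (hl : 0 < lam) {k : Space d → ℂ} (hk : Measurable k) :
    ∫⁻ y, ‖dil lam k y‖ₑ = ∫⁻ y, ‖k y‖ₑ := by
  simpa using lintegral_dil hl hk (w := fun _ => 1) measurable_const

theorem kernelFT_dil {lam : ℝ} (hl : 0 < lam) (k : Space d → ℂ) (ξ : Space d) :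
    kernelFT (dil lam k) ξ = kernelFT k (lam⁻¹ • ξ) := by
  have h := Measure.integral_comp_smul (volume : Measure (Space d))
    (fun y => k y * Complex.exp (-Complex.I * ((inner ℝ (lam⁻¹ • ξ) y : ℝ) : ℂ))) lam
  have hl' : 0 < lam ^ d := pow_pos hl d
  rw [kernelFT, kernelFT]
  have h2 : ∀ y, dil lam k y * Complex.exp (-Complex.I * ((inner ℝ ξ y : ℝ) : ℂ)) =
      ((lam ^ d : ℝ) : ℂ) * (k (lam • y) *
        Complex.exp (-Complex.I * ((inner ℝ (lam⁻¹ • ξ) (lam • y) : ℝ) : ℂ))) := by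
    intro y
    rw [dil, real_inner_smul_left, real_inner_smul_right, inv_mul_cancel_left₀ hl.ne', mul_assoc]
  simp_rw [h2]
  rw [integral_const_mul, h, ← Complex.real_smul, smul_smul]
  simp [abs_of_pos hl', hl'.ne']

theorem integrable_mul_exp {k : Space d → ℂ} (hk : Integrable k) (ξ : Space d) :
    Integrable fun y => k y * Complex.exp (-Complex.I * ((inner ℝ ξ y : ℝ) : ℂ)) := by
  refine hk.mul_bdd (c := 1) (Continuous.aestronglyMeasurable (by fun_prop))
    (ae_of_all _ fun y => ?_)
  have : -Complex.I * ((inner ℝ ξ y : ℝ) : ℂ) = ((-inner ℝ ξ y : ℝ) : ℂ) * Complex.I := by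
    push_cast; ring
  rw [this, Complex.norm_exp_ofReal_mul_I]

theorem kernelFT_conv {h f : Space d → ℂ} (hh : Integrable h) (hf : Integrable f) (ξ : Space d) :
    kernelFT (conv h f) ξ = kernelFT h ξ * kernelFT f ξ := by
  have h1 := integral_convolution (ContinuousLinearMap.mul ℂ ℂ) (μ := (volume : Measure (Space d)))
    (ν := volume) (integrable_mul_exp hh ξ) (integrable_mul_exp hf ξ)
  simp only [ContinuousLinearMap.mul_apply'] at h1
  rw [kernelFT, kernelFT, kernelFT, ← h1]
  congr 1
  ext x
  rw [convolution_def, conv, ← integral_mul_const]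
  congr 1
  ext z
  simp only [ContinuousLinearMap.mul_apply']
  have : Complex.exp (-Complex.I * ((inner ℝ ξ x : ℝ) : ℂ)) =
      Complex.exp (-Complex.I * ((inner ℝ ξ z : ℝ) : ℂ)) *
        Complex.exp (-Complex.I * ((inner ℝ ξ (x - z) : ℝ) : ℂ)) := by
    rw [← Complex.exp_add, inner_sub_right]
    push_cast
    ring_nf
  rw [this]
  ring

/-- The weight is submultiplicative: `1 + |x| ≤ (1 + |z|)(1 + |x - z|)`. -/
theorem weightedNorm_conv_le {h f : Space d → ℂ} (hh : Measurable h) (hf : Measurable f) :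
    weightedNorm (conv h f) ≤ weightedNorm h * weightedNorm f := by
  have h1 : ∀ x, ‖conv h f x‖ₑ * ENNReal.ofReal (1 + ‖x‖) ≤
      ∫⁻ z, (‖h z‖ₑ * ENNReal.ofReal (1 + ‖z‖)) * (‖f (x - z)‖ₑ * ENNReal.ofReal (1 + ‖x - z‖)) := by
    intro x
    refine (mul_le_mul_left (enorm_conv_le h f x) _).trans ?_
    rw [← lintegral_mul_const _ (by fun_prop)]
    refine lintegral_mono fun z => ?_
    have : ENNReal.ofReal (1 + ‖x‖) ≤ ENNReal.ofReal (1 + ‖z‖) * ENNReal.ofReal (1 + ‖x - z‖) := by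
      rw [← ENNReal.ofReal_mul (by positivity)]
      refine ENNReal.ofReal_le_ofReal ?_
      have h2 : ‖x‖ ≤ ‖z‖ + ‖x - z‖ := by
        simpa using norm_add_le z (x - z)
      nlinarith [norm_nonneg z, norm_nonneg (x - z)]
    calc ‖h z‖ₑ * ‖f (x - z)‖ₑ * ENNReal.ofReal (1 + ‖x‖)
        ≤ ‖h z‖ₑ * ‖f (x - z)‖ₑ * (ENNReal.ofReal (1 + ‖z‖) * ENNReal.ofReal (1 + ‖x - z‖)) := by
          gcongr
      _ = _ := by ring
  refine (lintegral_mono h1).trans_eq ?_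
  rw [lintegral_lintegral_swap (by fun_prop), weightedNorm, ← lintegral_mul_const _ (by fun_prop)]
  refine lintegral_congr fun z => ?_
  rw [lintegral_const_mul _ (by fun_prop),
    lintegral_sub_right_eq_self (fun x => ‖f x‖ₑ * ENNReal.ofReal (1 + ‖x‖)) z, weightedNorm]

/-- The heat kernel at time one. -/
def gauss {d : ℕ} (z : Space d) : ℂ :=
  (((4 * Real.pi) ^ (-(d : ℝ) / 2) * Real.exp (-(‖z‖ ^ 2 / 4)) : ℝ) : ℂ)

theorem measurable_gauss : Measurable (gauss : Space d → ℂ) := by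
  unfold gauss; fun_prop

theorem kernelFT_gauss (ξ : Space d) : kernelFT gauss ξ = ((Real.exp (-‖ξ‖ ^ 2) : ℝ) : ℂ) := by
  have h := GaussianFourier.integral_cexp_neg_mul_sq_norm_add (V := Space d) (b := 1 / 4)
    (by norm_num) (-Complex.I) ξ
  rw [kernelFT]
  have e : ∀ y : Space d, gauss y * Complex.exp (-Complex.I * ((inner ℝ ξ y : ℝ) : ℂ)) =
      (((4 * Real.pi) ^ (-(d : ℝ) / 2) : ℝ) : ℂ) *
        Complex.exp (-(1 / 4) * (‖y‖ : ℂ) ^ 2 + -Complex.I * ((inner ℝ ξ y : ℝ) : ℂ)) := by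
    intro y
    rw [gauss, Complex.exp_add]
    push_cast
    ring_nf
  simp_rw [e]
  rw [integral_const_mul, h]
  have hpi : (0 : ℝ) < 4 * Real.pi := by positivity
  have h2 : ((Real.pi : ℂ) / (1 / 4)) ^ ((Module.finrank ℝ (Space d) : ℂ) / 2) =
      (((4 * Real.pi) ^ ((d : ℝ) / 2) : ℝ) : ℂ) := by
    rw [Complex.ofReal_cpow hpi.le]
    congr 1
    · push_cast; ring
    · simp
  rw [h2, ← mul_assoc, ← Complex.ofReal_mul, ← Real.rpow_add hpi]
  have h3 : -(d : ℝ) / 2 + d / 2 = 0 := by ring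
  rw [h3, Real.rpow_zero]
  push_cast
  rw [one_mul, neg_sq, Complex.I_sq]
  congr 1
  ring

theorem norm_gauss_eq (z : Space d) :
    ‖gauss z‖ = (4 * Real.pi) ^ (-(d : ℝ) / 2) * Real.exp (-(‖z‖ ^ 2 / 4)) := by
  rw [gauss, Complex.norm_real, Real.norm_of_nonneg (by positivity)]

theorem integrable_exp_neg_sq {b : ℝ} (hb : 0 < b) :
    Integrable fun z : Space d => Real.exp (-(b * ‖z‖ ^ 2)) := by
  have h := (GaussianFourier.integrable_cexp_neg_mul_sq_norm_add (V := Space d) (b := (b : ℂ))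
    (by simpa using hb) 0 0).norm
  refine h.congr (ae_of_all _ fun z => ?_)
  simp only [Complex.norm_exp]
  congr 1
  simp [← Complex.ofReal_pow]

theorem weightedNorm_gauss_ne_top : weightedNorm (gauss : Space d → ℂ) ≠ ⊤ := by
  have h : Integrable fun z : Space d =>
      ((4 * Real.pi) ^ (-(d : ℝ) / 2) * 3) * Real.exp (-(1 / 8 * ‖z‖ ^ 2)) :=
    (integrable_exp_neg_sq (by norm_num)).const_mul _
  refine ne_top_of_le_ne_top h.2.ne (lintegral_mono fun z => ?_)
  rw [← ofReal_norm, ← ofReal_norm, ← ENNReal.ofReal_mul (norm_nonneg _), norm_gauss_eq]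
  refine ENNReal.ofReal_le_ofReal ?_
  rw [Real.norm_of_nonneg (by positivity)]
  beta_reduce
  rw [mul_assoc, mul_assoc]
  refine mul_le_mul_of_nonneg_left ?_ (by positivity)
  -- Half of the Gaussian decay absorbs the weight, with constant 3 because `1 + r ≤ 3 (1 + r²/8)`.
  have e : Real.exp (-(‖z‖ ^ 2 / 4)) = Real.exp (-(1 / 8 * ‖z‖ ^ 2)) * Real.exp (-(‖z‖ ^ 2 / 8)) := by
    rw [← Real.exp_add]; congr 1; ring
  rw [e]
  have h2 : 1 + ‖z‖ ≤ 3 * Real.exp (‖z‖ ^ 2 / 8) := by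
    have := Real.add_one_le_exp (‖z‖ ^ 2 / 8)
    nlinarith [sq_nonneg (‖z‖ - 4 / 3)]
  have h3 : Real.exp (-(‖z‖ ^ 2 / 8)) * (1 + ‖z‖) ≤ 3 := by
    calc Real.exp (-(‖z‖ ^ 2 / 8)) * (1 + ‖z‖)
        ≤ Real.exp (-(‖z‖ ^ 2 / 8)) * (3 * Real.exp (‖z‖ ^ 2 / 8)) := by gcongr
      _ = 3 * (Real.exp (-(‖z‖ ^ 2 / 8)) * Real.exp (‖z‖ ^ 2 / 8)) := by ring
      _ = 3 := by rw [← Real.exp_add]; simp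
  calc _ = Real.exp (-(1 / 8 * ‖z‖ ^ 2)) * (Real.exp (-(‖z‖ ^ 2 / 8)) * (1 + ‖z‖)) := by ring
    _ ≤ Real.exp (-(1 / 8 * ‖z‖ ^ 2)) * 3 := by gcongr
    _ = _ := by ring

theorem integrable_gauss : Integrable (gauss : Space d → ℂ) :=
  integrable_of_weightedNorm measurable_gauss weightedNorm_gauss_ne_top

/-- The heat kernel at time `σ ^ 2`. -/
def heat {d : ℕ} (σ : ℝ) : Space d → ℂ := dil σ⁻¹ gauss

theorem measurable_heat (σ : ℝ) : Measurable (heat σ : Space d → ℂ) :=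
  measurable_dil _ measurable_gauss

theorem kernelFT_heat {σ : ℝ} (hσ : 0 < σ) (ξ : Space d) :
    kernelFT (heat σ) ξ = ((Real.exp (-(σ ^ 2 * ‖ξ‖ ^ 2)) : ℝ) : ℂ) := by
  rw [heat, kernelFT_dil (inv_pos.mpr hσ), kernelFT_gauss, inv_inv, norm_smul,
    Real.norm_of_nonneg hσ.le, mul_pow]

theorem weightedNorm_heat_le {σ M : ℝ} (hσ : 0 < σ) (hM : σ ≤ M) (hM1 : 1 ≤ M) :
    weightedNorm (heat σ : Space d → ℂ) ≤ ENNReal.ofReal M * weightedNorm (gauss : Space d → ℂ) := by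
  rw [weightedNorm, heat, lintegral_dil (inv_pos.mpr hσ) measurable_gauss (by fun_prop), weightedNorm,
    ← lintegral_const_mul _ (by have := measurable_gauss (d := d); fun_prop)]
  refine lintegral_mono fun y => ?_
  rw [← mul_assoc, mul_comm (ENNReal.ofReal M), mul_assoc, ← ENNReal.ofReal_mul (by linarith)]
  gcongr
  rw [inv_inv, norm_smul, Real.norm_of_nonneg hσ.le]
  nlinarith [norm_nonneg y]

theorem weightedNorm_heat_ne_top {σ : ℝ} (hσ : 0 < σ) : weightedNorm (heat σ : Space d → ℂ) ≠ ⊤ :=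
  ne_top_of_le_ne_top (ENNReal.mul_ne_top ENNReal.ofReal_ne_top weightedNorm_gauss_ne_top)
    (weightedNorm_heat_le hσ (le_max_left σ 1) (le_max_right σ 1))

theorem integrable_heat {σ : ℝ} (hσ : 0 < σ) : Integrable (heat σ : Space d → ℂ) :=
  integrable_of_weightedNorm (measurable_heat σ) (weightedNorm_heat_ne_top hσ)

/-- Propagating a kernel by the heat flow up to a fixed time keeps it in a bounded set. -/
theorem exists_heat_kernel {f : Space d → ℂ} (hf : Measurable f) (hfw : weightedNorm f ≠ ⊤) (M : ℝ)
    (hM : 1 ≤ M) :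
    ∃ C : ℝ≥0, ∀ ρ : ℝ, 0 < ρ → ρ ≤ M → ∃ K : Space d → ℂ, Measurable K ∧ weightedNorm K ≤ C ∧
      ∀ ξ, kernelFT K ξ = ((Real.exp (-(ρ * ‖ξ‖ ^ 2)) : ℝ) : ℂ) * kernelFT f ξ := by
  have hfin : ENNReal.ofReal M * weightedNorm (gauss : Space d → ℂ) * weightedNorm f ≠ ⊤ :=
    ENNReal.mul_ne_top (ENNReal.mul_ne_top ENNReal.ofReal_ne_top weightedNorm_gauss_ne_top) hfw
  refine ⟨(ENNReal.ofReal M * weightedNorm (gauss : Space d → ℂ) * weightedNorm f).toNNReal,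
    fun ρ hρ hρM => ⟨conv (heat (Real.sqrt ρ)) f, measurable_conv (measurable_heat _) hf, ?_, ?_⟩⟩
  · rw [ENNReal.coe_toNNReal hfin]
    refine (weightedNorm_conv_le (measurable_heat _) hf).trans ?_
    gcongr
    refine weightedNorm_heat_le (Real.sqrt_pos.mpr hρ) ?_ hM
    exact Real.sqrt_le_iff.mpr ⟨by linarith, by nlinarith⟩
  · intro ξ
    rw [kernelFT_conv (integrable_heat (Real.sqrt_pos.mpr hρ)) (integrable_of_weightedNorm hf hfw),
      kernelFT_heat (Real.sqrt_pos.mpr hρ), Real.sq_sqrt hρ.le]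

/-- A mean value inequality in which the intermediate exponential is bounded by the sum of the two
end values, so that no intermediate point remains. -/
theorem abs_exp_neg_sub_le {p q : ℝ} :
    |Real.exp (-p) - Real.exp (-q)| ≤ |p - q| * (Real.exp (-p) + Real.exp (-q)) := by
  wlog h : p ≤ q generalizing p q
  · rw [abs_sub_comm, abs_sub_comm p q, add_comm]
    exact this (not_le.mp h).le
  have h1 : Real.exp (-q) ≤ Real.exp (-p) := Real.exp_le_exp.mpr (by linarith)
  rw [abs_of_nonneg (by linarith), abs_of_nonpos (by linarith)]
  have h2 : Real.exp (-q) = Real.exp (-p) * Real.exp (p - q) := by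
    rw [← Real.exp_add]; congr 1; ring
  have h3 := Real.add_one_le_exp (p - q)
  have h4 := Real.exp_pos (-p)
  have h5 := Real.exp_pos (-q)
  nlinarith [mul_nonneg (by linarith : 0 ≤ q - p) h5.le, mul_nonneg h4.le (by linarith : 0 ≤ Real.exp (p - q) - (p - q + 1))]

/-- A Lipschitz bound by weighted Gaussians at the two end points only; both have the same integral
by translation invariance. -/
theorem enorm_gauss_sub_le (z h : Space d) :
    ‖gauss (z - h) - gauss z‖ₑ ≤ ENNReal.ofReal (‖h‖ * (2 + ‖h‖)) *
      (‖gauss (z - h)‖ₑ * ENNReal.ofReal (1 + ‖z - h‖) + ‖gauss z‖ₑ * ENNReal.ofReal (1 + ‖z‖)) := by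
  have hreal : ‖gauss (z - h) - gauss z‖ ≤ (‖h‖ * (2 + ‖h‖)) *
      (‖gauss (z - h)‖ * (1 + ‖z - h‖) + ‖gauss z‖ * (1 + ‖z‖)) := by
    rw [norm_gauss_eq, norm_gauss_eq, gauss, gauss, ← Complex.ofReal_sub, Complex.norm_real,
      Real.norm_eq_abs, ← mul_sub, abs_mul]
    set c := (4 * Real.pi) ^ (-(d : ℝ) / 2)
    have hc : 0 ≤ c := by positivity
    rw [abs_of_nonneg hc]
    have h1 := abs_exp_neg_sub_le (p := ‖z - h‖ ^ 2 / 4) (q := ‖z‖ ^ 2 / 4)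
    set E1 := Real.exp (-(‖z - h‖ ^ 2 / 4))
    set E2 := Real.exp (-(‖z‖ ^ 2 / 4))
    have hE1 : 0 ≤ E1 := (Real.exp_pos _).le
    have hE2 : 0 ≤ E2 := (Real.exp_pos _).le
    have t1 : ‖z - h‖ ≤ ‖z‖ + ‖h‖ := norm_sub_le z h
    have t2 : ‖z‖ ≤ ‖z - h‖ + ‖h‖ := by simpa using norm_add_le (z - h) h
    have n1 := norm_nonneg (z - h)
    have n2 := norm_nonneg z
    have n3 := norm_nonneg h
    have h2 : |‖z - h‖ ^ 2 / 4 - ‖z‖ ^ 2 / 4| ≤ ‖h‖ * (‖z - h‖ + ‖z‖) := by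
      rw [abs_le]
      constructor <;> nlinarith
    have h3 : (‖z - h‖ + ‖z‖) * (E1 + E2) ≤
        (2 + ‖h‖) * (E1 * (1 + ‖z - h‖) + E2 * (1 + ‖z‖)) := by
      have a1 : (‖z - h‖ + ‖z‖) * E1 ≤ ((2 + ‖h‖) * (1 + ‖z - h‖)) * E1 :=
        mul_le_mul_of_nonneg_right (by nlinarith) hE1
      have a2 : (‖z - h‖ + ‖z‖) * E2 ≤ ((2 + ‖h‖) * (1 + ‖z‖)) * E2 :=
        mul_le_mul_of_nonneg_right (by nlinarith) hE2
      linarith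
    calc c * |E1 - E2| ≤ c * (‖h‖ * (‖z - h‖ + ‖z‖) * (E1 + E2)) := by
          refine mul_le_mul_of_nonneg_left (h1.trans ?_) hc
          exact mul_le_mul_of_nonneg_right h2 (by linarith)
      _ = c * ‖h‖ * ((‖z - h‖ + ‖z‖) * (E1 + E2)) := by ring
      _ ≤ c * ‖h‖ * ((2 + ‖h‖) * (E1 * (1 + ‖z - h‖) + E2 * (1 + ‖z‖))) :=
          mul_le_mul_of_nonneg_left h3 (by positivity)
      _ = _ := by ring
  have := ENNReal.ofReal_le_ofReal hreal
  rw [ENNReal.ofReal_mul (by positivity), ENNReal.ofReal_add (by positivity) (by positivity),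
    ENNReal.ofReal_mul (norm_nonneg (gauss (z - h))),
    ENNReal.ofReal_mul (norm_nonneg (gauss z))] at this
  simpa only [ofReal_norm] using this

theorem lintegral_enorm_gauss_sub_le (h : Space d) :
    ∫⁻ z, ‖gauss (z - h) - gauss z‖ₑ ≤
      ENNReal.ofReal (‖h‖ * (2 + ‖h‖)) * (2 * weightedNorm (gauss : Space d → ℂ)) := by
  have hg := measurable_gauss (d := d)
  refine (lintegral_mono fun z => enorm_gauss_sub_le z h).trans_eq ?_
  rw [lintegral_const_mul _ (by fun_prop), lintegral_add_left (by fun_prop),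
    lintegral_sub_right_eq_self (fun z => ‖gauss z‖ₑ * ENNReal.ofReal (1 + ‖z‖)) h, two_mul,
    weightedNorm]

/-- The heat flow contracts mean-zero kernels. -/
theorem exists_contracting_kernel {f : Space d → ℂ} (hf : Measurable f) (hfi : Integrable f)
    (hf0 : ∫ y, f y = 0)
    (hfw : ∫⁻ y, ‖f y‖ₑ * ENNReal.ofReal (‖y‖ * (2 + ‖y‖)) ≠ ⊤) {δ : ℝ} (hδ : 0 < δ) :
    ∃ N : ℝ, 1 ≤ N ∧ ∃ A : Space d → ℂ, Measurable A ∧ Integrable A ∧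
      ∫⁻ y, ‖A y‖ₑ ≤ ENNReal.ofReal δ ∧
      ∀ ξ, kernelFT A ξ = ((Real.exp (-(N * ‖ξ‖ ^ 2)) : ℝ) : ℂ) * kernelFT f ξ := by
  have hg := measurable_gauss (d := d)
  set V : ℝ≥0∞ := (∫⁻ y, ‖f y‖ₑ * ENNReal.ofReal (‖y‖ * (2 + ‖y‖))) *
    (2 * weightedNorm (gauss : Space d → ℂ)) with hV
  have hVfin : V ≠ ⊤ :=
    ENNReal.mul_ne_top hfw (ENNReal.mul_ne_top (by simp) weightedNorm_gauss_ne_top)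
  -- Diffusing `f` for time `σ²` amounts, after rescaling, to diffusing the concentrated kernel `dil
  -- σ f` for unit time. As its mean vanishes, the result has L¹ norm at most `V / σ ≤ δ`. The bound
  -- `1 ≤ σ` keeps the quadratic part of the weight under control.
  set σ : ℝ := max 1 (V.toReal / δ) with hσ
  have hσ1 : 1 ≤ σ := le_max_left _ _
  have hσ0 : 0 < σ := by linarith
  set D := dil σ f with hD
  have hDm : Measurable D := measurable_dil σ hf
  have hDi : Integrable D := by
    refine ⟨hDm.aestronglyMeasurable, ?_⟩
    rw [HasFiniteIntegral, lintegral_enorm_dil hσ0 hf]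
    exact hfi.2
  have hzero : ∀ k : Space d → ℂ, kernelFT k 0 = ∫ y, k y := fun k => by simp [kernelFT]
  have hD0 : ∫ y, D y = 0 := by
    rw [← hzero, hD, kernelFT_dil hσ0, smul_zero, hzero, hf0]
  have hAle : ∫⁻ x, ‖conv D gauss x‖ₑ ≤ ENNReal.ofReal δ := by
    have h1 : ∀ x, ‖conv D gauss x‖ₑ ≤ ∫⁻ y, ‖D y‖ₑ * ‖gauss (x - y) - gauss x‖ₑ := by
      intro x
      have h2 : Integrable fun y => D y * gauss (x - y) := by
        refine hDi.mul_bdd (c := (4 * Real.pi) ^ (-(d : ℝ) / 2))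
          (hg.comp (measurable_const.sub measurable_id)).aestronglyMeasurable
          (ae_of_all _ fun y => ?_)
        rw [norm_gauss_eq]
        refine mul_le_of_le_one_right (by positivity) (Real.exp_le_one_iff.mpr ?_)
        rw [neg_nonpos]
        positivity
      have h3 : conv D gauss x = ∫ y, D y * (gauss (x - y) - gauss x) := by
        simp only [mul_sub]
        rw [integral_sub h2 (hDi.mul_const _), integral_mul_const, hD0, zero_mul, sub_zero, conv]
      rw [h3]
      refine (enorm_integral_le_lintegral_enorm _).trans_eq (lintegral_congr fun y => ?_)
      rw [enorm_mul]
    refine (lintegral_mono h1).trans ?_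
    rw [lintegral_lintegral_swap (by fun_prop)]
    have h4 : ∀ y, ∫⁻ x, ‖D y‖ₑ * ‖gauss (x - y) - gauss x‖ₑ ≤
        ‖D y‖ₑ * ENNReal.ofReal (‖y‖ * (2 + ‖y‖)) * (2 * weightedNorm (gauss : Space d → ℂ)) := by
      intro y
      rw [lintegral_const_mul _ (by fun_prop), mul_assoc]
      gcongr
      exact lintegral_enorm_gauss_sub_le y
    refine (lintegral_mono h4).trans ?_
    rw [lintegral_mul_const _ (by fun_prop), hD, lintegral_dil hσ0 hf (by fun_prop)]
    have h5 : ∫⁻ y, ‖f y‖ₑ * ENNReal.ofReal (‖σ⁻¹ • y‖ * (2 + ‖σ⁻¹ • y‖)) ≤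
        ENNReal.ofReal σ⁻¹ * ∫⁻ y, ‖f y‖ₑ * ENNReal.ofReal (‖y‖ * (2 + ‖y‖)) := by
      rw [← lintegral_const_mul _ (by fun_prop)]
      refine lintegral_mono fun y => ?_
      rw [mul_left_comm, ← ENNReal.ofReal_mul (by positivity)]
      refine mul_le_mul_right (ENNReal.ofReal_le_ofReal ?_) _
      rw [norm_smul, Real.norm_of_nonneg (by positivity), mul_assoc]
      have h6 : σ⁻¹ * ‖y‖ ≤ ‖y‖ :=
        mul_le_of_le_one_left (norm_nonneg _) (inv_le_one_of_one_le₀ hσ1)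
      have h7 : 0 ≤ σ⁻¹ := by positivity
      refine mul_le_mul_of_nonneg_left ?_ h7
      exact mul_le_mul_of_nonneg_left (by linarith) (norm_nonneg _)
    refine (mul_le_mul_left h5 _).trans ?_
    rw [mul_assoc, ← hV, ← ENNReal.ofReal_toReal hVfin, ← ENNReal.ofReal_mul (by positivity)]
    refine ENNReal.ofReal_le_ofReal ?_
    rw [inv_mul_le_iff₀ hσ0]
    exact (div_le_iff₀ hδ).mp (le_max_right _ _)
  refine ⟨σ ^ 2, by nlinarith, dil σ⁻¹ (conv D gauss), measurable_dil _ (measurable_conv hDm hg),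
    ⟨(measurable_dil _ (measurable_conv hDm hg)).aestronglyMeasurable, ?_⟩, ?_, ?_⟩
  · rw [HasFiniteIntegral, lintegral_enorm_dil (inv_pos.mpr hσ0) (measurable_conv hDm hg)]
    exact hAle.trans_lt ENNReal.ofReal_lt_top
  · rw [lintegral_enorm_dil (inv_pos.mpr hσ0) (measurable_conv hDm hg)]
    exact hAle
  · intro ξ
    rw [kernelFT_dil (inv_pos.mpr hσ0), inv_inv, kernelFT_conv hDi integrable_gauss, kernelFT_gauss,
      hD, kernelFT_dil hσ0, inv_smul_smul₀ hσ0.ne', norm_smul, Real.norm_of_nonneg hσ0.le, mul_pow,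
      mul_comm]

end Kernels

/-! ### Kernels of the Littlewood–Paley family, uniformly in the frequency index. -/

section LittlewoodPaley

open scoped Topology ComplexConjugate

variable {d : ℕ} {Φ : ℤ → 𝓢(Space d, ℂ)}

theorem finite_waveVector_le {L : ℝ} (hL : 0 < L) (R : ℝ) :
    {m : Fin d → ℤ | ‖waveVector L m‖ ≤ R}.Finite := by
  set B : ℤ := ⌈R * L / (2 * Real.pi)⌉
  refine (Set.finite_Icc (fun _ => -B : Fin d → ℤ) (fun _ => B)).subset fun m hm => ?_
  have h : ∀ i, |m i| ≤ B := by
    intro i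
    have h1 : ‖waveVector L m i‖ ≤ R := (PiLp.norm_apply_le _ i).trans hm
    have h2 : waveVector L m i = 2 * Real.pi / L * (m i : ℝ) := rfl
    have h3 : (0 : ℝ) < 2 * Real.pi / L := by positivity
    rw [h2, norm_mul, Real.norm_of_nonneg h3.le, Real.norm_eq_abs] at h1
    have h4 : |(m i : ℝ)| ≤ R * L / (2 * Real.pi) := by
      rw [le_div_iff₀ (by positivity)]
      rw [div_mul_eq_mul_div, div_le_iff₀ hL] at h1
      linarith
    have h5 := h4.trans (Int.le_ceil _)
    exact_mod_cast h5
  exact ⟨fun i => (abs_le.mp (h i)).1, fun i => (abs_le.mp (h i)).2⟩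

theorem fourier_constant_pos : (0 : ℝ) < (2 * Real.pi) ^ (-(d : ℝ) / 2) := by positivity

theorem fourierTransform_ne_zero_iff (f : Space d → ℂ) (ξ : Space d) :
    fourierTransform f ξ ≠ 0 ↔ kernelFT f ξ ≠ 0 := by
  rw [fourierTransform_eq]
  have : (((2 * Real.pi) ^ (-(d : ℝ) / 2) : ℝ) : ℂ) ≠ 0 := by
    exact_mod_cast (fourier_constant_pos (d := d)).ne'
  simp [this]

/-- Equality of transforms is enough: for band-limited kernels, convolution with a periodic function
depends, up to null sets, only on the transform at the lattice wave numbers. -/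
theorem IsLittlewoodPaleyFamily.kernelFT_scaling (hΦ : IsLittlewoodPaleyFamily Φ) (l : ℤ)
    (ξ : Space d) : kernelFT (Φ l) ξ = kernelFT (dil ((2 : ℝ) ^ l) (Φ 0)) ξ := by
  have h := hΦ.scaling l ξ
  rw [fourierTransform_eq, fourierTransform_eq] at h
  rw [kernelFT_dil (by positivity), ← zpow_neg]
  refine mul_left_cancel₀ ?_ h
  exact_mod_cast (fourier_constant_pos (d := d)).ne'

theorem IsLittlewoodPaleyFamily.norm_le (hΦ : IsLittlewoodPaleyFamily Φ) (l : ℤ) {ξ : Space d}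
    (h : kernelFT (Φ l) ξ ≠ 0) : ((2 : ℝ) ^ (-l)) * ‖ξ‖ ∈ Ioo ((2 : ℝ)⁻¹) 2 := by
  rw [← fourierTransform_ne_zero_iff, hΦ.scaling] at h
  have := hΦ.support _ h
  rwa [norm_smul, Real.norm_of_nonneg (by positivity)] at this

/-- A bounded frequency band meets the lattice in finitely many points, so projections of periodic
functions are trigonometric polynomials. -/
theorem IsLittlewoodPaleyFamily.exists_finset (hΦ : IsLittlewoodPaleyFamily Φ) {L : ℝ}
    (hL : 0 < L) (l : ℤ) :
    ∃ S : Finset (Fin d → ℤ), ∀ m, m ∉ S → kernelFT (Φ l) (waveVector L m) = 0 := by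
  refine ⟨(finite_waveVector_le hL (2 * 2 ^ l)).toFinset, fun m hm => ?_⟩
  by_contra h
  apply hm
  rw [Set.Finite.mem_toFinset]
  have h1 := (hΦ.norm_le l h).2.le
  rw [zpow_neg, inv_mul_le_iff₀ (by positivity), mul_comm] at h1
  exact h1

/-- The quadratic weight dominates both `1 + |y|` and `|y| (2 + |y|)`, the two weights used for
kernels. -/
theorem lintegral_schwartz_ne_top (f : 𝓢(Space d, ℂ)) :
    ∫⁻ y, ‖f y‖ₑ * ENNReal.ofReal ((1 + ‖y‖) ^ 2) ≠ ⊤ := by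
  have h0 := f.integrable_pow_mul volume 0
  have h1 := f.integrable_pow_mul volume 1
  have h2 := f.integrable_pow_mul volume 2
  have h := (h0.add (h1.const_mul 2)).add h2
  refine ne_top_of_le_ne_top h.2.ne (lintegral_mono fun y => ?_)
  rw [← ofReal_norm, ← ofReal_norm, ← ENNReal.ofReal_mul (norm_nonneg _)]
  refine ENNReal.ofReal_le_ofReal (le_trans (le_of_eq ?_) (le_abs_self _))
  simp only [Pi.add_apply, pow_zero, pow_one]
  ring

theorem weightedNorm_schwartz_ne_top (f : 𝓢(Space d, ℂ)) : weightedNorm (f : Space d → ℂ) ≠ ⊤ := by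
  refine ne_top_of_le_ne_top (lintegral_schwartz_ne_top f) (lintegral_mono fun y => ?_)
  refine mul_le_mul_right (ENNReal.ofReal_le_ofReal ?_) _
  nlinarith [norm_nonneg y]

theorem measurable_schwartz (f : 𝓢(Space d, ℂ)) : Measurable (f : Space d → ℂ) :=
  f.continuous.measurable

/-- Scaling produces `lam ^ (-s)`, and `|y|^s ≤ 1 + |y|` makes the constant independent of `s`. -/
theorem lintegral_dil_rpow_le {lam s : ℝ} (hl : 0 < lam) (hs : s ∈ Icc (0 : ℝ) 1) {k : Space d → ℂ}
    (hk : Measurable k) :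
    ∫⁻ y, ‖dil lam k y‖ₑ * ENNReal.ofReal (2 * ‖y‖ ^ s) ≤
      2 * weightedNorm k * ENNReal.ofReal (lam ^ (-s)) := by
  have hs0 := hs.1
  rw [lintegral_dil hl hk (by fun_prop), weightedNorm, ← lintegral_const_mul _ (by fun_prop),
    ← lintegral_mul_const _ (by fun_prop)]
  refine lintegral_mono fun y => ?_
  have h1 : 2 * ‖lam⁻¹ • y‖ ^ s ≤ 2 * (1 + ‖y‖) * lam ^ (-s) := by
    rw [norm_smul, Real.norm_of_nonneg (by positivity), Real.mul_rpow (by positivity) (norm_nonneg _),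
      Real.inv_rpow hl.le, ← Real.rpow_neg hl.le]
    have h2 : ‖y‖ ^ s ≤ 1 + ‖y‖ := by
      rcases le_total ‖y‖ 1 with h | h
      · have := Real.rpow_le_one (norm_nonneg y) h hs0
        linarith [norm_nonneg y]
      · have := Real.rpow_le_rpow_of_exponent_le h hs.2
        rw [Real.rpow_one] at this
        linarith
    have h3 : 0 ≤ lam ^ (-s) := by positivity
    nlinarith
  calc ‖k y‖ₑ * ENNReal.ofReal (2 * ‖lam⁻¹ • y‖ ^ s)
      ≤ ‖k y‖ₑ * ENNReal.ofReal (2 * (1 + ‖y‖) * lam ^ (-s)) := by gcongr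
    _ = _ := by
      rw [ENNReal.ofReal_mul (by positivity), ENNReal.ofReal_mul (by norm_num), ENNReal.ofReal_ofNat]
      ring

theorem IsLittlewoodPaleyFamily.kernelFT_zero (hΦ : IsLittlewoodPaleyFamily Φ) (l : ℤ) :
    kernelFT (Φ l) 0 = 0 := by
  by_contra h
  have := (hΦ.norm_le l h).1
  rw [norm_zero, mul_zero] at this
  norm_num at this

theorem IsLittlewoodPaleyFamily.integral_eq_zero (hΦ : IsLittlewoodPaleyFamily Φ) (l : ℤ) :
    ∫ y, dil ((2 : ℝ) ^ l) (Φ 0) y = 0 := by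
  rw [← hΦ.kernelFT_zero l, hΦ.kernelFT_scaling, kernelFT]
  simp

theorem integrable_dil {lam : ℝ} (hl : 0 < lam) {k : Space d → ℂ} (hk : Measurable k)
    (hki : Integrable k) : Integrable (dil lam k) := by
  refine ⟨(measurable_dil lam hk).aestronglyMeasurable, ?_⟩
  rw [HasFiniteIntegral, lintegral_enorm_dil hl hk]
  exact hki.2

/-- The kernels of the Littlewood--Paley projections, propagated by the heat flow. -/
theorem IsLittlewoodPaleyFamily.exists_heat_kernel (hΦ : IsLittlewoodPaleyFamily Φ) {N : ℝ}
    (hN : 1 ≤ N) :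
    ∃ C : ℝ≥0, ∀ (l : ℤ) (ρ : ℝ), 0 < ρ → ρ * ((2 : ℝ) ^ l) ^ 2 ≤ N →
      ∃ k : Space d → ℂ, Measurable k ∧ Integrable k ∧
        (∀ ξ, kernelFT k ξ = ((Real.exp (-(ρ * ‖ξ‖ ^ 2)) : ℝ) : ℂ) * kernelFT (Φ l) ξ) ∧
        ∀ s ∈ Icc (0 : ℝ) 1, ∫⁻ y, ‖k y‖ₑ * ENNReal.ofReal (2 * ‖y‖ ^ s) ≤
          C * ENNReal.ofReal (((2 : ℝ) ^ l) ^ (-s)) := by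
  obtain ⟨C, hC⟩ := PassiveScalar.exists_heat_kernel (measurable_schwartz (Φ 0))
    (weightedNorm_schwartz_ne_top _) N hN
  refine ⟨2 * C, fun l ρ hρ hρN => ?_⟩
  have hl : (0 : ℝ) < 2 ^ l := by positivity
  -- In units of the scale `2^{-l}` the heat time is `ρ 4^l ≤ N`, so one bound for `Φ 0` serves all
  -- `l`.
  obtain ⟨K, hKm, hKw, hKF⟩ := hC (ρ * ((2 : ℝ) ^ l) ^ 2) (by positivity) hρN
  refine ⟨dil (2 ^ l) K, measurable_dil _ hKm, integrable_dil hl hKm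
    (integrable_of_weightedNorm hKm (ne_top_of_le_ne_top ENNReal.coe_ne_top hKw)), ?_, ?_⟩
  · intro ξ
    rw [hΦ.kernelFT_scaling, kernelFT_dil hl, kernelFT_dil hl, hKF, norm_smul, norm_inv,
      Real.norm_of_nonneg hl.le]
    congr 4
    field_simp
  · intro s hs
    refine (lintegral_dil_rpow_le hl hs hKm).trans ?_
    push_cast
    gcongr

/-- The heat flow over a long time contracts functions with the frequency support of the
Littlewood--Paley projections. -/
theorem IsLittlewoodPaleyFamily.exists_contracting_kernel (hΦ : IsLittlewoodPaleyFamily Φ) {δ : ℝ}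
    (hδ : 0 < δ) :
    ∃ N : ℝ, 1 ≤ N ∧ ∀ l : ℤ, ∃ A : Space d → ℂ, Measurable A ∧ Integrable A ∧
      ∫⁻ y, ‖A y‖ₑ ≤ ENNReal.ofReal δ ∧
      ∀ ξ, kernelFT A ξ * kernelFT (Φ l) ξ =
        ((Real.exp (-(N / ((2 : ℝ) ^ l) ^ 2 * ‖ξ‖ ^ 2)) : ℝ) : ℂ) * kernelFT (Φ l) ξ := by
  set c : ℂ := (((2 * Real.pi) ^ (-(d : ℝ) / 2) : ℝ) : ℂ) with hc
  -- A fattened projection with zero mean whose `kernelFT` is 1 on the frequency band of `Φ 0`; `c`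
  -- converts `kernelFT` into the normalized transform. Contracting `ψ` therefore represents the
  -- heat flow on the band.
  set ψ : 𝓢(Space d, ℂ) := c • (Φ (-1) + Φ 0 + Φ 1) with hψ
  have hψF : ∀ ξ, kernelFT ψ ξ =
      fourierTransform (Φ (-1)) ξ + fourierTransform (Φ 0) ξ + fourierTransform (Φ 1) ξ := by
    intro ξ
    simp only [fourierTransform_eq, ← mul_add, ← hc, kernelFT]
    have h1 := integrable_mul_exp (Φ (-1)).integrable ξ
    have h2 := integrable_mul_exp (Φ 0).integrable ξ
    have h3 := integrable_mul_exp (Φ 1).integrable ξ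
    have h12 := integral_add h1 h2
    have h123 := integral_add (h1.add h2) h3
    simp only [Pi.add_apply] at h123
    rw [← h12, ← h123, ← integral_const_mul]
    congr 1
    ext y
    simp only [hψ, _root_.smul_apply, _root_.add_apply, smul_eq_mul]
    ring
  have hψ0 : ∫ y, ψ y = 0 := by
    have h : kernelFT ψ 0 = ∫ y, ψ y := by simp [kernelFT]
    rw [← h, hψF]
    simp [fourierTransform_eq, hΦ.kernelFT_zero]
  have hψw : ∫⁻ y, ‖ψ y‖ₑ * ENNReal.ofReal (‖y‖ * (2 + ‖y‖)) ≠ ⊤ := by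
    refine ne_top_of_le_ne_top (lintegral_schwartz_ne_top ψ) (lintegral_mono fun y => ?_)
    refine mul_le_mul_right (ENNReal.ofReal_le_ofReal ?_) _
    nlinarith [norm_nonneg y]
  obtain ⟨N, hN, A, hAm, hAi, hAle, hAF⟩ := PassiveScalar.exists_contracting_kernel
    (measurable_schwartz ψ) ψ.integrable hψ0 hψw hδ
  refine ⟨N, hN, fun l => ?_⟩
  have hl : (0 : ℝ) < 2 ^ l := by positivity
  refine ⟨dil (2 ^ l) A, measurable_dil _ hAm, integrable_dil hl hAm hAi,
    (lintegral_enorm_dil hl hAm).trans_le hAle, fun ξ => ?_⟩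
  by_cases h0 : kernelFT (Φ l) ξ = 0
  · rw [h0, mul_zero, mul_zero]
  congr 1
  have hband := hΦ.norm_le l h0
  have hone : kernelFT ψ (((2 : ℝ) ^ l)⁻¹ • ξ) = 1 := by
    set η := ((2 : ℝ) ^ l)⁻¹ • ξ with hη
    have hηn : ‖η‖ ∈ Ioo ((2 : ℝ)⁻¹) 2 := by
      rw [hη, norm_smul, norm_inv, Real.norm_of_nonneg hl.le, ← zpow_neg]
      exact hband
    have hη0 : η ≠ 0 := by
      intro h
      rw [h, norm_zero] at hηn
      linarith [hηn.1, (by norm_num : (0 : ℝ) < 2⁻¹)]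
    have hsum := hΦ.partition η hη0
    -- If `1/2 < |η| < 2`, a nonzero term requires `1/4 < 2^{-j} < 4`, so only `j = -1, 0, 1`
    -- contribute to the partition of unity.
    have hsum2 : HasSum (fun l : ℤ => fourierTransform (Φ l) η)
        (∑ l ∈ ({-1, 0, 1} : Finset ℤ), fourierTransform (Φ l) η) := by
      refine hasSum_sum_of_ne_finset_zero fun j hj => ?_
      by_contra hne
      rw [← ne_eq, fourierTransform_ne_zero_iff] at hne
      have hb := hΦ.norm_le j hne
      have hlow : (2 : ℝ) ^ (-j) < 2 ^ (2 : ℤ) := by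
        have : (2 : ℝ) ^ (-j) * 2⁻¹ < 2 :=
          lt_of_le_of_lt (mul_le_mul_of_nonneg_left hηn.1.le (by positivity)) hb.2
        have e : (2 : ℝ) ^ (2 : ℤ) = 4 := by norm_num
        rw [e]
        linarith
      have hhigh : (2 : ℝ) ^ (-2 : ℤ) < 2 ^ (-j) := by
        have : (2 : ℝ)⁻¹ < (2 : ℝ) ^ (-j) * 2 :=
          lt_of_lt_of_le hb.1 (mul_le_mul_of_nonneg_left hηn.2.le (by positivity))
        have e : (2 : ℝ) ^ (-2 : ℤ) = 1 / 4 := by norm_num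
        rw [e]
        linarith
      have h1 := (zpow_lt_zpow_iff_right₀ (by norm_num : (1 : ℝ) < 2)).mp hlow
      have h2 := (zpow_lt_zpow_iff_right₀ (by norm_num : (1 : ℝ) < 2)).mp hhigh
      apply hj
      simp only [Finset.mem_insert, Finset.mem_singleton]
      omega
    rw [hψF, hsum.unique hsum2]
    simp [add_assoc]
  rw [kernelFT_dil hl, hAF, hone, mul_one, norm_smul, norm_inv, Real.norm_of_nonneg hl.le]
  congr 3
  field_simp

end LittlewoodPaley

/-! ### Weak derivatives and primitives on the half line. -/

section RealLine

open scoped Topology ComplexConjugate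

theorem exists_Icc_of_isCompact {K : Set ℝ} (hK : IsCompact K) (h0 : K ⊆ Ioi 0) :
    ∃ a b : ℝ, 0 < a ∧ a ≤ b ∧ K ⊆ Icc a b := by
  have hK' : IsCompact (K ∪ {1}) := hK.union isCompact_singleton
  have hne : (K ∪ {1}).Nonempty := ⟨1, by simp⟩
  have hmem := hK'.sInf_mem hne
  refine ⟨sInf (K ∪ {1}), sSup (K ∪ {1}), ?_, ?_, fun x hx => ?_⟩
  · rcases hmem with h | h
    · exact h0 h
    · rw [mem_singleton_iff] at h; rw [h]; norm_num
  · exact csInf_le_csSup hne hK'.bddBelow hK'.bddAbove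
  · exact ⟨csInf_le hK'.bddBelow (Or.inl hx), le_csSup hK'.bddAbove (Or.inl hx)⟩

theorem setIntegral_Ioi_eq_intervalIntegral {f : ℝ → ℝ} {b : ℝ} (hb : 0 ≤ b)
    (h : ∀ t, b < t → f t = 0) : ∫ t in Ioi (0 : ℝ), f t = ∫ t in (0 : ℝ)..b, f t := by
  rw [intervalIntegral.integral_of_le hb]
  refine setIntegral_eq_of_subset_of_forall_sdiff_eq_zero measurableSet_Ioi Ioc_subset_Ioi_self ?_
  intro t ht
  refine h t ?_
  by_contra hn
  exact ht.2 ⟨ht.1, not_lt.mp hn⟩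

theorem intervalIntegrable_of_integrableOn {f : ℝ → ℝ} (hf : ∀ T, IntegrableOn f (Ioc 0 T)) (T : ℝ)
    (hT : 0 ≤ T) : IntervalIntegrable f volume 0 T :=
  (intervalIntegrable_iff_integrableOn_Ioc_of_le hT).mpr (hf T)

theorem integral_primitive_mul_deriv {Q : ℝ → ℝ} (hQ : ∀ T, IntegrableOn Q (Ioc 0 T))
    {χ : ℝ → ℝ} (hχ : ContDiff ℝ ∞ χ) {T : ℝ} (hT : 0 ≤ T) (h0 : χ 0 = 0) (hT0 : χ T = 0) :
    ∫ t in (0 : ℝ)..T, (∫ r in (0 : ℝ)..t, Q r) * deriv χ t = -∫ t in (0 : ℝ)..T, Q t * χ t := by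
  have hi := intervalIntegrable_of_integrableOn hQ T hT
  have hac := hi.absolutelyContinuousOnInterval_intervalIntegral (c := 0) (by simp)
  have hχac : AbsolutelyContinuousOnInterval χ 0 T :=
    (hχ.contDiffOn.of_le (by exact_mod_cast le_top)).absolutelyContinuousOnInterval
  rw [hac.integral_mul_deriv_eq_deriv_mul hχac, h0, hT0, mul_zero, mul_zero, sub_zero, zero_sub]
  congr 1
  refine intervalIntegral.integral_congr_ae ?_
  filter_upwards [hi.ae_hasDerivAt_integral] with t ht htm
  rw [(ht (uIoc_subset_uIcc htm) 0 (by simp)).deriv]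

theorem eq_zero_of_tsupport_subset_Icc {f : ℝ → ℝ} {a b t : ℝ} (h : tsupport f ⊆ Icc a b)
    (ht : t ∉ Icc a b) : f t = 0 :=
  image_eq_zero_of_notMem_tsupport fun hm => ht (h hm)

/-- A locally integrable function on the half line with vanishing weak derivative is constant. -/
theorem ae_eq_const_of_weak_deriv_eq_zero {R : ℝ → ℝ} (hR : ∀ T, IntegrableOn R (Ioc 0 T))
    (h : ∀ χ : ℝ → ℝ, ContDiff ℝ ∞ χ → HasCompactSupport χ → tsupport χ ⊆ Ioi 0 →
      ∫ t in Ioi (0 : ℝ), R t * deriv χ t = 0) :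
    ∃ c : ℝ, ∀ᵐ t ∂volume.restrict (Ioi (0 : ℝ)), R t = c := by
  let bump : ContDiffBump (2 : ℝ) := ⟨1 / 2, 1, by norm_num, by norm_num⟩
  set χ₀ : ℝ → ℝ := bump.normed volume with hχ₀
  have hχ₀d : ContDiff ℝ ∞ χ₀ := bump.contDiff_normed
  have hχ₀s : tsupport χ₀ = Icc 1 3 := by
    rw [hχ₀, bump.tsupport_normed_eq, Real.closedBall_eq_Icc]
    norm_num [bump]
  have hχ₀1 : ∫ t, χ₀ t = 1 := bump.integral_normed
  set c := ∫ t in Ioi (0 : ℝ), R t * χ₀ t with hc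
  refine ⟨c, ?_⟩
  have hloc : LocallyIntegrableOn (fun t => R t - c) (Ioi 0) := by
    rw [locallyIntegrableOn_iff isOpen_Ioi.isLocallyClosed]
    intro K hK hK2
    obtain ⟨a, b, ha, hab, hKab⟩ := exists_Icc_of_isCompact hK2 hK
    have : IntegrableOn (fun t => R t - c) (Ioc 0 b) :=
      (hR b).sub (integrableOn_const (by simp))
    exact this.mono_set fun t ht => ⟨ha.trans_le (hKab ht).1, (hKab ht).2⟩
  have key := isOpen_Ioi.ae_eq_zero_of_integral_contDiff_smul_eq_zero hloc ?_
  · rw [ae_restrict_iff' measurableSet_Ioi]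
    filter_upwards [key] with t ht ht0
    exact sub_eq_zero.mp (ht ht0)
  intro g hg hgc hgs
  obtain ⟨a, b, ha, hab, hKab⟩ := exists_Icc_of_isCompact (hgc.isCompact.union
    (isCompact_Icc (a := (1 : ℝ)) (b := 3))) (union_subset hgs fun t ht => by
      have := ht.1
      exact lt_of_lt_of_le one_pos this)
  have hgab : tsupport g ⊆ Icc a b := subset_union_left.trans hKab
  have hχab : tsupport χ₀ ⊆ Icc a b := by rw [hχ₀s]; exact subset_union_right.trans hKab
  set m := ∫ t, g t with hm
  -- Removing the mean of `g` with the fixed unit bump `χ₀` makes the primitive of `G` compactly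
  -- supported, hence an admissible `χ`. Testing with it gives `∫ R g = (∫ g) c`.
  set G : ℝ → ℝ := fun t => g t - m * χ₀ t with hG
  have hGd : ContDiff ℝ ∞ G := hg.sub (contDiff_const.mul hχ₀d)
  have hG0 : ∀ t, t ∉ Icc a b → G t = 0 := fun t ht => by
    rw [hG]; simp only
    rw [eq_zero_of_tsupport_subset_Icc hgab ht, eq_zero_of_tsupport_subset_Icc hχab ht, mul_zero,
      sub_zero]
  have hGi : Integrable G := by
    refine hGd.continuous.integrable_of_hasCompactSupport ?_
    exact HasCompactSupport.intro isCompact_Icc hG0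
  have hgi : Integrable g := hg.continuous.integrable_of_hasCompactSupport hgc
  have hχi : Integrable χ₀ :=
    hχ₀d.continuous.integrable_of_hasCompactSupport (HasCompactSupport.intro isCompact_Icc
      fun t ht => eq_zero_of_tsupport_subset_Icc hχab ht)
  have hGint : ∫ t, G t = 0 := by
    rw [hG, integral_sub hgi (hχi.const_mul _), integral_const_mul, hχ₀1, mul_one, sub_self]
  set χ : ℝ → ℝ := fun t => ∫ r in (0 : ℝ)..t, G r with hχ
  have hχ' : ∀ t, HasDerivAt χ (G t) t := fun t =>
    intervalIntegral.integral_hasDerivAt_right (hGd.continuous.intervalIntegrable _ _)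
      (hGd.continuous.stronglyMeasurableAtFilter _ _) hGd.continuous.continuousAt
  have hχd : ContDiff ℝ ∞ χ := by
    rw [contDiff_infty_iff_deriv]
    refine ⟨fun t => (hχ' t).differentiableAt, ?_⟩
    have : deriv χ = G := funext fun t => (hχ' t).deriv
    rw [this]
    exact hGd
  have hχ0 : ∀ t, t ∉ Icc a b → χ t = 0 := by
    intro t ht
    rcases lt_or_ge t a with h1 | h1
    · refine intervalIntegral.integral_zero_ae (ae_of_all _ fun r hr => hG0 r fun hr2 => ?_)
      rcases le_total 0 t with h2 | h2
      · rw [uIoc_of_le h2] at hr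
        linarith [hr.2, hr2.1]
      · rw [uIoc_of_ge h2] at hr
        linarith [hr.2, hr2.1]
    · have h2 : b < t := by
        by_contra h3
        exact ht ⟨h1, not_lt.mp h3⟩
      rw [← hGint, hχ]
      simp only
      rw [intervalIntegral.integral_of_le (by linarith)]
      refine setIntegral_eq_integral_of_forall_compl_eq_zero fun r hr => hG0 r fun hr2 => hr ?_
      exact ⟨by linarith [hr2.1], by linarith [hr2.2]⟩
  have hχc : HasCompactSupport χ := HasCompactSupport.intro isCompact_Icc hχ0
  have hχs : tsupport χ ⊆ Ioi 0 := by
    refine (closure_minimal (fun t ht => ?_) isClosed_Icc).trans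
      (fun t (ht : t ∈ Icc a b) => lt_of_lt_of_le ha ht.1)
    by_contra hn
    exact ht (hχ0 t hn)
  have hfin := h χ hχd hχc hχs
  have hRf : ∀ f : ℝ → ℝ, Continuous f → (∀ t, t ∉ Icc a b → f t = 0) →
      IntegrableOn (fun t => R t * f t) (Ioi 0) := by
    intro f hf hf0
    obtain ⟨M, hM⟩ := isCompact_Icc.exists_bound_of_continuousOn (s := Icc a b) hf.continuousOn
    have hM' : ∀ t, ‖f t‖ ≤ max M 0 := fun t => by
      by_cases ht : t ∈ Icc a b
      · exact (hM t ht).trans (le_max_left _ _)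
      · rw [hf0 t ht, norm_zero]; exact le_max_right _ _
    have h1 : IntegrableOn (fun t => R t * f t) (Ioc 0 b) :=
      (hR b).mul_bdd (c := max M 0) hf.aestronglyMeasurable (ae_of_all _ hM')
    refine h1.of_forall_sdiff_eq_zero measurableSet_Ioi fun t ht => ?_
    rw [hf0 t fun h2 => ht.2 ⟨ht.1, h2.2⟩, mul_zero]
  have hgint : ∫ t in Ioi (0 : ℝ), g t = m := by
    refine setIntegral_eq_integral_of_forall_compl_eq_zero fun t ht => ?_
    exact eq_zero_of_tsupport_subset_Icc hgab fun h2 => ht (lt_of_lt_of_le ha h2.1)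
  have hRg := hRf g hg.continuous fun t ht => eq_zero_of_tsupport_subset_Icc hgab ht
  have hRχ := hRf χ₀ hχ₀d.continuous fun t ht => eq_zero_of_tsupport_subset_Icc hχab ht
  have hderiv : ∫ t in Ioi (0 : ℝ), R t * deriv χ t =
      (∫ t in Ioi (0 : ℝ), R t * g t) - m * c := by
    rw [hc, ← integral_const_mul, ← integral_sub hRg (hRχ.const_mul _)]
    congr 1
    ext t
    rw [(hχ' t).deriv, hG]
    ring
  rw [hderiv] at hfin
  have h1 : ∫ t, g t • (R t - c) = ∫ t in Ioi (0 : ℝ), g t • (R t - c) := by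
    refine (setIntegral_eq_integral_of_forall_compl_eq_zero fun t ht => ?_).symm
    rw [eq_zero_of_tsupport_subset_Icc hgab fun h2 => ht (lt_of_lt_of_le ha h2.1), zero_smul]
  rw [h1]
  have h2 : ∫ t in Ioi (0 : ℝ), g t • (R t - c) =
      (∫ t in Ioi (0 : ℝ), R t * g t) - c * ∫ t in Ioi (0 : ℝ), g t := by
    rw [← integral_const_mul, ← integral_sub hRg (hgi.integrableOn.const_mul _)]
    congr 1
    ext t
    rw [smul_eq_mul]
    ring
  rw [h2, hgint]
  linarith

/-- A function with locally integrable weak derivative is a primitive. -/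
theorem ae_eq_primitive_of_weak_deriv {V Q : ℝ → ℝ} (hV : ∀ T, IntegrableOn V (Ioc 0 T))
    (hQ : ∀ T, IntegrableOn Q (Ioc 0 T))
    (h : ∀ χ : ℝ → ℝ, ContDiff ℝ ∞ χ → HasCompactSupport χ → tsupport χ ⊆ Ioi 0 →
      ∫ t in Ioi (0 : ℝ), (V t * deriv χ t + Q t * χ t) = 0) :
    ∃ c : ℝ, ∀ᵐ t ∂volume.restrict (Ioi (0 : ℝ)), V t = c + ∫ r in (0 : ℝ)..t, Q r := by
  set P : ℝ → ℝ := fun t => ∫ r in (0 : ℝ)..t, Q r with hP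
  have hPc : ∀ T, 0 ≤ T → ContinuousOn P (Icc 0 T) := fun T hT => by
    have := (intervalIntegrable_of_integrableOn hQ T hT).absolutelyContinuousOnInterval_intervalIntegral
      (c := 0) (by simp)
    simpa [uIcc_of_le hT] using this.continuousOn
  have hPi : ∀ T, IntegrableOn P (Ioc 0 T) := fun T => by
    rcases le_total 0 T with hT | hT
    · exact ((hPc T hT).integrableOn_Icc).mono_set Ioc_subset_Icc_self
    · rw [Ioc_eq_empty (not_lt.mpr hT)]; exact integrableOn_empty
  obtain ⟨c, hc⟩ := ae_eq_const_of_weak_deriv_eq_zero (R := fun t => V t - P t)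
    (fun T => (hV T).sub (hPi T)) (fun χ hχ hχc hχs => by
      obtain ⟨a, b, ha, hab, hKab⟩ := exists_Icc_of_isCompact hχc.isCompact hχs
      have hb : 0 ≤ b := by linarith
      have hχ0 : ∀ t, t ∉ Icc a b → χ t = 0 := fun t ht => eq_zero_of_tsupport_subset_Icc hKab ht
      have hχ'0 : ∀ t, t ∉ Icc a b → deriv χ t = 0 := fun t ht =>
        eq_zero_of_tsupport_subset_Icc ((tsupport_deriv_subset (f := χ)).trans hKab) ht
      have hχ'c : Continuous (deriv χ) := hχ.continuous_deriv (by simp)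
      have hbt : ∀ {t}, b + 1 < t → t ∉ Icc a b := fun ht h2 => by linarith [h2.2]
      have hip := integral_primitive_mul_deriv hQ hχ (T := b + 1) (by linarith)
        (hχ0 0 fun h2 => by linarith [h2.1]) (hχ0 (b + 1) fun h2 => by linarith [h2.2])
      have hw := h χ hχ hχc hχs
      rw [setIntegral_Ioi_eq_intervalIntegral (b := b + 1) (by linarith)
        (fun t ht => by rw [hχ0 t (hbt ht), hχ'0 t (hbt ht)]; ring)] at hw
      rw [setIntegral_Ioi_eq_intervalIntegral (b := b + 1) (by linarith)
        (fun t ht => by rw [hχ'0 t (hbt ht), mul_zero])]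
      have i1 := (intervalIntegrable_of_integrableOn hV (b + 1) (by linarith)).mul_continuousOn
        hχ'c.continuousOn
      have i2 := (intervalIntegrable_of_integrableOn hQ (b + 1) (by linarith)).mul_continuousOn
        hχ.continuous.continuousOn
      have i3 := (intervalIntegrable_of_integrableOn hPi (b + 1) (by linarith)).mul_continuousOn
        hχ'c.continuousOn
      rw [intervalIntegral.integral_add i1 i2] at hw
      simp only [sub_mul]
      rw [intervalIntegral.integral_sub i1 i3, hip]
      linarith)
  refine ⟨c, hc.mono fun t ht => ?_⟩
  linarith [ht]

/-- Chain rule for a smooth function of a primitive. -/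
theorem comp_primitive_sub_eq_integral {h : ℝ → ℝ} {T : ℝ} (hT : 0 ≤ T)
    (hi : IntervalIntegrable h volume 0 T) {B : ℝ → ℝ} (hB : ContDiff ℝ ∞ B)
    (hB1 : ∀ r, |deriv B r| ≤ 1) (w : ℝ) {a b : ℝ} (ha : 0 ≤ a) (hab : a ≤ b) (hb : b ≤ T) :
    B (w + ∫ r in (0 : ℝ)..b, h r) - B (w + ∫ r in (0 : ℝ)..a, h r) =
      ∫ t in a..b, deriv B (w + ∫ r in (0 : ℝ)..t, h r) * h t := by
  have hsub : uIcc a b ⊆ uIcc 0 T := by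
    rw [uIcc_of_le hab, uIcc_of_le hT]
    exact Icc_subset_Icc ha hb
  have hac : AbsolutelyContinuousOnInterval (fun t => ∫ r in (0 : ℝ)..t, h r) a b :=
    (hi.absolutelyContinuousOnInterval_intervalIntegral (c := 0) (by simp)).mono hsub
  -- A 1-Lipschitz function preserves absolute continuity under composition, so the fundamental
  -- theorem of calculus applies to `B` of the primitive.
  have hlip : ∀ x y, dist (B x) (B y) ≤ dist x y := by
    intro x y
    have := Convex.norm_image_sub_le_of_norm_deriv_le (𝕜 := ℝ) (f := B) (C := 1) (s := univ)
      (fun x _ => hB.differentiable (by simp) x) (fun x _ => hB1 x) convex_univ (mem_univ y)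
      (mem_univ x)
    rw [Real.dist_eq, Real.dist_eq]
    simpa using this
  have hac2 : AbsolutelyContinuousOnInterval (fun t => B (w + ∫ r in (0 : ℝ)..t, h r)) a b := by
    rw [absolutelyContinuousOnInterval_iff] at hac ⊢
    intro ε hε
    obtain ⟨δ, hδ, hδ2⟩ := hac ε hε
    refine ⟨δ, hδ, fun E hE hE2 => lt_of_le_of_lt (Finset.sum_le_sum fun i _ => ?_) (hδ2 E hE hE2)⟩
    refine (hlip _ _).trans_eq ?_
    simp
  rw [← hac2.integral_deriv_eq_sub]
  refine intervalIntegral.integral_congr_ae ?_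
  filter_upwards [hi.ae_hasDerivAt_integral] with t ht htm
  have h1 := (ht (hsub (uIoc_subset_uIcc htm)) 0 (by simp)).const_add w
  have h2 : HasDerivAt B (deriv B (w + ∫ r in (0 : ℝ)..t, h r)) (w + ∫ r in (0 : ℝ)..t, h r) :=
    (hB.differentiable (by simp) _).hasDerivAt
  exact (h2.comp t h1).deriv

end RealLine

/-! ### Time regularity of the Fourier modes of a weak solution. -/

section TimeRegularity

open scoped Topology ComplexConjugate

variable {d : ℕ} {L : ℝ}

/-- The properties of velocity and scalar that hold at almost every time. -/
structure RegularTime {d : ℕ} (L : ℝ) (u : Space d → Space d) (θ : Space d → ℝ)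
    (g : Space d → Space d) : Prop where
  velocity_sq : ∫⁻ x, ‖u x‖ₑ ^ 2 ∂cellMeasure d L ≠ ⊤
  scalar_sq : ∫⁻ x, ‖θ x‖ₑ ^ 2 ∂cellMeasure d L ≠ ⊤
  grad_sq : ∫⁻ x, ‖g x‖ₑ ^ 2 ∂cellMeasure d L ≠ ⊤
  divFree : WeakDivFree L u
  weakGradient : IsWeakGradient L θ g

theorem LocallySquareIntegrable.lintegral_ne_top {F : Type*} [NormedAddCommGroup F]
    [MeasurableSpace F] [BorelSpace F] {f : ℝ → Space d → F}
    (h : LocallySquareIntegrable L f) (hm : Measurable fun p : ℝ × Space d => f p.1 p.2) (T : ℝ) :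
    ∫⁻ t in Ioo 0 T, ∫⁻ x, ‖f t x‖ₑ ^ 2 ∂cellMeasure d L ≠ ⊤ := by
  have h1 := (h T).2
  rw [eLpNorm_lt_top_iff_lintegral_rpow_enorm_lt_top (by simp) (by simp)] at h1
  simp only [ENNReal.toReal_ofNat, ENNReal.rpow_ofNat] at h1
  rw [lintegral_prod _ (hm.enorm.pow_const 2).aemeasurable] at h1
  have h2 : ∀ t, ∫⁻ x, ‖f t x‖ₑ ^ 2 ∂cellMeasure d L =
      ENNReal.ofReal ((L ^ d)⁻¹) * ∫⁻ x in cell d L, ‖f t x‖ₑ ^ 2 := fun t => by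
    rw [← spaceAvg_eq_lintegral, spaceAvg]
  simp_rw [h2]
  rw [lintegral_const_mul' _ _ ENNReal.ofReal_ne_top]
  exact ENNReal.mul_ne_top ENNReal.ofReal_ne_top h1.ne

theorem ae_Ioi_of_forall_Ioo {p : ℝ → Prop} (h : ∀ T : ℝ, ∀ᵐ t ∂volume.restrict (Ioo 0 T), p t) :
    ∀ᵐ t ∂volume.restrict (Ioi (0 : ℝ)), p t := by
  have : Ioi (0 : ℝ) = ⋃ n : ℕ, Ioo (0 : ℝ) n := by
    ext t
    simp only [mem_Ioi, mem_iUnion, mem_Ioo]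
    constructor
    · intro ht
      obtain ⟨n, hn⟩ := exists_nat_gt t
      exact ⟨n, ht, hn⟩
    · rintro ⟨n, hn⟩
      exact hn.1
  rw [this, ae_restrict_iUnion_iff]
  exact fun n => h n

theorem measurable_lintegral_sq {F : Type*} [NormedAddCommGroup F]
    [MeasurableSpace F] [BorelSpace F] {f : ℝ → Space d → F}
    (hm : Measurable fun p : ℝ × Space d => f p.1 p.2) :
    Measurable fun t => ∫⁻ x, ‖f t x‖ₑ ^ 2 ∂cellMeasure d L :=
  Measurable.lintegral_prod_right' (f := fun p : ℝ × Space d => ‖f p.1 p.2‖ₑ ^ 2)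
    (hm.enorm.pow_const 2)

theorem LocallySquareIntegrable.ae_ne_top {F : Type*} [NormedAddCommGroup F]
    [MeasurableSpace F] [BorelSpace F] {f : ℝ → Space d → F}
    (h : LocallySquareIntegrable L f) (hm : Measurable fun p : ℝ × Space d => f p.1 p.2) :
    ∀ᵐ t ∂volume.restrict (Ioi (0 : ℝ)), ∫⁻ x, ‖f t x‖ₑ ^ 2 ∂cellMeasure d L ≠ ⊤ :=
  ae_Ioi_of_forall_Ioo fun T =>
    (ae_lt_top (measurable_lintegral_sq hm) (h.lintegral_ne_top hm T)).mono fun _ ht => ht.ne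

variable {κ : ℝ} {u : ℝ → Space d → Space d} {θ₀ : Space d → ℝ} {θ : ℝ → Space d → ℝ}
  {Dθ : ℝ → Space d → Space d}

theorem IsWeakSolution.ae_regularTime (hu : IsVelocityField L u)
    (h : IsWeakSolution L κ u θ₀ θ Dθ) :
    ∀ᵐ t ∂volume.restrict (Ioi (0 : ℝ)), RegularTime L (u t) (θ t) (Dθ t) := by
  filter_upwards [hu.sqIntegrable.ae_ne_top hu.measurable, h.sqIntegrable.ae_ne_top h.measurable,
    h.grad_sqIntegrable.ae_ne_top h.grad_measurable, hu.divFree, h.weakGradient]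
    with t h1 h2 h3 h4 h5
  exact ⟨h1, h2, h3, h4, h5⟩

/-- The Fourier coefficients of a scalar at time `t`. -/
def timeCoeff {d : ℕ} (L : ℝ) (f : ℝ → Space d → ℝ) (m : Fin d → ℤ) (t : ℝ) : ℂ :=
  coeffC L (fun x => (f t x : ℂ)) m

theorem measurable_timeCoeff {f : ℝ → Space d → ℝ} (hm : Measurable fun p : ℝ × Space d => f p.1 p.2)
    (m : Fin d → ℤ) : Measurable (timeCoeff L f m) := by
  refine StronglyMeasurable.measurable ?_
  refine StronglyMeasurable.integral_prod_right'
    (f := fun p : ℝ × Space d => (f p.1 p.2 : ℂ) * expWave L m (-p.2)) ?_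
  refine Measurable.stronglyMeasurable ?_
  exact (Complex.measurable_ofReal.comp hm).mul
    (((continuous_expWave m).measurable.comp measurable_neg).comp measurable_snd)

theorem integrableOn_timeCoeff {f : ℝ → Space d → ℝ}
    (hm : Measurable fun p : ℝ × Space d => f p.1 p.2)
    (hf : ∀ T : ℝ, ∫⁻ t in Ioo 0 T, ∫⁻ x, ‖f t x‖ₑ ∂cellMeasure d L ≠ ⊤) (m : Fin d → ℤ) (T : ℝ) :
    IntegrableOn (timeCoeff L f m) (Ioc 0 T) := by
  rw [integrableOn_Ioc_iff_integrableOn_Ioo]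
  refine ⟨(measurable_timeCoeff hm m).aestronglyMeasurable, ?_⟩
  refine lt_of_le_of_lt (lintegral_mono fun t => ?_) (hf T).lt_top
  refine (enorm_coeffC_le _ m).trans_eq (lintegral_congr fun x => ?_)
  rw [← ofReal_norm, Complex.norm_real, ofReal_norm]

theorem enorm_le_one_add_sq {F : Type*} [NormedAddCommGroup F] (x : F) : ‖x‖ₑ ≤ 1 + ‖x‖ₑ ^ 2 := by
  have h : ‖x‖ ≤ 1 + ‖x‖ ^ 2 := by nlinarith [sq_nonneg (‖x‖ - 1), norm_nonneg x]
  have := ENNReal.ofReal_le_ofReal h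
  rwa [ENNReal.ofReal_add (by norm_num) (by positivity), ENNReal.ofReal_one,
    ENNReal.ofReal_pow (norm_nonneg _), ofReal_norm] at this

theorem LocallySquareIntegrable.lintegral_enorm_ne_top {F : Type*} [NormedAddCommGroup F]
    [MeasurableSpace F] [BorelSpace F] {f : ℝ → Space d → F}
    (h : LocallySquareIntegrable L f) (hm : Measurable fun p : ℝ × Space d => f p.1 p.2) (T : ℝ) :
    ∫⁻ t in Ioo 0 T, ∫⁻ x, ‖f t x‖ₑ ∂cellMeasure d L ≠ ⊤ := by
  have h1 : ∫⁻ t in Ioo 0 T, ∫⁻ x, ‖f t x‖ₑ ∂cellMeasure d L ≤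
      ∫⁻ t in Ioo 0 T, (cellMeasure d L univ + ∫⁻ x, ‖f t x‖ₑ ^ 2 ∂cellMeasure d L) := by
    refine lintegral_mono fun t => ?_
    refine (lintegral_mono fun x => enorm_le_one_add_sq (f t x)).trans_eq ?_
    rw [lintegral_add_left measurable_const, lintegral_one]
  refine ne_top_of_le_ne_top ?_ h1
  rw [lintegral_add_left measurable_const, lintegral_const]
  refine ENNReal.add_ne_top.mpr ⟨ENNReal.mul_ne_top (measure_ne_top _ _) ?_, h.lintegral_ne_top hm T⟩
  simp

theorem enorm_inner_le_add_sq (v w : Space d) : ‖(inner ℝ v w : ℝ)‖ₑ ≤ ‖v‖ₑ ^ 2 + ‖w‖ₑ ^ 2 := by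
  have h : ‖(inner ℝ v w : ℝ)‖ ≤ ‖v‖ ^ 2 + ‖w‖ ^ 2 := by
    refine (norm_inner_le_norm v w).trans ?_
    nlinarith [sq_nonneg (‖v‖ - ‖w‖), norm_nonneg v, norm_nonneg w]
  have := ENNReal.ofReal_le_ofReal h
  rwa [ENNReal.ofReal_add (by positivity) (by positivity),
    ENNReal.ofReal_pow (norm_nonneg _), ENNReal.ofReal_pow (norm_nonneg _), ofReal_norm, ofReal_norm,
    ofReal_norm] at this

theorem lintegral_inner_ne_top_of_sq {v w : ℝ → Space d → Space d}
    (hv : LocallySquareIntegrable L v) (hvm : Measurable fun p : ℝ × Space d => v p.1 p.2)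
    (hw : LocallySquareIntegrable L w) (hwm : Measurable fun p : ℝ × Space d => w p.1 p.2) (T : ℝ) :
    ∫⁻ t in Ioo 0 T, ∫⁻ x, ‖(inner ℝ (v t x) (w t x) : ℝ)‖ₑ ∂cellMeasure d L ≠ ⊤ := by
  have h1 : ∫⁻ t in Ioo 0 T, ∫⁻ x, ‖(inner ℝ (v t x) (w t x) : ℝ)‖ₑ ∂cellMeasure d L ≤
      ∫⁻ t in Ioo 0 T, (∫⁻ x, ‖v t x‖ₑ ^ 2 ∂cellMeasure d L + ∫⁻ x, ‖w t x‖ₑ ^ 2 ∂cellMeasure d L) := by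
    refine lintegral_mono fun t => ?_
    refine (lintegral_mono fun x => enorm_inner_le_add_sq (v t x) (w t x)).trans_eq ?_
    rw [lintegral_add_left]
    exact (hvm.comp measurable_prodMk_left).enorm.pow_const 2
  refine ne_top_of_le_ne_top ?_ h1
  rw [lintegral_add_left (measurable_lintegral_sq hvm)]
  exact ENNReal.add_ne_top.mpr ⟨hv.lintegral_ne_top hvm T, hw.lintegral_ne_top hwm T⟩

theorem RegularTime.integrable_scalar (hL : 0 < L) {u g : Space d → Space d} {θ : Space d → ℝ}
    (h : RegularTime L u θ g) (hθ : Measurable θ) :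
    Integrable (fun x => (θ x : ℂ)) (cellMeasure d L) := by
  have h2 : ∫⁻ x, ‖(θ x : ℂ)‖ₑ ^ 2 ∂cellMeasure d L ≠ ⊤ := by
    simpa only [← ofReal_norm, Complex.norm_real] using h.scalar_sq
  have hm : Measurable fun x => (θ x : ℂ) := Complex.measurable_ofReal.comp hθ
  exact integrable_of_lintegral_ne_top hm (PassiveScalar.lintegral_enorm_ne_top hL hm h2)

/-- The spatial integral in the weak formulation, for a test function which is a single mode. -/
theorem RegularTime.integral_single_mode (hL : 0 < L) {u g : Space d → Space d} {θ : Space d → ℝ}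
    (h : RegularTime L u θ g) (hθ : Measurable θ) (hu : Measurable u) (hg : Measurable g)
    (m : Fin d → ℤ) (κ E E' : ℝ) (z : ℂ) :
    ∫ x in cell d L, (θ x * (E' * reTrig L {-m} (fun _ => z) x) -
        inner ℝ (u x) (g x) * reTrig L {-m} (fun _ => (E : ℂ) * z) x -
        κ * inner ℝ (g x) (gradient (reTrig L {-m} (fun _ => (E : ℂ) * z)) x)) =
      L ^ d * (z * (((E' - κ * ‖waveVector L m‖ ^ 2 * E : ℝ) : ℂ) * coeffC L (fun x => (θ x : ℂ)) m -
        (E : ℂ) * coeffC L (fun x => ((inner ℝ (u x) (g x) : ℝ) : ℂ)) m)).re := by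
  have hθi := h.integrable_scalar hL hθ
  have hgi : ∀ i, Integrable (fun x => (g x i : ℂ)) (cellMeasure d L) := fun i =>
    integrable_of_lintegral_ne_top (measurable_coord hg i)
      (PassiveScalar.lintegral_enorm_ne_top hL (measurable_coord hg i)
        (lintegral_coord_ne_top h.grad_sq i))
  have hFi := integrable_of_lintegral_ne_top (measurable_ofReal_inner hu hg)
    (lintegral_inner_ne_top hu hg h.velocity_sq h.grad_sq)
  have hre : ∀ {f : Space d → ℂ} {r : Space d → ℝ}, (∀ x, f x = (r x : ℂ)) →
      Integrable f (cellMeasure d L) → ∀ c : ℂ,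
      Integrable (fun x => r x * (c * expWave L m (-x)).re) (cellMeasure d L) := by
    intro f r hr hf c
    refine ((integrable_mul_expWave (L := L) hf m).const_mul c).re.congr (ae_of_all _ fun x => ?_)
    simp only [RCLike.re_eq_complex_re]
    rw [hr x, mul_left_comm, Complex.re_ofReal_mul]
  rw [setIntegral_cell hL, smul_eq_mul]
  congr 1
  have e : ∀ x, (θ x * (E' * reTrig L {-m} (fun _ => z) x) -
        inner ℝ (u x) (g x) * reTrig L {-m} (fun _ => (E : ℂ) * z) x -
        κ * inner ℝ (g x) (gradient (reTrig L {-m} (fun _ => (E : ℂ) * z)) x)) =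
      θ x * (((E' : ℂ) * z) * expWave L m (-x)).re -
        inner ℝ (u x) (g x) * (((E : ℂ) * z) * expWave L m (-x)).re -
        κ * ∑ i, g x i * ((((E : ℂ) * z) * (Complex.I * (waveVector L (-m) i : ℝ))) *
          expWave L m (-x)).re := by
    intro x
    have e0 : inner ℝ (g x) (gradient (reTrig L {-m} (fun _ => (E : ℂ) * z)) x) =
        ∑ i, g x i * ((((E : ℂ) * z) * (Complex.I * (waveVector L (-m) i : ℝ))) *
          expWave L m (-x)).re := by
      rw [PiLp.inner_apply]
      refine Finset.sum_congr rfl fun i _ => ?_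
      rw [gradient_reTrig]
      simp only [reTrig, Finset.sum_singleton, ← expWave_neg_eq, RCLike.inner_apply, conj_trivial]
      exact mul_comm _ _
    rw [e0]
    simp only [reTrig, Finset.sum_singleton, ← expWave_neg_eq]
    rw [mul_assoc (E' : ℂ), Complex.re_ofReal_mul]
  simp_rw [e]
  have i1 := hre (fun _ => rfl) hθi ((E' : ℂ) * z)
  have i2 := hre (r := fun x => inner ℝ (u x) (g x)) (fun _ => rfl) hFi ((E : ℂ) * z)
  have i3 : ∀ i, Integrable (fun x => g x i * ((((E : ℂ) * z) *
      (Complex.I * (waveVector L (-m) i : ℝ))) * expWave L m (-x)).re) (cellMeasure d L) :=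
    fun i => hre (fun _ => rfl) (hgi i) _
  have i4 := (integrable_finsetSum Finset.univ fun i _ => i3 i).const_mul κ
  have e3 := integral_sub (i1.sub i2) i4
  simp only [Pi.sub_apply] at e3
  rw [e3, integral_sub i1 i2, integral_const_mul,
    integral_finsetSum _ fun i _ => i3 i,
    integral_mul_re_const_mul (fun _ => rfl) (integrable_mul_expWave hθi m),
    integral_mul_re_const_mul (fun _ => rfl) (integrable_mul_expWave hFi m)]
  -- The factor `-i m_i` from the test function meets `i m_i` from the coefficient of the weak
  -- gradient; their product, summed over `i`, is `|m|²`.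
  have e2 : ∀ i, ∫ x, g x i * ((((E : ℂ) * z) * (Complex.I * (waveVector L (-m) i : ℝ))) *
      expWave L m (-x)).re ∂cellMeasure d L =
      (waveVector L m i) ^ 2 * ((E : ℂ) * z * coeffC L (fun x => (θ x : ℂ)) m).re := by
    intro i
    rw [integral_mul_re_const_mul (fun _ => rfl) (integrable_mul_expWave (hgi i) m)]
    have := h.weakGradient.coeffC_eq hL hθi hgi m i
    rw [coeffC] at this
    rw [this, ← Complex.re_ofReal_mul]
    congr 1
    have hw : waveVector L (-m) i = -waveVector L m i := by simp [waveVector]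
    rw [hw]
    push_cast
    linear_combination (-(E : ℂ) * z * (waveVector L m i : ℂ) ^ 2 *
      coeffC L (fun x => (θ x : ℂ)) m) * Complex.I_sq
  simp_rw [e2]
  rw [← Finset.sum_mul, ← EuclideanSpace.real_norm_sq_eq]
  change (E' * z * coeffC L (fun x => (θ x : ℂ)) m).re -
    (E * z * coeffC L (fun x => ((inner ℝ (u x) (g x) : ℝ) : ℂ)) m).re - _ = _
  rw [← mul_assoc, ← Complex.re_ofReal_mul, ← Complex.sub_re, ← Complex.sub_re]
  congr 1
  push_cast
  ring

theorem hasDerivAt_exp_mul {χ : ℝ → ℝ} (hχ : ContDiff ℝ ∞ χ) (lam t : ℝ) :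
    HasDerivAt (fun τ => Real.exp (lam * τ) * χ τ)
      (lam * (Real.exp (lam * t) * χ t) + Real.exp (lam * t) * deriv χ t) t := by
  have h1 : HasDerivAt (fun τ => Real.exp (lam * τ)) (Real.exp (lam * t) * lam) t := by
    have := ((hasDerivAt_id t).const_mul lam).exp
    simpa using this
  have h2 : HasDerivAt χ (deriv χ t) t := (hχ.differentiable (by simp) t).hasDerivAt
  convert! h1.mul h2 using 1
  ring

/-- The weak formulation for a single Fourier mode. -/
theorem IsWeakSolution.integral_mode_eq_zero (hL : 0 < L) (hu : IsVelocityField L u)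
    (h : IsWeakSolution L κ u θ₀ θ Dθ) (m : Fin d → ℤ) (z : ℂ) {χ : ℝ → ℝ} (hχ : ContDiff ℝ ∞ χ)
    (hχc : HasCompactSupport χ) (hχs : tsupport χ ⊆ Ioi 0) :
    ∫ t in Ioi (0 : ℝ), ((z * (Real.exp (κ * ‖waveVector L m‖ ^ 2 * t) *
        timeCoeff L θ m t)).re * deriv χ t +
      -(z * (Real.exp (κ * ‖waveVector L m‖ ^ 2 * t) *
        timeCoeff L (fun t x => inner ℝ (u t x) (Dθ t x)) m t)).re * χ t) = 0 := by
  set lam := κ * ‖waveVector L m‖ ^ 2 with hlam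
  obtain ⟨a, b, ha, hab, hKab⟩ := exists_Icc_of_isCompact hχc.isCompact hχs
  have hχ0 : ∀ t, t ∉ Icc a b → χ t = 0 := fun t ht => eq_zero_of_tsupport_subset_Icc hKab ht
  -- The integrating factor `e^{λt}`, `λ = κ|m|²`, cancels the diffusion term: the time derivative
  -- of `e^{λt}χ` minus `λ e^{λt}χ` is `e^{λt}χ'`. Since `χ` vanishes at time 0, the initial datum
  -- drops out.
  set η : ℝ → Space d → ℝ := fun t =>
    reTrig L {-m} (fun _ => ((Real.exp (lam * t) * χ t : ℝ) : ℂ) * z) with hη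
  have hηeq : ∀ t x, η t x = (Real.exp (lam * t) * χ t) * reTrig L {-m} (fun _ => z) x := by
    intro t x
    simp only [hη, reTrig, Finset.sum_singleton]
    rw [mul_assoc, Complex.re_ofReal_mul]
  have htest : IsTestFunction L η := by
    refine ⟨?_, fun t => isPeriodic_reTrig hL _ _, b + 1, fun t ht x => ?_⟩
    · simp_rw [hηeq]
      refine ContDiff.mul (ContDiff.mul ?_ (hχ.comp contDiff_fst))
        ((contDiff_reTrig _ _).comp contDiff_snd)
      exact Real.contDiff_exp.comp (contDiff_const.mul contDiff_fst)
    · rw [hηeq, hχ0 t fun h2 => by linarith [h2.2]]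
      ring
  have heq := h.equation η htest
  have h0 : ∀ x, η 0 x = 0 := fun x => by
    rw [hηeq, hχ0 0 fun h2 => by linarith [h2.1]]; ring
  simp only [h0, mul_zero, integral_zero, add_zero] at heq
  have hLd : L ^ d ≠ 0 := by positivity
  refine (mul_eq_zero.mp ?_).resolve_left hLd
  rw [← integral_const_mul]
  refine Eq.trans (integral_congr_ae ?_) heq
  filter_upwards [h.ae_regularTime hu] with t ht
  have hderiv : ∀ x, deriv (fun τ => η τ x) t =
      (lam * (Real.exp (lam * t) * χ t) + Real.exp (lam * t) * deriv χ t) *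
        reTrig L {-m} (fun _ => z) x := by
    intro x
    simp_rw [hηeq]
    exact ((hasDerivAt_exp_mul hχ lam t).mul_const _).deriv
  simp_rw [hderiv]
  have hθm : Measurable (θ t) := h.measurable.comp measurable_prodMk_left
  have hum : Measurable (u t) := hu.measurable.comp measurable_prodMk_left
  have hgm : Measurable (Dθ t) := h.grad_measurable.comp measurable_prodMk_left
  have := ht.integral_single_mode hL hθm hum hgm m κ (Real.exp (lam * t) * χ t)
    (lam * (Real.exp (lam * t) * χ t) + Real.exp (lam * t) * deriv χ t) z
  simp only [hη]
  rw [this, ← hlam]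
  congr 1
  rw [add_sub_cancel_left, timeCoeff, timeCoeff]
  have e1 : ∀ (w : ℂ) (r : ℝ), w.re * r = ((r : ℂ) * w).re := fun w r => by
    rw [Complex.re_ofReal_mul, mul_comm]
  rw [neg_mul, e1, e1, ← sub_eq_add_neg, ← Complex.sub_re]
  congr 1
  push_cast
  ring

/-- The Fourier modes of a weak solution are, up to an exponential factor, primitives. -/
theorem IsWeakSolution.exists_mode_eq_primitive (hL : 0 < L) (hu : IsVelocityField L u)
    (h : IsWeakSolution L κ u θ₀ θ Dθ) (m : Fin d → ℤ) :
    ∃ c : ℂ, ∀ᵐ t ∂volume.restrict (Ioi (0 : ℝ)),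
      Real.exp (κ * ‖waveVector L m‖ ^ 2 * t) * timeCoeff L θ m t =
        c - ∫ r in (0 : ℝ)..t, Real.exp (κ * ‖waveVector L m‖ ^ 2 * r) *
          timeCoeff L (fun t x => inner ℝ (u t x) (Dθ t x)) m r := by
  set lam := κ * ‖waveVector L m‖ ^ 2 with hlam
  have hFm : Measurable fun p : ℝ × Space d => (inner ℝ (u p.1 p.2) (Dθ p.1 p.2) : ℝ) :=
    hu.measurable.inner h.grad_measurable
  have hexp : ∀ {f : ℝ → ℂ}, (∀ T, IntegrableOn f (Ioc 0 T)) → ∀ T,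
      IntegrableOn (fun t => (Real.exp (lam * t) : ℂ) * f t) (Ioc 0 T) := by
    intro f hf T
    have hc : Continuous fun t : ℝ => (Real.exp (lam * t) : ℂ) := by fun_prop
    rcases le_total 0 T with hT | hT
    · have := ((intervalIntegrable_iff_integrableOn_Ioc_of_le hT).mpr (hf T)).continuousOn_mul
        hc.continuousOn
      exact (intervalIntegrable_iff_integrableOn_Ioc_of_le hT).mp this
    · rw [Ioc_eq_empty (not_lt.mpr hT)]; exact integrableOn_empty
  have hV := hexp (fun T => integrableOn_timeCoeff h.measurable
    (h.sqIntegrable.lintegral_enorm_ne_top h.measurable) m T)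
  have hQ := hexp (fun T => integrableOn_timeCoeff hFm
    (lintegral_inner_ne_top_of_sq hu.sqIntegrable hu.measurable h.grad_sqIntegrable
      h.grad_measurable) m T)
  -- Used with `z = 1` for the real part and `z = -i` for the imaginary part.
  have key : ∀ z : ℂ, ∃ c : ℝ, ∀ᵐ t ∂volume.restrict (Ioi (0 : ℝ)),
      (z * (Real.exp (lam * t) * timeCoeff L θ m t)).re = c + ∫ r in (0 : ℝ)..t,
        -(z * (Real.exp (lam * r) *
          timeCoeff L (fun t x => inner ℝ (u t x) (Dθ t x)) m r)).re := fun z =>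
    ae_eq_primitive_of_weak_deriv (fun T => ((hV T).const_mul z).re)
      (fun T => ((hQ T).const_mul z).re.neg)
      fun χ hχ hχc hχs => h.integral_mode_eq_zero hL hu m z hχ hχc hχs
  obtain ⟨c1, hc1⟩ := key 1
  obtain ⟨c2, hc2⟩ := key (-Complex.I)
  refine ⟨⟨c1, c2⟩, ?_⟩
  filter_upwards [hc1, hc2, ae_restrict_mem measurableSet_Ioi] with t h1 h2 ht
  have hi : IntervalIntegrable (fun r => (Real.exp (lam * r) : ℂ) *
      timeCoeff L (fun t x => inner ℝ (u t x) (Dθ t x)) m r) volume 0 t :=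
    (intervalIntegrable_iff_integrableOn_Ioc_of_le (le_of_lt ht)).mpr (hQ t)
  have e : ∀ z : ℂ, (z * ∫ r in (0 : ℝ)..t, (Real.exp (lam * r) : ℂ) *
      timeCoeff L (fun t x => inner ℝ (u t x) (Dθ t x)) m r).re =
      ∫ r in (0 : ℝ)..t, (z * ((Real.exp (lam * r) : ℂ) *
      timeCoeff L (fun t x => inner ℝ (u t x) (Dθ t x)) m r)).re := by
    intro z
    rw [← intervalIntegral.integral_const_mul]
    exact (Complex.reCLM.intervalIntegral_comp_comm (hi.const_mul z)).symm
  rw [intervalIntegral.integral_neg, ← e] at h1 h2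
  apply Complex.ext
  · rw [one_mul, one_mul] at h1
    rw [h1, Complex.sub_re]
    ring
  · simp only [neg_mul, Complex.neg_re, Complex.I_mul_re, neg_neg] at h2
    rw [h2, Complex.sub_im]
    ring

end TimeRegularity

/-! ### Growth of the L¹ norm of a time-dependent trigonometric polynomial. -/

section Evolution

open scoped Topology ComplexConjugate

variable {d : ℕ} {L : ℝ}

/-- A smooth approximation of the absolute value. -/
def smoothAbs (ε w : ℝ) : ℝ := √(ε ^ 2 + w ^ 2)

theorem contDiff_smoothAbs {ε : ℝ} (hε : 0 < ε) : ContDiff ℝ ∞ (smoothAbs ε) := by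
  refine ContDiff.sqrt (by fun_prop) fun w => ?_
  positivity

theorem hasDerivAt_smoothAbs {ε : ℝ} (hε : 0 < ε) (w : ℝ) :
    HasDerivAt (smoothAbs ε) (w / √(ε ^ 2 + w ^ 2)) w := by
  have h1 : HasDerivAt (fun w : ℝ => ε ^ 2 + w ^ 2) (2 * w) w := by
    simpa using (hasDerivAt_pow 2 w).const_add (ε ^ 2)
  convert! h1.sqrt (by positivity) using 1
  field_simp

theorem smoothAbs_nonneg (ε w : ℝ) : 0 ≤ smoothAbs ε w := Real.sqrt_nonneg _

theorem abs_le_smoothAbs (ε w : ℝ) : |w| ≤ smoothAbs ε w := by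
  refine Real.abs_le_sqrt ?_
  nlinarith [sq_nonneg ε]

theorem smoothAbs_le {ε : ℝ} (hε : 0 < ε) (w : ℝ) : smoothAbs ε w ≤ |w| + ε := by
  refine Real.sqrt_le_iff.2 ⟨by positivity, ?_⟩
  nlinarith [sq_abs w, abs_nonneg w]

theorem abs_deriv_smoothAbs_le {ε : ℝ} (hε : 0 < ε) (w : ℝ) : |deriv (smoothAbs ε) w| ≤ 1 := by
  rw [(hasDerivAt_smoothAbs hε w).deriv, abs_div, abs_of_nonneg (Real.sqrt_nonneg _)]
  exact div_le_one_of_le₀ (abs_le_smoothAbs ε w) (Real.sqrt_nonneg _)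

theorem measurable_primitive {f : ℝ → ℂ} (hf : Measurable f) :
    Measurable fun t => ∫ r in (0 : ℝ)..t, f r := by
  have key : ∀ {p q : ℝ → ℝ}, Measurable p → Measurable q →
      Measurable fun t : ℝ => ∫ r in Ioc (p t) (q t), f r := by
    intro p q hp hq
    have : (fun t : ℝ => ∫ r in Ioc (p t) (q t), f r) =
        fun t => ∫ r, {z : ℝ × ℝ | p z.1 < z.2 ∧ z.2 ≤ q z.1}.indicator (fun z => f z.2) (t, r) := by
      ext t
      rw [← integral_indicator measurableSet_Ioc]
      rfl
    rw [this]
    refine (StronglyMeasurable.integral_prod_right' ?_).measurable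
    refine ((hf.comp measurable_snd).indicator ?_).stronglyMeasurable
    exact (measurableSet_lt (hp.comp measurable_fst) measurable_snd).inter
      (measurableSet_le measurable_snd (hq.comp measurable_fst))
  exact (key measurable_const measurable_id).sub (key measurable_id measurable_const)

/-- The `L¹` norm of a time-dependent trigonometric polynomial grows at most by the time integral of
the pairing of its time derivative with its (regularized) sign. -/
theorem lintegral_enorm_reTrig_primitive_le (hL : 0 < L) (S : Finset (Fin d → ℤ))
    {f : (Fin d → ℤ) → ℝ → ℂ} (hf : ∀ m, Measurable (f m))
    (hfi : ∀ m T, IntegrableOn (f m) (Ioc 0 T)) (c : (Fin d → ℤ) → ℂ) {a b : ℝ} (ha : 0 ≤ a)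
    (hab : a ≤ b) {K : ℝ → ℝ≥0∞}
    (hK : ∀ B : ℝ → ℝ, ContDiff ℝ ∞ B → (∀ r, |deriv B r| ≤ 1) →
      ∀ᵐ t ∂volume.restrict (Ioc a b),
        ‖∫ x, deriv B (reTrig L S (fun m => c m - ∫ r in (0 : ℝ)..t, f m r) x) *
          reTrig L S (fun m => f m t) x ∂cellMeasure d L‖ₑ ≤ K t) :
    ∫⁻ x, ‖reTrig L S (fun m => c m - ∫ r in (0 : ℝ)..b, f m r) x‖ₑ ∂cellMeasure d L ≤
      (∫⁻ x, ‖reTrig L S (fun m => c m - ∫ r in (0 : ℝ)..a, f m r) x‖ₑ ∂cellMeasure d L) +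
        ∫⁻ t in Ioc a b, K t := by
  have := isProbabilityMeasure_cellMeasure (d := d) hL
  set w : ℝ → Space d → ℝ := fun t => reTrig L S (fun m => c m - ∫ r in (0 : ℝ)..t, f m r) with hw
  have hb : 0 ≤ b := ha.trans hab
  have hri : ∀ x, IntervalIntegrable (fun r => reTrig L S (fun m => f m r) x) volume 0 b := by
    intro x
    rw [intervalIntegrable_iff_integrableOn_Ioc_of_le hb]
    refine Integrable.re (f := fun r => ∑ m ∈ S, f m r * expWave L m x) ?_
    exact integrable_finsetSum _ fun m _ => (hfi m b).mul_const _
  have hwf : ∀ x t, 0 ≤ t → w t x = reTrig L S c x + ∫ r in (0 : ℝ)..t,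
      -reTrig L S (fun m => f m r) x := by
    intro x t ht
    have h1 : ∫ r in (0 : ℝ)..t, reTrig L S (fun m => f m r) x =
        reTrig L S (fun m => ∫ r in (0 : ℝ)..t, f m r) x := by
      rw [intervalIntegral.integral_of_le ht]
      simp only [reTrig]
      have h2 : Integrable (fun r => ∑ m ∈ S, f m r * expWave L m x) (volume.restrict (Ioc 0 t)) :=
        integrable_finsetSum _ fun m _ => (hfi m t).mul_const _
      have h3 : ∫ r in Ioc 0 t, (∑ m ∈ S, f m r * expWave L m x).re =
          (∫ r in Ioc 0 t, ∑ m ∈ S, f m r * expWave L m x).re := integral_re h2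
      rw [h3, integral_finsetSum _ fun m _ => (hfi m t).mul_const _]
      congr 1
      refine Finset.sum_congr rfl fun m _ => ?_
      rw [integral_mul_const, intervalIntegral.integral_of_le ht]
    rw [intervalIntegral.integral_neg, h1, hw]
    simp only [reTrig, sub_mul, Finset.sum_sub_distrib, Complex.sub_re]
    ring
  have hcont : ∀ t, Continuous (w t) := fun t => (contDiff_reTrig _ _).continuous
  have hbdd : ∀ t x, |w t x| ≤ ∑ m ∈ S, ‖c m - ∫ r in (0 : ℝ)..t, f m r‖ := fun t x =>
    norm_reTrig_le S _ x
  have hwi : ∀ t, Integrable (w t) (cellMeasure d L) := fun t =>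
    Integrable.of_bound (hcont t).aestronglyMeasurable _ (ae_of_all _ (hbdd t))
  have hjm : Measurable fun p : Space d × ℝ => reTrig L S (fun m => f m p.2) p.1 := by
    simp only [reTrig]
    refine Complex.measurable_re.comp ?_
    exact Finset.measurable_fun_sum _ fun m _ => ((hf m).comp measurable_snd).mul
      ((continuous_expWave m).measurable.comp measurable_fst)
  have hprim := fun m => measurable_primitive (hf m)
  have hwm : Measurable fun p : Space d × ℝ => w p.2 p.1 := by
    simp only [hw, reTrig]
    refine Complex.measurable_re.comp ?_
    exact Finset.measurable_fun_sum _ fun m _ =>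
      (measurable_const.sub ((hprim m).comp measurable_snd)).mul
      ((continuous_expWave m).measurable.comp measurable_fst)
  -- The absolute value is replaced by `smoothAbs ε`, which costs at most `ε` because the cell
  -- measure has mass one.
  refine ENNReal.le_of_forall_pos_le_add fun ε hε _ => ?_
  have hε' : (0 : ℝ) < ε := hε
  set B := smoothAbs ε with hB
  have hBd := contDiff_smoothAbs hε'
  have hB1 := abs_deriv_smoothAbs_le hε'
  have hBm : Measurable (deriv B) := measurable_deriv _
  have hBi : ∀ t, Integrable (fun x => B (w t x)) (cellMeasure d L) := by
    intro t
    refine ((hwi t).abs.add (integrable_const (ε : ℝ))).mono'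
      (hBd.continuous.comp (hcont t)).aestronglyMeasurable (ae_of_all _ fun x => ?_)
    rw [Real.norm_eq_abs, abs_of_nonneg (smoothAbs_nonneg _ _)]
    exact smoothAbs_le hε' _
  -- The chain rule in time at each fixed `x`, followed by Fubini; the integrand is dominated by `∑
  -- ‖f m t‖`, since `|B'| ≤ 1`.
  have hkey : (∫ x, B (w b x) ∂cellMeasure d L) - ∫ x, B (w a x) ∂cellMeasure d L =
      ∫ t in Ioc a b, ∫ x, -(deriv B (w t x) * reTrig L S (fun m => f m t) x) ∂cellMeasure d L := by
    have e := integral_sub (hBi b) (hBi a)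
    rw [← e]
    have h1 : ∀ x, B (w b x) - B (w a x) =
        ∫ t in Ioc a b, -(deriv B (w t x) * reTrig L S (fun m => f m t) x) := by
      intro x
      have e2 := comp_primitive_sub_eq_integral hb (hri x).neg hBd hB1 (reTrig L S c x) ha hab le_rfl
      simp only [Pi.neg_apply] at e2
      rw [hwf x b hb, hwf x a ha, e2, intervalIntegral.integral_of_le hab]
      refine setIntegral_congr_fun measurableSet_Ioc fun t ht => ?_
      rw [hwf x t (ha.trans ht.1.le)]
      ring
    simp_rw [h1]
    refine integral_integral_swap ?_
    have hdom : Integrable (fun p : Space d × ℝ => (1 : ℝ) * ∑ m ∈ S, ‖f m p.2‖)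
        ((cellMeasure d L).prod (volume.restrict (Ioc a b))) := by
      refine Integrable.mul_prod (f := fun _ : Space d => (1 : ℝ))
        (g := fun r : ℝ => ∑ m ∈ S, ‖f m r‖) (integrable_const _) ?_
      refine integrable_finsetSum _ fun m _ => Integrable.norm ?_
      exact (hfi m b).mono_set (Ioc_subset_Ioc_left ha)
    refine hdom.mono' (((hBm.comp hwm).mul hjm).neg.aestronglyMeasurable) (ae_of_all _ fun p => ?_)
    simp only [Function.uncurry, norm_neg, norm_mul]
    exact mul_le_mul (hB1 _) (norm_reTrig_le S _ _) (norm_nonneg _) zero_le_one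
  have hconv : ∀ t, ∫⁻ x, ‖w t x‖ₑ ∂cellMeasure d L =
      ENNReal.ofReal (∫ x, |w t x| ∂cellMeasure d L) := by
    intro t
    rw [ofReal_integral_eq_lintegral_ofReal (hwi t).abs (ae_of_all _ fun x => abs_nonneg _)]
    refine lintegral_congr fun x => ?_
    rw [← Real.norm_eq_abs, ofReal_norm]
  have hle : ∫ x, |w b x| ∂cellMeasure d L ≤ (∫ x, |w a x| ∂cellMeasure d L) + ε +
      ‖∫ t in Ioc a b, ∫ x, -(deriv B (w t x) * reTrig L S (fun m => f m t) x) ∂cellMeasure d L‖ := by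
    have h1 : ∫ x, |w b x| ∂cellMeasure d L ≤ ∫ x, B (w b x) ∂cellMeasure d L :=
      integral_mono (hwi b).abs (hBi b) fun x => abs_le_smoothAbs _ _
    have h2 : ∫ x, B (w a x) ∂cellMeasure d L ≤ ∫ x, (|w a x| + ε) ∂cellMeasure d L :=
      integral_mono (hBi a) ((hwi a).abs.add (integrable_const _)) fun x => smoothAbs_le hε' _
    rw [integral_add (hwi a).abs (integrable_const _)] at h2
    simp only [integral_const, probReal_univ, one_smul] at h2
    have h3 := le_abs_self ((∫ x, B (w b x) ∂cellMeasure d L) - ∫ x, B (w a x) ∂cellMeasure d L)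
    rw [← Real.norm_eq_abs, hkey] at h3
    linarith
  rw [hconv, hconv]
  refine (ENNReal.ofReal_le_ofReal hle).trans ?_
  have hn : 0 ≤ ∫ x, |w a x| ∂cellMeasure d L := integral_nonneg fun _ => abs_nonneg _
  rw [ENNReal.ofReal_add (by positivity) (norm_nonneg _), ENNReal.ofReal_add hn hε'.le, ofReal_norm,
    ENNReal.ofReal_coe_nnreal, add_right_comm]
  gcongr
  refine (enorm_integral_le_lintegral_enorm _).trans (lintegral_mono_ae ?_)
  filter_upwards [hK B hBd hB1] with t ht
  rwa [integral_neg, enorm_neg]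

end Evolution

/-! ### The contraction estimate over one diffusive time window. -/

section Recursion

open scoped Topology ComplexConjugate

variable {d : ℕ} {L κ : ℝ} {u : ℝ → Space d → Space d} {θ₀ : Space d → ℝ} {θ : ℝ → Space d → ℝ}
  {Dθ : ℝ → Space d → Space d} {Φ : ℤ → 𝓢(Space d, ℂ)}

/-- Evolution of the `L¹` norm of a spectrally localized part of the scalar, compared with its
evolution under the heat equation. The factor `z` selects real or imaginary parts. -/
theorem IsWeakSolution.exists_ae_evolution (hL : 0 < L) (hκ : 0 < κ) (hu : IsVelocityField L u)
    (h : IsWeakSolution L κ u θ₀ θ Dθ) {s : ℝ} (hs : s ∈ Icc (0 : ℝ) 1) {G : ℝ≥0∞}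
    (hG : ∀ᵐ t ∂volume.restrict (Ioi (0 : ℝ)), fracGradSq L s (u t) ^ (1 / 2 : ℝ) = G)
    {k₀ : Space d → ℂ} (S : Finset (Fin d → ℤ))
    (hS : ∀ m, m ∉ S → kernelFT k₀ (waveVector L m) = 0) {R : ℝ} {D : ℝ≥0∞}
    (hheat : ∀ ρ : ℝ, 0 < ρ → ρ ≤ R → ∃ k : Space d → ℂ, Measurable k ∧ Integrable k ∧
      (∀ ξ, kernelFT k ξ = ((Real.exp (-(ρ * ‖ξ‖ ^ 2)) : ℝ) : ℂ) * kernelFT k₀ ξ) ∧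
      ∫⁻ y, ‖k y‖ₑ * ENNReal.ofReal (2 * ‖y‖ ^ s) ≤ D) :
    ∃ P : ℝ → Prop, (∀ᵐ t ∂volume.restrict (Ioi (0 : ℝ)), P t) ∧
      ∀ z : ℂ, ‖z‖ ≤ 1 → ∀ a b : ℝ, 0 ≤ a → a ≤ b → P a → P b → κ * (b - a) ≤ R →
        ∫⁻ x, ‖reTrig L S (fun m => z * (kernelFT k₀ (waveVector L m) *
            timeCoeff L θ m b)) x‖ₑ ∂cellMeasure d L ≤
          (∫⁻ x, ‖reTrig L S (fun m => z * (((Real.exp (-(κ * (b - a) * ‖waveVector L m‖ ^ 2)) : ℝ) : ℂ)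
            * (kernelFT k₀ (waveVector L m) * timeCoeff L θ m a))) x‖ₑ ∂cellMeasure d L) +
          ∫⁻ r in Ioc a b, D * G * (∫⁻ x, ‖Dθ r x‖ₑ ^ 2 ∂cellMeasure d L) ^ (1 / 2 : ℝ) := by
  choose c hc using fun m => h.exists_mode_eq_primitive hL hu m
  -- The good times are those at which each of the finitely many modes agrees with its absolutely
  -- continuous representative. This null set does not depend on `z`, `a` or `b`.
  refine ⟨fun t => ∀ m ∈ S, (Real.exp (κ * ‖waveVector L m‖ ^ 2 * t) : ℂ) * timeCoeff L θ m t =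
        c m - ∫ r in (0 : ℝ)..t, (Real.exp (κ * ‖waveVector L m‖ ^ 2 * r) : ℂ) *
          timeCoeff L (fun t x => inner ℝ (u t x) (Dθ t x)) m r,
    (Finset.eventually_all S).2 fun m _ => hc m, ?_⟩
  intro z hz a b ha hab hPa hPb hR
  set F := timeCoeff L (fun t x => inner ℝ (u t x) (Dθ t x)) with hF
  have hFm : Measurable fun p : ℝ × Space d => (inner ℝ (u p.1 p.2) (Dθ p.1 p.2) : ℝ) :=
    hu.measurable.inner h.grad_measurable
  have hFi := integrableOn_timeCoeff hFm
    (lintegral_inner_ne_top_of_sq hu.sqIntegrable hu.measurable h.grad_sqIntegrable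
      h.grad_measurable)
  -- At a good time `t`, `α m * c m - ∫₀ᵗ f m` is the localized mode propagated by the heat flow
  -- from `t` to the fixed final time `b`. In this variable diffusion has disappeared and only
  -- transport remains.
  set α : (Fin d → ℤ) → ℂ := fun m => z * kernelFT k₀ (waveVector L m) *
    (Real.exp (-(κ * ‖waveVector L m‖ ^ 2 * b)) : ℝ) with hα
  set f : (Fin d → ℤ) → ℝ → ℂ := fun m r =>
    α m * ((Real.exp (κ * ‖waveVector L m‖ ^ 2 * r) : ℂ) * F m r) with hf
  have hfm : ∀ m, Measurable (f m) := fun m => by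
    refine measurable_const.mul (Measurable.mul ?_ (measurable_timeCoeff hFm m))
    exact Complex.measurable_ofReal.comp (by fun_prop)
  have hfi : ∀ m T, IntegrableOn (f m) (Ioc 0 T) := by
    intro m T
    refine Integrable.const_mul ?_ _
    refine (hFi m T).bdd_mul (c := Real.exp (|κ * ‖waveVector L m‖ ^ 2| * T)) ?_ ?_
    · exact (Complex.measurable_ofReal.comp (by fun_prop)).aestronglyMeasurable
    · refine (ae_restrict_iff' measurableSet_Ioc).2 (ae_of_all _ fun r hr => ?_)
      rw [Complex.norm_real, Real.norm_eq_abs, abs_of_pos (Real.exp_pos _), Real.exp_le_exp]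
      refine mul_le_mul (le_abs_self _) hr.2 hr.1.le (abs_nonneg _)
  have hrep : ∀ t, (∀ m ∈ S, (Real.exp (κ * ‖waveVector L m‖ ^ 2 * t) : ℂ) * timeCoeff L θ m t =
        c m - ∫ r in (0 : ℝ)..t, (Real.exp (κ * ‖waveVector L m‖ ^ 2 * r) : ℂ) * F m r) →
      ∀ x, reTrig L S (fun m => α m * c m - ∫ r in (0 : ℝ)..t, f m r) x =
        reTrig L S (fun m => z * (((Real.exp (-(κ * (b - t) * ‖waveVector L m‖ ^ 2)) : ℝ) : ℂ)
            * (kernelFT k₀ (waveVector L m) * timeCoeff L θ m t))) x := by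
    intro t ht x
    simp only [reTrig]
    congr 1
    refine Finset.sum_congr rfl fun m hm => ?_
    congr 1
    rw [hf]
    simp only [intervalIntegral.integral_const_mul]
    rw [← mul_sub, ← ht m hm, hα]
    have : Real.exp (-(κ * (b - t) * ‖waveVector L m‖ ^ 2)) =
        Real.exp (-(κ * ‖waveVector L m‖ ^ 2 * b)) * Real.exp (κ * ‖waveVector L m‖ ^ 2 * t) := by
      rw [← Real.exp_add]
      ring_nf
    rw [this, Complex.ofReal_mul]
    ring
  have hmain := lintegral_enorm_reTrig_primitive_le (d := d) hL S hfm hfi (fun m => α m * c m) ha hab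
    (K := fun r => D * G * (∫⁻ x, ‖Dθ r x‖ₑ ^ 2 ∂cellMeasure d L) ^ (1 / 2 : ℝ)) ?_
  · refine le_of_eq_of_le ?_ (hmain.trans_eq ?_)
    · refine lintegral_congr fun x => ?_
      rw [hrep b hPb]
      simp
    · congr 1
      exact lintegral_congr fun x => by rw [hrep a hPa]
  · intro B hB hB1
    have hsub : Ioc a b ⊆ Ioi 0 := fun r hr => ha.trans_lt hr.1
    -- `hheat` requires a positive heat time, so the end point is discarded.
    have hne : ∀ᵐ t ∂volume.restrict (Ioc a b), t ≠ b :=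
      ae_restrict_of_ae (by simp [ae_iff, measure_singleton])
    filter_upwards [hne, ae_restrict_mem measurableSet_Ioc,
      ae_restrict_of_ae_restrict_of_subset hsub ((Finset.eventually_all S).2 fun m _ => hc m),
      ae_restrict_of_ae_restrict_of_subset hsub hG,
      ae_restrict_of_ae_restrict_of_subset hsub (h.ae_regularTime hu)] with t htb htm ht htG htr
    have htlt : t < b := lt_of_le_of_ne htm.2 htb
    -- The remaining heat flow is merged with `k₀` into one kernel, to which the commutator estimate
    -- applies.
    obtain ⟨k, hkm, hki, hkF, hkD⟩ := hheat (κ * (b - t)) (mul_pos hκ (sub_pos.2 htlt))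
      ((mul_le_mul_of_nonneg_left (by linarith [htm.1]) hκ.le).trans hR)
    have hzk : ∀ m, waveTransform L (fun y => z * k y) m = z *
        (((Real.exp (-(κ * (b - t) * ‖waveVector L m‖ ^ 2)) : ℝ) : ℂ) *
          kernelFT k₀ (waveVector L m)) := by
      intro m
      rw [← hkF, ← waveTransform_eq_kernelFT, waveTransform, waveTransform, ← integral_const_mul]
      simp only [mul_assoc]
    have htrans := enorm_integral_transport_le hL hs
      (u := u t) (g := Dθ t) (θ := θ t) (k := fun y => z * k y)
      (hu.measurable.comp measurable_prodMk_left) (hu.periodic t) htr.velocity_sq htr.divFree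
      (h.grad_measurable.comp measurable_prodMk_left) (h.grad_periodic t) htr.grad_sq
      (htr.integrable_scalar hL (h.measurable.comp measurable_prodMk_left)) htr.weakGradient
      (measurable_const.mul hkm) (hki.const_mul z) S
      (fun m hm => by rw [hzk, hS m hm]; simp) hB hB1
    have e1 : ∀ x, reTrig L S (fun m => α m * c m - ∫ r in (0 : ℝ)..t, f m r) x =
        reTrig L S (fun m => waveTransform L (fun y => z * k y) m *
          coeffC L (fun x => (θ t x : ℂ)) m) x := by
      intro x
      rw [hrep t ht]
      simp only [hzk, mul_assoc]
      rfl
    have e2 : ∀ x, reTrig L S (fun m => f m t) x =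
        reTrig L S (fun m => waveTransform L (fun y => z * k y) m *
          coeffC L (fun x => ((inner ℝ (u t x) (Dθ t x) : ℝ) : ℂ)) m) x := by
      intro x
      simp only [reTrig]
      congr 1
      refine Finset.sum_congr rfl fun m hm => ?_
      congr 1
      rw [hzk, hf, hα]
      have : Real.exp (-(κ * (b - t) * ‖waveVector L m‖ ^ 2)) =
          Real.exp (-(κ * ‖waveVector L m‖ ^ 2 * b)) * Real.exp (κ * ‖waveVector L m‖ ^ 2 * t) := by
        rw [← Real.exp_add]
        ring_nf
      have hFt : F m t = coeffC L (fun x => ((inner ℝ (u t x) (Dθ t x) : ℝ) : ℂ)) m := rfl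
      simp only [this, Complex.ofReal_mul, ← hFt]
      ring
    simp_rw [e1, e2]
    refine htrans.trans ?_
    rw [htG]
    gcongr
    refine le_trans (lintegral_mono fun y => ?_) hkD
    gcongr
    rw [enorm_mul]
    refine mul_le_of_le_one_left zero_le ?_
    rw [← ofReal_norm]
    exact ENNReal.ofReal_le_one.2 hz

theorem enorm_reTrig_le (S : Finset (Fin d → ℤ)) (c : (Fin d → ℤ) → ℂ) {z : ℂ} (hz : ‖z‖ ≤ 1)
    (x : Space d) :
    ‖reTrig L S (fun m => z * c m) x‖ₑ ≤ ‖∑ m ∈ S, c m * expWave L m x‖ₑ := by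
  have : reTrig L S (fun m => z * c m) x = (z * ∑ m ∈ S, c m * expWave L m x).re := by
    simp only [reTrig, Finset.mul_sum, mul_assoc]
  rw [this, ← ofReal_norm, ← ofReal_norm]
  refine ENNReal.ofReal_le_ofReal ((Complex.abs_re_le_norm _).trans ?_)
  rw [norm_mul]
  exact mul_le_of_le_one_left (norm_nonneg _) hz

theorem enorm_trigPoly_le (S : Finset (Fin d → ℤ)) (c : (Fin d → ℤ) → ℂ) (x : Space d) :
    ‖∑ m ∈ S, c m * expWave L m x‖ₑ ≤ ‖reTrig L S (fun m => 1 * c m) x‖ₑ +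
      ‖reTrig L S (fun m => -Complex.I * c m) x‖ₑ := by
  set w := ∑ m ∈ S, c m * expWave L m x with hw
  have h1 : reTrig L S (fun m => 1 * c m) x = w.re := by simp [reTrig, hw]
  have h2 : reTrig L S (fun m => -Complex.I * c m) x = w.im := by
    have : reTrig L S (fun m => -Complex.I * c m) x = (-Complex.I * w).re := by
      simp only [reTrig, hw, Finset.mul_sum, mul_assoc]
    rw [this]
    simp
  rw [h1, h2, ← ofReal_norm, ← ofReal_norm, ← ofReal_norm, ← ENNReal.ofReal_add (by positivity)
    (by positivity)]
  exact ENNReal.ofReal_le_ofReal (Complex.norm_le_abs_re_add_abs_im w)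

theorem RegularTime.lpProj_ae_eq (hL : 0 < L) {v g : Space d → Space d} {f : Space d → ℝ}
    (h : RegularTime L v f g) (hf : Measurable f) (hfp : IsPeriodic L f) (l : ℤ)
    (S : Finset (Fin d → ℤ)) (hS : ∀ m, m ∉ S → kernelFT (Φ l) (waveVector L m) = 0) :
    ∀ᵐ x ∂cellMeasure d L, lpProj Φ l f x =
      ∑ m ∈ S, kernelFT (Φ l) (waveVector L m) * coeffC L (fun x => (f x : ℂ)) m *
        expWave L m x := by
  have h1 := conv_ae_eq_trigPoly hL (measurable_schwartz (Φ l)) (Φ l).integrable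
    (Complex.measurable_ofReal.comp hf) (hfp.postcomp _)
    (h.integrable_scalar hL hf).2.ne S (fun m hm => by rw [waveTransform_eq_kernelFT, hS m hm])
  filter_upwards [h1] with x hx
  simp only [waveTransform_eq_kernelFT] at hx
  exact hx

/-- The `L¹` norm of a Littlewood--Paley projection of the scalar contracts over the diffusive time
scale, up to an error due to transport. -/
theorem IsWeakSolution.exists_ae_recursion (hL : 0 < L) (hκ : 0 < κ) (hu : IsVelocityField L u)
    (h : IsWeakSolution L κ u θ₀ θ Dθ) (hΦ : IsLittlewoodPaleyFamily Φ)
    {s : ℝ} (hs : s ∈ Icc (0 : ℝ) 1) {G : ℝ≥0∞}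
    (hG : ∀ᵐ t ∂volume.restrict (Ioi (0 : ℝ)), fracGradSq L s (u t) ^ (1 / 2 : ℝ) = G)
    (l : ℤ) {R : ℝ} (hR : 0 ≤ R) {D : ℝ≥0∞}
    (hheat : ∀ ρ : ℝ, 0 < ρ → ρ ≤ R → ∃ k : Space d → ℂ, Measurable k ∧ Integrable k ∧
      (∀ ξ, kernelFT k ξ = ((Real.exp (-(ρ * ‖ξ‖ ^ 2)) : ℝ) : ℂ) * kernelFT (Φ l) ξ) ∧
      ∫⁻ y, ‖k y‖ₑ * ENNReal.ofReal (2 * ‖y‖ ^ s) ≤ D)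
    {A : Space d → ℂ} (hA : Measurable A) (hAi : Integrable A) {δ : ℝ≥0∞} (hAδ : ∫⁻ y, ‖A y‖ₑ ≤ δ)
    (hAF : ∀ ξ, kernelFT A ξ * kernelFT (Φ l) ξ =
      ((Real.exp (-(R * ‖ξ‖ ^ 2)) : ℝ) : ℂ) * kernelFT (Φ l) ξ) :
    ∃ P : ℝ → Prop, (∀ᵐ t ∂volume.restrict (Ioi (0 : ℝ)), P t) ∧
      ∀ a b : ℝ, 0 ≤ a → P a → P b → b = a + R / κ →
        ∫⁻ x, ‖lpProj Φ l (θ b) x‖ₑ ∂cellMeasure d L ≤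
          2 * (δ * ∫⁻ x, ‖lpProj Φ l (θ a) x‖ₑ ∂cellMeasure d L) +
          2 * ∫⁻ r in Ioc a b, D * G * (∫⁻ x, ‖Dθ r x‖ₑ ^ 2 ∂cellMeasure d L) ^ (1 / 2 : ℝ) := by
  obtain ⟨S, hS⟩ := hΦ.exists_finset hL l
  obtain ⟨P, hP, hev⟩ := h.exists_ae_evolution hL hκ hu hs hG S hS hheat
  refine ⟨fun t => P t ∧ RegularTime L (u t) (θ t) (Dθ t), hP.and (h.ae_regularTime hu), ?_⟩
  rintro a b ha ⟨hPa, hra⟩ ⟨hPb, hrb⟩ hab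
  have hθm : ∀ t, Measurable (θ t) := fun t => h.measurable.comp measurable_prodMk_left
  have hpa := hra.lpProj_ae_eq hL (hθm a) (h.periodic a) l S hS
  have hpb := hrb.lpProj_ae_eq hL (hθm b) (h.periodic b) l S hS
  have hκb : κ * (b - a) = R := by rw [hab]; field_simp; ring
  have hle : a ≤ b := by rw [hab]; linarith [div_nonneg hR hκ.le]
  set T := ∫⁻ r in Ioc a b, D * G * (∫⁻ x, ‖Dθ r x‖ₑ ^ 2 ∂cellMeasure d L) ^ (1 / 2 : ℝ)
  set qa := ∫⁻ x, ‖lpProj Φ l (θ a) x‖ₑ ∂cellMeasure d L with hqa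
  have hstep : ∀ z : ℂ, ‖z‖ ≤ 1 → ∫⁻ x, ‖reTrig L S (fun m => z * (kernelFT (Φ l) (waveVector L m) *
            timeCoeff L θ m b)) x‖ₑ ∂cellMeasure d L ≤ δ * qa + T := by
    intro z hz
    refine (hev z hz a b ha hle hPa hPb hκb.le).trans ?_
    gcongr
    rw [hκb]
    -- On the band of `Φ l`, the heat flow over the whole window is convolution with `A`, so Young's
    -- inequality yields the factor `δ`.
    have hconv := lintegral_enorm_conv_le hL hA
      (measurable_trigPoly (L := L) S fun m => kernelFT (Φ l) (waveVector L m) * timeCoeff L θ m a)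
      (isPeriodic_trigPoly hL S _)
    refine le_trans (lintegral_mono fun x => ?_) (hconv.trans ?_)
    · refine (enorm_reTrig_le S _ hz x).trans_eq ?_
      rw [conv_trigPoly hAi]
      congr 1
      refine Finset.sum_congr rfl fun m _ => ?_
      rw [waveTransform_eq_kernelFT, ← mul_assoc, ← mul_assoc, hAF]
    · refine mul_le_mul' hAδ (le_of_eq (lintegral_congr_ae ?_))
      filter_upwards [hpa] with x hx
      rw [hx]
      rfl
  -- The projection is complex-valued, whereas the evolution estimate is for real functions.
  -- Treating real and imaginary parts separately costs the factor 2.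
  calc ∫⁻ x, ‖lpProj Φ l (θ b) x‖ₑ ∂cellMeasure d L
      ≤ ∫⁻ x, (‖reTrig L S (fun m => 1 * (kernelFT (Φ l) (waveVector L m) *
            timeCoeff L θ m b)) x‖ₑ + ‖reTrig L S (fun m => -Complex.I *
            (kernelFT (Φ l) (waveVector L m) * timeCoeff L θ m b)) x‖ₑ) ∂cellMeasure d L := by
        refine lintegral_mono_ae ?_
        filter_upwards [hpb] with x hx
        rw [hx]
        exact enorm_trigPoly_le S _ x
    _ ≤ (δ * qa + T) + (δ * qa + T) := by
        rw [lintegral_add_left]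
        · exact add_le_add (hstep 1 (by simp)) (hstep _ (by simp))
        · exact (contDiff_reTrig _ _).continuous.measurable.enorm
    _ = 2 * (δ * qa) + 2 * T := by ring

/-- A Littlewood--Paley projection of the scalar is controlled by its gradient. -/
theorem RegularTime.lintegral_lpProj_le (hL : 0 < L) (hΦ : IsLittlewoodPaleyFamily Φ)
    {v g : Space d → Space d} {f : Space d → ℝ}
    (h : RegularTime L v f g) (hf : Measurable f) (hfp : IsPeriodic L f) (hg : Measurable g)
    (hgp : IsPeriodic L g) (l : ℤ) :
    ∫⁻ x, ‖lpProj Φ l f x‖ₑ ∂cellMeasure d L ≤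
      2 * weightedNorm (Φ 0) * ENNReal.ofReal (((2 : ℝ) ^ l) ^ (-1 : ℝ)) *
        (∫⁻ x, ‖g x‖ₑ ^ 2 ∂cellMeasure d L) ^ (1 / 2 : ℝ) := by
  have hl : (0 : ℝ) < 2 ^ l := by positivity
  obtain ⟨S, hS⟩ := hΦ.exists_finset hL l
  have hm := measurable_dil ((2 : ℝ) ^ l) (measurable_schwartz (Φ 0))
  have hi := integrable_dil hl (measurable_schwartz (Φ 0)) (Φ 0).integrable
  have hgrad := lintegral_enorm_conv_le_gradient hL h.weakGradient hf hfp h.scalar_sq hg hgp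
    h.grad_sq hm hi (hΦ.integral_eq_zero l)
  have hw := lintegral_dil_rpow_le hl (s := 1) (by simp) (measurable_schwartz (Φ 0))
  simp only [Real.rpow_one] at hw
  refine le_trans (le_of_eq (lintegral_congr_ae ?_)) (hgrad.trans (mul_le_mul_left hw _))
  -- The gradient bound was obtained for the kernel `dil (2 ^ l) (Φ 0)`. Having the same transform
  -- as `Φ l`, it produces the same trigonometric polynomial a.e.
  have h1 := conv_ae_eq_trigPoly hL hm hi (Complex.measurable_ofReal.comp hf) (hfp.postcomp _)
    (h.integrable_scalar hL hf).2.ne S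
    (fun m hm => by rw [waveTransform_eq_kernelFT, ← hΦ.kernelFT_scaling, hS m hm])
  filter_upwards [h1, h.lpProj_ae_eq hL hf hfp l S hS] with x hx hx2
  rw [hx2]
  refine congrArg _ (Eq.trans ?_ hx.symm)
  refine Finset.sum_congr rfl fun m _ => ?_
  rw [waveTransform_eq_kernelFT, ← hΦ.kernelFT_scaling]
  rfl

end Recursion

/-! ### Weighted long-time averages. -/

section LongTime

open scoped Topology ComplexConjugate

/-- Pointwise domination carries over to weighted long-time averages. -/
theorem longTimeAvg_le_const_mul {φ : ℝ → ℝ} {q Y : ℝ → ℝ≥0∞} {K : ℝ≥0∞} (hK : K ≠ ⊤)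
    (h : ∀ᵐ t ∂volume.restrict (Ioi (0 : ℝ)), q t ≤ K * Y t) :
    longTimeAvg φ q ≤ K * longTimeAvg φ Y := by
  rw [longTimeAvg, longTimeAvg, ← ENNReal.limsup_const_mul_of_ne_top hK]
  refine limsup_le_limsup (Eventually.of_forall fun T => ?_)
  simp only
  rw [mul_left_comm, ← lintegral_const_mul' _ _ hK]
  gcongr ENNReal.ofReal _ * ?_
  refine lintegral_mono_ae ?_
  filter_upwards [ae_restrict_of_ae_restrict_of_subset Ioc_subset_Ioi_self h] with t ht
  rw [← mul_assoc]
  gcongr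

theorem limsup_add_le_of_tendsto_zero {u v : ℝ → ℝ≥0∞} (hu : Tendsto u atTop (𝓝 0)) :
    limsup (fun T => u T + v T) atTop ≤ limsup v atTop := by
  refine ENNReal.le_of_forall_pos_le_add fun ε hε hv => ?_
  have hε2 : (0 : ℝ≥0∞) < ((ε / 2 : ℝ≥0) : ℝ≥0∞) := by
    rw [ENNReal.coe_pos]
    positivity
  refine limsup_le_of_le (h := ?_)
  filter_upwards [hu.eventually_lt_const hε2,
    eventually_lt_of_limsup_lt (ENNReal.lt_add_right hv.ne hε2.ne')] with T h1 h2
  calc u T + v T ≤ ((ε / 2 : ℝ≥0) : ℝ≥0∞) + (limsup v atTop + ((ε / 2 : ℝ≥0) : ℝ≥0∞)) :=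
        add_le_add h1.le h2.le
    _ = limsup v atTop + (((ε / 2 : ℝ≥0) : ℝ≥0∞) + ((ε / 2 : ℝ≥0) : ℝ≥0∞)) := by ring
    _ = limsup v atTop + ε := by rw [← ENNReal.coe_add, add_halves]

theorem tendsto_ofReal_inv_mul_const {c : ℝ≥0∞} (hc : c ≠ ⊤) :
    Tendsto (fun T : ℝ => ENNReal.ofReal T⁻¹ * c) atTop (𝓝 0) := by
  have h1 : Tendsto (fun T : ℝ => ENNReal.ofReal T⁻¹) atTop (𝓝 (ENNReal.ofReal 0)) :=
    (ENNReal.continuous_ofReal.tendsto 0).comp tendsto_inv_atTop_zero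
  rw [ENNReal.ofReal_zero] at h1
  simpa using ENNReal.Tendsto.mul_const h1 (Or.inr hc)

/-- Tonelli: a given `r` lies in the window `(a, a + τ]` only for `a ∈ [r - τ, r)`, a set of length
`τ`. -/
theorem lintegral_window_le {E : ℝ → ℝ≥0∞} (hE : Measurable E) {τ T : ℝ} :
    ∫⁻ a in Ioc 0 (T - τ), ∫⁻ r in Ioc a (a + τ), E r ≤
      ENNReal.ofReal τ * ∫⁻ r in Ioc 0 T, E r := by
  have hset : MeasurableSet {p : ℝ × ℝ | p.1 < p.2 ∧ p.2 ≤ p.1 + τ} :=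
    (measurableSet_lt measurable_fst measurable_snd).inter
      (measurableSet_le measurable_snd (measurable_fst.add_const τ))
  have h1 : ∀ a ∈ Ioc 0 (T - τ), ∫⁻ r in Ioc a (a + τ), E r =
      ∫⁻ r in Ioc 0 T, {p : ℝ × ℝ | p.1 < p.2 ∧ p.2 ≤ p.1 + τ}.indicator (fun p => E p.2) (a, r) := by
    intro a ha
    rw [← lintegral_indicator measurableSet_Ioc, ← lintegral_indicator measurableSet_Ioc]
    refine lintegral_congr fun r => ?_
    simp only [indicator, mem_Ioc, mem_ofPred_eq]
    by_cases hr : a < r ∧ r ≤ a + τ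
    · rw [if_pos hr, if_pos]
      exact ⟨ha.1.trans hr.1, by linarith [ha.2, hr.2]⟩
    · simp [if_neg hr]
  rw [setLIntegral_congr_fun measurableSet_Ioc h1, lintegral_lintegral_swap]
  · rw [← lintegral_const_mul _ hE]
    refine lintegral_mono fun r => ?_
    have h2 : ∀ a, {p : ℝ × ℝ | p.1 < p.2 ∧ p.2 ≤ p.1 + τ}.indicator (fun p => E p.2) (a, r) =
        (Ico (r - τ) r).indicator (fun _ => E r) a := by
      intro a
      simp only [indicator, mem_Ico, mem_ofPred_eq]
      refine if_congr ⟨fun h => ⟨by linarith [h.2], h.1⟩, fun h => ⟨h.2, by linarith [h.1]⟩⟩ rfl rfl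
    simp_rw [h2]
    refine (setLIntegral_le_lintegral _ _).trans_eq ?_
    rw [lintegral_indicator measurableSet_Ico, setLIntegral_const, Real.volume_Ico, mul_comm]
    simp
  · exact ((hE.comp measurable_snd).indicator hset).aemeasurable

/-- A quantity that is contracted over time windows of length `τ`, up to the integral of a source,
has a weighted long-time average controlled by the one of the source, if the weight is comparable on
such windows. -/
theorem longTimeAvg_le_of_recursion {φ : ℝ → ℝ} (hφ : MonotoneOn φ (Ici 0)) {q Y : ℝ → ℝ≥0∞}
    (hY : Measurable Y) (hYi : ∀ T, ∫⁻ t in Ioc 0 T, Y t ≠ ⊤) {K E δ : ℝ≥0∞} (hK : K ≠ ⊤)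
    (hE : E ≠ ⊤) (hδ : δ * ENNReal.ofReal (Real.exp 1) ≤ 1 / 2) {τ : ℝ} (hτ : 0 < τ)
    (hqY : ∀ᵐ t ∂volume.restrict (Ioi (0 : ℝ)), q t ≤ K * Y t)
    {P : ℝ → Prop} (hP : ∀ᵐ t ∂volume.restrict (Ioi (0 : ℝ)), P t)
    (hrec : ∀ a, 0 ≤ a → P a → P (a + τ) →
      q (a + τ) ≤ δ * q a + E * ∫⁻ r in Ioc a (a + τ), Y r)
    (hφτ : ∀ a, 0 ≤ a → φ (a + τ) ≤ φ a + 1) :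
    longTimeAvg φ q ≤
      2 * ENNReal.ofReal (Real.exp 1) * E * ENNReal.ofReal τ * longTimeAvg φ Y := by
  set g : ℝ → ℝ≥0∞ := fun t => ENNReal.ofReal (Real.exp (φ t)) with hg
  set e := ENNReal.ofReal (Real.exp 1) with he
  have hgτ : ∀ a, 0 ≤ a → g (a + τ) ≤ e * g a := by
    intro a ha
    rw [hg, he, ← ENNReal.ofReal_mul (Real.exp_pos _).le, ← Real.exp_add]
    refine ENNReal.ofReal_le_ofReal (Real.exp_le_exp.2 ?_)
    linarith [hφτ a ha]
  have hgmono : ∀ a r, 0 ≤ a → a ≤ r → g a ≤ g r := fun a r ha har =>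
    ENNReal.ofReal_le_ofReal (Real.exp_le_exp.2 (hφ ha (ha.trans har) har))
  have hfin : ∀ T, ∫⁻ t in Ioc 0 T, Y t * g t ≠ ⊤ := by
    intro T
    refine ne_top_of_le_ne_top (ENNReal.mul_ne_top (hYi T) (ENNReal.ofReal_ne_top (r :=
      Real.exp (φ T)))) ?_
    rw [← lintegral_mul_const' _ _ ENNReal.ofReal_ne_top]
    refine setLIntegral_mono' measurableSet_Ioc fun t ht => ?_
    gcongr
    exact hgmono t T ht.1.le ht.2
  -- Finiteness on bounded time intervals, the only purpose of `hqY` here, is what makes the later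
  -- absorption legitimate.
  have hqfin : ∀ T, ∫⁻ t in Ioc 0 T, q t * g t ≠ ⊤ := by
    intro T
    refine ne_top_of_le_ne_top (ENNReal.mul_ne_top hK (hfin T)) ?_
    rw [← lintegral_const_mul' _ _ hK]
    refine lintegral_mono_ae ?_
    filter_upwards [ae_restrict_of_ae_restrict_of_subset Ioc_subset_Ioi_self hqY] with t ht
    rw [← mul_assoc]
    gcongr
  -- a measurable version of the weight
  have hgm : ∃ g' : ℝ → ℝ≥0∞, Measurable g' ∧ ∀ t, 0 ≤ t → g' t = g t := by
    refine ⟨fun t => ENNReal.ofReal (Real.exp (φ (max t 0))), ?_, fun t ht => ?_⟩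
    · refine ENNReal.measurable_ofReal.comp (Real.measurable_exp.comp ?_)
      refine Monotone.measurable fun x y hxy => ?_
      exact hφ (le_max_right x 0) (le_max_right y 0) (max_le_max_right _ hxy)
    · simp only [max_eq_left ht, hg]
  obtain ⟨g', hg'm, hg'⟩ := hgm
  have hPτ : ∀ᵐ a ∂volume.restrict (Ioi (0 : ℝ)), P (a + τ) := by
    rw [ae_restrict_iff' measurableSet_Ioi] at hP ⊢
    filter_upwards [(measurePreserving_add_right volume τ).quasiMeasurePreserving.ae hP] with a ha
    intro h0
    exact ha (add_pos h0 hτ)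
  have hmain : ∀ T, ∫⁻ t in Ioc 0 T, q t * g t ≤
      2 * (∫⁻ t in Ioc 0 τ, q t * g t) +
        2 * e * E * ENNReal.ofReal τ * ∫⁻ t in Ioc 0 T, Y t * g t := by
    intro T
    have hsplit : ∫⁻ t in Ioc 0 T, q t * g t ≤
        (∫⁻ t in Ioc 0 τ, q t * g t) + ∫⁻ t in Ioc τ T, q t * g t := by
      refine (lintegral_mono_set (t := Ioc 0 τ ∪ Ioc τ T) ?_).trans (lintegral_union_le _ _ _)
      intro t ht
      rcases le_or_gt t τ with h | h
      · exact Or.inl ⟨ht.1, h⟩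
      · exact Or.inr ⟨h, ht.2⟩
    have hshift : ∫⁻ t in Ioc τ T, q t * g t =
        ∫⁻ a in Ioc 0 (T - τ), q (a + τ) * g (a + τ) := by
      rw [← lintegral_indicator measurableSet_Ioc, ← lintegral_indicator measurableSet_Ioc,
        ← lintegral_add_right_eq_self _ τ]
      refine lintegral_congr fun a => ?_
      simp only [indicator, mem_Ioc]
      refine if_congr ⟨fun h => ⟨by linarith [h.1], by linarith [h.2]⟩,
        fun h => ⟨by linarith [h.1], by linarith [h.2]⟩⟩ rfl rfl
    -- The weight at `a + τ` is at most `e` times the weight at `a`, hence also at most `e` times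
    -- the weight at any later `r` in the window. By `hδ` the first term keeps the factor `1 / 2`.
    have hbound : ∫⁻ a in Ioc 0 (T - τ), q (a + τ) * g (a + τ) ≤
        ∫⁻ a in Ioc 0 (T - τ), ((1 / 2) * (q a * g a) +
          ∫⁻ r in Ioc a (a + τ), E * e * (Y r * g' r)) := by
      refine lintegral_mono_ae ?_
      filter_upwards [ae_restrict_mem measurableSet_Ioc,
        ae_restrict_of_ae_restrict_of_subset Ioc_subset_Ioi_self hP,
        ae_restrict_of_ae_restrict_of_subset Ioc_subset_Ioi_self hPτ] with a ha h1 h2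
      have ha0 := ha.1.le
      refine (mul_le_mul_left (hrec a ha0 h1 h2) _).trans ?_
      rw [add_mul]
      refine add_le_add ?_ ?_
      · calc δ * q a * g (a + τ) ≤ δ * q a * (e * g a) := by gcongr; exact hgτ a ha0
          _ = (δ * e) * (q a * g a) := by ring
          _ ≤ _ := by gcongr
      · rw [← lintegral_const_mul' _ _ hE, ← lintegral_mul_const' _ _ ENNReal.ofReal_ne_top]
        refine setLIntegral_mono' measurableSet_Ioc fun r hr => ?_
        rw [hg' r (ha0.trans hr.1.le)]
        calc E * Y r * g (a + τ) ≤ E * Y r * (e * g r) := by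
              gcongr
              exact (hgτ a ha0).trans (mul_le_mul_right (hgmono a r ha0 hr.1.le) _)
          _ = _ := by ring
    have hEm : Measurable fun r => E * e * (Y r * g' r) := measurable_const.mul (hY.mul hg'm)
    have hwin := lintegral_window_le hEm (T := T) (τ := τ)
    have hcong : ∫⁻ r in Ioc 0 T, E * e * (Y r * g' r) = E * e * ∫⁻ r in Ioc 0 T, Y r * g r := by
      rw [← lintegral_const_mul' _ _ (ENNReal.mul_ne_top hE ENNReal.ofReal_ne_top)]
      refine setLIntegral_congr_fun measurableSet_Ioc fun r hr => ?_
      simp only [hg' r hr.1.le, he]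
    -- As `q` is not assumed measurable, splitting the integral of the sum relies on measurability
    -- of the window term.
    have hinner : Measurable fun a => ∫⁻ r in Ioc a (a + τ), E * e * (Y r * g' r) := by
      have : (fun a => ∫⁻ r in Ioc a (a + τ), E * e * (Y r * g' r)) = fun a =>
          ∫⁻ r, {p : ℝ × ℝ | p.1 < p.2 ∧ p.2 ≤ p.1 + τ}.indicator
            (fun p => E * e * (Y p.2 * g' p.2)) (a, r) := by
        ext a
        rw [← lintegral_indicator measurableSet_Ioc]
        rfl
      rw [this]
      refine Measurable.lintegral_prod_right' ((hEm.comp measurable_snd).indicator ?_)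
      exact (measurableSet_lt measurable_fst measurable_snd).inter
        (measurableSet_le measurable_snd (measurable_fst.add_const τ))
    rw [lintegral_add_right _ hinner, lintegral_const_mul' _ _ (by simp)] at hbound
    rw [hcong] at hwin
    have hsub : ∫⁻ a in Ioc 0 (T - τ), q a * g a ≤ ∫⁻ a in Ioc 0 T, q a * g a :=
      lintegral_mono_set (Ioc_subset_Ioc_right (by linarith))
    set I := ∫⁻ t in Ioc 0 T, q t * g t with hI
    set c0 := ∫⁻ t in Ioc 0 τ, q t * g t
    set J := ∫⁻ r in Ioc 0 T, Y r * g r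
    -- `c0` is the contribution of the first window, which the recursion does not reach; half of the
    -- finite `I` is then absorbed.
    have hfinal : I ≤ 1 / 2 * I + (c0 + ENNReal.ofReal τ * (E * e * J)) := by
      calc I ≤ c0 + (1 / 2 * I + ENNReal.ofReal τ * (E * e * J)) := by
            refine hsplit.trans (add_le_add le_rfl ?_)
            rw [hshift]
            exact hbound.trans (add_le_add (mul_le_mul_right hsub _) hwin)
        _ = _ := by ring
    have hIfin := hqfin T
    have h2 : 1 / 2 * I + 1 / 2 * I = I := by
      rw [← add_mul, one_div, ENNReal.inv_two_add_inv_two, one_mul]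
    have h3 : 1 / 2 * I ≤ c0 + ENNReal.ofReal τ * (E * e * J) := by
      refine (ENNReal.add_le_add_iff_left (a := 1 / 2 * I) (ENNReal.mul_ne_top (by simp) hIfin)).1 ?_
      rw [h2]
      exact hfinal
    calc I = 1 / 2 * I + 1 / 2 * I := h2.symm
      _ ≤ _ := add_le_add h3 h3
      _ = _ := by ring
  -- The first window contributes a finite constant, which disappears after division by `T`.
  rw [longTimeAvg, longTimeAvg, ← ENNReal.limsup_const_mul_of_ne_top]
  · refine (limsup_le_limsup (Eventually.of_forall fun T => ?_)).trans
      (limsup_add_le_of_tendsto_zero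
        (tendsto_ofReal_inv_mul_const (c := 2 * ∫⁻ t in Ioc 0 τ, q t * g t) (ENNReal.mul_ne_top ENNReal.ofNat_ne_top (hqfin τ))))
    calc _ ≤ ENNReal.ofReal T⁻¹ * _ := mul_le_mul_right (hmain T) _
      _ = _ := by ring
  · exact ENNReal.mul_ne_top (ENNReal.mul_ne_top (ENNReal.mul_ne_top (by simp)
      ENNReal.ofReal_ne_top) hE) ENNReal.ofReal_ne_top

/-- The increment of a time weight exponent over a time window. -/
theorem IsTimeWeight.le_add_one {φ : ℝ → ℝ} (hφ : IsTimeWeight φ) {τ : ℝ} (hτ : 0 < τ)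
    (h : eLpNorm (deriv φ) ⊤ (volume.restrict (Ioi (0 : ℝ))) * ENNReal.ofReal τ ≤ 1) {a : ℝ}
    (ha : 0 ≤ a) : φ (a + τ) ≤ φ a + 1 := by
  set M := eLpNorm (deriv φ) ⊤ (volume.restrict (Ioi (0 : ℝ))) with hM
  have hac : AbsolutelyContinuousOnInterval φ a (a + τ) := by
    refine (hφ.absCont (a + τ) (by positivity)).mono ?_
    rw [uIcc_of_le (by linarith), uIcc_of_le (by linarith)]
    exact Icc_subset_Icc_left ha
  have h1 := hac.integral_deriv_eq_sub
  rw [intervalIntegral.integral_of_le (by linarith)] at h1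
  have h2 : ‖∫ t in Ioc a (a + τ), deriv φ t‖ₑ ≤ M * ENNReal.ofReal τ := by
    refine (enorm_integral_le_lintegral_enorm _).trans ?_
    have h3 : ∀ᵐ t ∂volume.restrict (Ioc a (a + τ)), ‖deriv φ t‖ₑ ≤ M := by
      refine ae_restrict_of_ae_restrict_of_subset (t := Ioi 0)
        (fun r hr => ha.trans_lt hr.1) ?_
      rw [hM, eLpNorm_exponent_top]
      exact ae_le_eLpNormEssSup
    refine (lintegral_mono_ae h3).trans_eq ?_
    rw [setLIntegral_const, Real.volume_Ioc]
    congr 2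
    ring
  have h4 := h2.trans h
  rw [h1, ← ofReal_norm, ENNReal.ofReal_le_one, Real.norm_eq_abs] at h4
  linarith [le_abs_self (φ (a + τ) - φ a)]

end LongTime

end PassiveScalar

end

/-! ### The main estimate. -/

theorem theorem1 (d : ℕ) (hd : 1 ≤ d) (Φ : ℤ → 𝓢(PassiveScalar.Space d, ℂ))
    (hΦ : PassiveScalar.IsLittlewoodPaleyFamily Φ) :
    ∃ C : ℝ≥0, ∀ (L κ s : ℝ), 0 < L → 0 < κ → s ∈ Icc (0 : ℝ) 1 →
      ∀ (u : ℝ → PassiveScalar.Space d → PassiveScalar.Space d) (G : ℝ≥0),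
        PassiveScalar.IsVelocityField L u →
        (∀ᵐ t ∂volume.restrict (Ioi (0 : ℝ)),
          PassiveScalar.fracGradSq L s (u t) ^ (1 / 2 : ℝ) = (G : ℝ≥0∞)) →
      ∀ (θ₀ : PassiveScalar.Space d → ℝ) (θ : ℝ → PassiveScalar.Space d → ℝ)
        (Dθ : ℝ → PassiveScalar.Space d → PassiveScalar.Space d),
        PassiveScalar.IsWeakSolution L κ u θ₀ θ Dθ →
      ∀ φ : ℝ → ℝ, PassiveScalar.IsTimeWeight φ →
      ∀ l : ℤ,
        PassiveScalar.longTimeAvg φ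
            (fun t => PassiveScalar.spaceAvg L fun x => ‖PassiveScalar.lpProj Φ l (θ t) x‖ₑ)
          ≤ (C : ℝ≥0∞) * ENNReal.ofReal κ⁻¹ *
            (ENNReal.ofReal ((2 : ℝ) ^ (-(s + 2) * (l : ℝ))) * (G : ℝ≥0∞)
              + ENNReal.ofReal ((2 : ℝ) ^ (-3 * (l : ℝ))) *
                eLpNorm (deriv φ) ∞ (volume.restrict (Ioi (0 : ℝ)))) *
            PassiveScalar.longTimeAvg φ
              (fun t => (PassiveScalar.spaceAvg L fun x => ‖Dθ t x‖ₑ ^ 2) ^ (1 / 2 : ℝ)) := by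
  -- The recursion doubles δ and the weight costs a factor `e`, so this choice leaves exactly `1 /
  -- 2`.
  obtain ⟨N, hN, hA⟩ := hΦ.exists_contracting_kernel (δ := (4 * Real.exp 1)⁻¹) (by positivity)
  obtain ⟨C₂, hheat⟩ := hΦ.exists_heat_kernel hN
  have hw := PassiveScalar.weightedNorm_schwartz_ne_top (Φ 0)
  set W := 2 * (PassiveScalar.weightedNorm (Φ 0)).toNNReal with hWdef
  have hW : 2 * PassiveScalar.weightedNorm (Φ 0) = (W : ℝ≥0∞) := by
    rw [hWdef, ENNReal.coe_mul, ENNReal.coe_toNNReal hw]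
    rfl
  have hN0 : 0 < N := by linarith
  -- The first summand serves rapidly growing weights, the second slowly growing ones.
  refine ⟨W * N.toNNReal + 4 * (Real.exp 1).toNNReal * C₂ * N.toNNReal, ?_⟩
  intro L κ s hL hκ hs u G hu hG θ₀ θ Dθ h φ hφ l
  have hl : (0 : ℝ) < 2 ^ l := by positivity
  set lam : ℝ := (2 : ℝ) ^ l with hlam
  set Y : ℝ → ℝ≥0∞ :=
    fun t => (PassiveScalar.spaceAvg L fun x => ‖Dθ t x‖ₑ ^ 2) ^ (1 / 2 : ℝ) with hY
  set q : ℝ → ℝ≥0∞ :=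
    fun t => PassiveScalar.spaceAvg L fun x => ‖PassiveScalar.lpProj Φ l (θ t) x‖ₑ with hq
  set M := eLpNorm (deriv φ) ⊤ (volume.restrict (Ioi (0 : ℝ))) with hM
  have hpow : ∀ r : ℝ, (2 : ℝ) ^ (r * (l : ℝ)) = lam ^ r := by
    intro r
    rw [hlam, mul_comm, Real.rpow_mul (by norm_num), Real.rpow_intCast]
  have hYeq : ∀ t, Y t =
      (∫⁻ x, ‖Dθ t x‖ₑ ^ 2 ∂PassiveScalar.cellMeasure d L) ^ (1 / 2 : ℝ) := fun t => by
    simp only [hY, PassiveScalar.spaceAvg_eq_lintegral]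
  have hqY : ∀ᵐ t ∂volume.restrict (Ioi (0 : ℝ)),
      q t ≤ W * ENNReal.ofReal (lam ^ (-1 : ℝ)) * Y t := by
    filter_upwards [h.ae_regularTime hu] with t ht
    rw [hYeq, ← hW]
    simp only [hq, PassiveScalar.spaceAvg_eq_lintegral]
    exact ht.lintegral_lpProj_le hL hΦ (h.measurable.comp measurable_prodMk_left) (h.periodic t)
      (h.grad_measurable.comp measurable_prodMk_left) (h.grad_periodic t) l
  -- Over this time the diffusion contracts frequencies of size `lam` by the chosen δ.
  set τ : ℝ := N / lam ^ 2 / κ with hτdef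
  have hτ : 0 < τ := by positivity
  have hKtop : W * ENNReal.ofReal (lam ^ (-1 : ℝ)) ≠ ⊤ :=
    ENNReal.mul_ne_top ENNReal.coe_ne_top ENNReal.ofReal_ne_top
  have hNc : ((N.toNNReal : ℝ≥0) : ℝ≥0∞) = ENNReal.ofReal N := rfl
  have hec : (((Real.exp 1).toNNReal : ℝ≥0) : ℝ≥0∞) = ENNReal.ofReal (Real.exp 1) := rfl
  have hrp : ∀ r : ℝ, lam ^ (r - 2) = lam ^ r * (lam ^ 2)⁻¹ := by
    intro r
    rw [Real.rpow_sub hl, div_eq_mul_inv, Real.rpow_ofNat]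
  rw [hpow, hpow]
  -- If the weight exponent may grow by more than 1 in a window, `q ≤ W lam⁻¹ Y` is multiplied by `M
  -- τ ≥ 1`, giving the term with `lam⁻³ M`. Otherwise the recursion gives the term with `lam ^ (-(s
  -- + 2)) G`.
  rcases le_total 1 (M * ENNReal.ofReal τ) with hbig | hsmall
  · refine (PassiveScalar.longTimeAvg_le_const_mul hKtop hqY).trans ?_
    gcongr ?_ * _
    have e1 : W * ENNReal.ofReal (lam ^ (-1 : ℝ)) * (M * ENNReal.ofReal τ) =
        (W * ENNReal.ofReal N) * ENNReal.ofReal κ⁻¹ * (ENNReal.ofReal (lam ^ (-3 : ℝ)) * M) := by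
      have : ENNReal.ofReal (lam ^ (-1 : ℝ)) * ENNReal.ofReal τ =
          ENNReal.ofReal N * ENNReal.ofReal κ⁻¹ * ENNReal.ofReal (lam ^ (-3 : ℝ)) := by
        rw [← ENNReal.ofReal_mul (by positivity), ← ENNReal.ofReal_mul hN0.le,
          ← ENNReal.ofReal_mul (by positivity), show (-3 : ℝ) = -1 - 2 by norm_num, hrp, hτdef]
        congr 1
        field_simp
      calc _ = W * M * (ENNReal.ofReal (lam ^ (-1 : ℝ)) * ENNReal.ofReal τ) := by ring
        _ = _ := by rw [this]; ring
    calc W * ENNReal.ofReal (lam ^ (-1 : ℝ))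
        ≤ W * ENNReal.ofReal (lam ^ (-1 : ℝ)) * (M * ENNReal.ofReal τ) := le_mul_of_one_le_right' hbig
      _ = _ := e1
      _ ≤ _ := by
        refine mul_le_mul' (mul_le_mul_left ?_ _) le_add_self
        push_cast
        rw [hNc]
        exact le_self_add
  · obtain ⟨A, hAm, hAi, hAδ, hAF⟩ := hA l
    have hYm : Measurable Y := by
      have : Y = fun t => (∫⁻ x, ‖Dθ t x‖ₑ ^ 2 ∂PassiveScalar.cellMeasure d L) ^ (1 / 2 : ℝ) :=
        funext hYeq
      rw [this]
      exact (PassiveScalar.measurable_lintegral_sq h.grad_measurable).pow_const _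
    have hYi : ∀ T, ∫⁻ t in Ioc 0 T, Y t ≠ ⊤ := by
      intro T
      rw [setLIntegral_congr Ioo_ae_eq_Ioc.symm]
      have h1 : ∫⁻ t in Ioo 0 T, Y t ≤ ∫⁻ t in Ioo 0 T,
          (1 + ∫⁻ x, ‖Dθ t x‖ₑ ^ 2 ∂PassiveScalar.cellMeasure d L) := by
        refine lintegral_mono fun t => ?_
        rw [hYeq]
        refine (ENNReal.rpow_le_rpow (le_add_self (b := 1)) (by norm_num)).trans ?_
        conv_rhs => rw [← ENNReal.rpow_one (1 + _)]
        exact ENNReal.rpow_le_rpow_of_exponent_le le_self_add (by norm_num)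
      refine ne_top_of_le_ne_top ?_ h1
      rw [lintegral_add_left measurable_const]
      refine ENNReal.add_ne_top.2 ⟨by simp, ?_⟩
      exact h.grad_sqIntegrable.lintegral_ne_top h.grad_measurable T
    obtain ⟨P, hP, hrec⟩ := h.exists_ae_recursion hL hκ hu hΦ hs hG l
      (R := N / lam ^ 2) (D := C₂ * ENNReal.ofReal (lam ^ (-s))) (by positivity)
      (fun ρ hρ hρR => by
        obtain ⟨k, h1, h2, h3, h4⟩ := hheat l ρ hρ ((le_div_iff₀ (by positivity)).1 hρR)
        exact ⟨k, h1, h2, h3, h4 s hs⟩) hAm hAi hAδ hAF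
    set D : ℝ≥0∞ := C₂ * ENNReal.ofReal (lam ^ (-s)) with hD
    have hDG : D * G ≠ ⊤ := ENNReal.mul_ne_top
      (ENNReal.mul_ne_top ENNReal.coe_ne_top ENNReal.ofReal_ne_top) ENNReal.coe_ne_top
    refine (PassiveScalar.longTimeAvg_le_of_recursion hφ.monotone hYm hYi hKtop
      (E := 2 * (D * G)) (δ := 2 * ENNReal.ofReal (4 * Real.exp 1)⁻¹)
      (ENNReal.mul_ne_top ENNReal.ofNat_ne_top hDG) ?_ hτ hqY hP ?_
      fun a ha => hφ.le_add_one hτ hsmall ha).trans ?_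
    · rw [mul_assoc, ← ENNReal.ofReal_mul (by positivity),
        show (2 : ℝ≥0∞) = ENNReal.ofReal 2 by simp, ← ENNReal.ofReal_mul (by norm_num),
        show (2 : ℝ) * ((4 * Real.exp 1)⁻¹ * Real.exp 1) = 2⁻¹ by field_simp; norm_num,
        ENNReal.ofReal_inv_of_pos (by norm_num)]
      simp
    · intro a ha hPa hPb
      have h1 := hrec a (a + τ) ha hPa hPb rfl
      simp only [← hYeq] at h1
      rw [lintegral_const_mul' _ _ hDG] at h1
      simp only [hq, PassiveScalar.spaceAvg_eq_lintegral]
      refine h1.trans_eq ?_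
      ring
    · gcongr ?_ * _
      have e1 : ENNReal.ofReal (lam ^ (-s)) * ENNReal.ofReal τ =
          ENNReal.ofReal N * ENNReal.ofReal κ⁻¹ * ENNReal.ofReal (lam ^ (-(s + 2))) := by
        rw [← ENNReal.ofReal_mul (by positivity), ← ENNReal.ofReal_mul hN0.le,
          ← ENNReal.ofReal_mul (by positivity), show -(s + 2) = -s - 2 by ring, hrp, hτdef]
        congr 1
        field_simp
      calc 2 * ENNReal.ofReal (Real.exp 1) * (2 * (D * G)) * ENNReal.ofReal τ
          = 4 * ENNReal.ofReal (Real.exp 1) * C₂ * G *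
              (ENNReal.ofReal (lam ^ (-s)) * ENNReal.ofReal τ) := by rw [hD]; ring
        _ = (4 * ENNReal.ofReal (Real.exp 1) * C₂ * ENNReal.ofReal N) * ENNReal.ofReal κ⁻¹ *
              (ENNReal.ofReal (lam ^ (-(s + 2))) * G) := by rw [e1]; ring
        _ ≤ _ := by
          refine mul_le_mul' (mul_le_mul_left ?_ _) le_self_add
          push_cast
          rw [hNc, hec]
          exact le_add_self
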